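/- Let $\mathcal X,\mathcal Y,\mathcal Z,\hat{\mathcal X}$ be finite alphabets, $P_X$ a distribution on $\mathcal X$, $P_{Y|X}$ and $P_{Z|X}$ discrete memoryless channels, and $d:\mathcal X\times\hat{\mathcal X}\to[0,\infty)$ a distortion measure with $d(x^n,\hat x^n)=\frac1n\sum_{i=1}^n d(x_i,\hat x_i)$; logarithms are natural. A code of blocklength $n$ consists of positive integers $M,L$ and functions $f:\mathcal Y^n\to\{1,\dots,L\}$, $g:\{1,\dots,L\}^M\times\mathcal Z^n\to\{1,\dots,M\}$ and $h:\{1,\dots,L\}\times\mathcal Z^n\to\hat{\mathcal X}^n$. The vectors $X^n(1),\dots,X^n(M)$ are independent with law $P_X^n$, $Y^n(m)$ is the output of the memoryless channel $P_{Y|X}$ with input $X^n(m)$, independently for each $m$, and $S(m)=f(Y^n(m))$. The index $W$ is uniform on $\{1,\dots,M\}$ and independent of all these, and $Z^n$ is the output of the memoryless channel $P_{Z|X}$ with input $X^n(W)$. Put $\hat W=g(S(1),\dots,S(M),Z^n)$, $\hat X^n=h(S(\hat W),Z^n)$, $$\mathrm P_{\rm e}^{(n)}(D)=\Pr\{\hat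 W\ne W\text{ or }d(X^n(W),\hat X^n)>D\},\qquad \mathrm P_{\rm c}^{(n)}(D)=1-\mathrm P_{\rm e}^{(n)}(D).$$ A triple $(R^{\rm i},R^{\rm c},D)\in\mathbb R^3$ is $\varepsilon$-achievable if there is a sequence of codes, one for each $n$, with $$\liminf_{n\to\infty}\tfrac1n\log M\ge R^{\rm i},\qquad \limsup_{n\to\infty}\tfrac1n\log L\le R^{\rm c},\qquad \limsup_{n\to\infty}\mathrm P_{\rm e}^{(n)}(D)\le\varepsilon .$$ Let $\mathcal R(\varepsilon)$ be the closure of the set of $\varepsilon$-achievable triples and $\mathcal R=\bigcap_{\varepsilon\in(0,1)}\mathcal R(\varepsilon)$. Let $\mathcal R^*$ be the set of triples $(R^{\rm i},R^{\rm c},D)\in\mathbb R^3$ for which there are random variables $(X,Y,Z,U,\hat X)$ such that $U$ takes values in a set of at most $|\mathcal Y|+2$ elements, $X,Y,Z$ have $P_X$, $P_{Y|X}$, $P_{Z|X}$ as distribution and channels, $Z-X-Y-U$ is a Markov chain, $\hat X=\phi(U,Z)$ for a function $\phi$, and $$R^{\rm i}\le I(U;Z),\qquad R^{\rm c}-R^{\rm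 i}\ge I(U;Y|Z),\qquad D\ge\mathbb E[d(X,\hat X)].$$ **Theorem (exponential strong converse).** (a) Suppose a sequence of codes satisfies $\limsup_{n\to\infty}\frac1n\log L\le R^{\rm c}$ and $\liminf_{n\to\infty}\frac1n\log M\ge R^{\rm i}$, and let $D\in\mathbb R$. If $(R^{\rm i},R^{\rm c},D)\notin\mathcal R$, then $\mathrm P_{\rm c}^{(n)}(D)$ decays to zero exponentially fast: there is $\gamma>0$ with $\mathrm P_{\rm c}^{(n)}(D)\le e^{-\gamma n}$ for all sufficiently large $n$. (b) For every $\varepsilon\in[0,1)$, $\mathcal R(\varepsilon)=\mathcal R^*$ as regions of triples with $R^{\rm i}\ge 0$; that is, for all $(R^{\rm i},R^{\rm c},D)$ with $R^{\rm i}\ge0$, $(R^{\rm i},R^{\rm c},D)\in\mathcal R(\varepsilon)$ if and only if $(R^{\rm i},R^{\rm c},D)\in\mathcal R^*$. -/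

import Mathlib

open Filter Topology

noncomputable section

namespace ContentId

/-- The data of the problem on the alphabets `X`, `Y`, `Z`, `Xh`: the source distribution `P_X`,
the two memoryless channels `P_{Y|X}` and `P_{Z|X}` (`PYX x y` is `P_{Y|X}(y|x)`), and the
distortion measure `d : X × Xh → [0, ∞)`. -/
structure Model (X Y Z Xh : Type*) [Fintype X] [Fintype Y] [Fintype Z] where
  PX : X → ℝ
  PYX : X → Y → ℝ
  PZX : X → Z → ℝ
  d : X → Xh → ℝ
  PX_mem : PX ∈ stdSimplex ℝ X
  PYX_mem : ∀ x, PYX x ∈ stdSimplex ℝ Y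
  PZX_mem : ∀ x, PZX x ∈ stdSimplex ℝ Z
  d_nonneg : ∀ x xh, 0 ≤ d x xh

/-- A code of blocklength `n`, with `M` enrolled items and `L` stored messages: the encoding
function `f : Y^n → {1..L}`, the identification function `g : {1..L}^M × Z^n → {1..M}` and the
reproduction function `h : {1..L} × Z^n → Xh^n`. -/
structure Code (Y Z Xh : Type*) (n : ℕ) where
  M : ℕ
  L : ℕ
  M_pos : 0 < M
  L_pos : 0 < L
  f : (Fin n → Y) → Fin L
  g : (Fin M → Fin L) → (Fin n → Z) → Fin M
  h : Fin L → (Fin n → Z) → (Fin n → Xh)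

section Operational

variable {X Y Z Xh : Type*} [Fintype X] [Fintype Y] [Fintype Z]

/-- The distortion of blocks, `d(x^n, xh^n) = (1/n) ∑ i, d(x_i, xh_i)`. -/
def Model.blockDist (P : Model X Y Z Xh) {n : ℕ} (x : Fin n → X) (xh : Fin n → Xh) : ℝ :=
  (1 / (n : ℝ)) * ∑ i, P.d (x i) (xh i)

/-- The probability of `W = w`, `X^n(m) = x m` and `Y^n(m) = y m` for all `m`, and `Z^n = z`:
`W` is uniform on the `M` indices, the pairs `(X_i(m), Y_i(m))` are i.i.d. with law
`P_X × P_{Y|X}` and independent of `W`, and `Z^n` is the output of the channel `P_{Z|X}`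
with input `X^n(W)`. -/
def Model.jointProb (P : Model X Y Z Xh) {n M : ℕ} (w : Fin M)
    (x : Fin M → Fin n → X) (y : Fin M → Fin n → Y) (z : Fin n → Z) : ℝ :=
  (1 / (M : ℝ)) * (∏ m, ∏ i, P.PX (x m i) * P.PYX (x m i) (y m i)) * ∏ i, P.PZX (x w i) (z i)

/-- The estimate of the index, `g(S(1), …, S(M), z)` where `S(m) = f(y m)`. -/
def Code.estimate {n : ℕ} (C : Code Y Z Xh n) (y : Fin C.M → Fin n → Y) (z : Fin n → Z) :
    Fin C.M :=
  C.g (fun m => C.f (y m)) z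

/-- The reproduction, `h(S(w'), z)` where `w'` is the estimate of the index. -/
def Code.reproduction {n : ℕ} (C : Code Y Z Xh n) (y : Fin C.M → Fin n → Y) (z : Fin n → Z) :
    Fin n → Xh :=
  C.h (C.f (y (C.estimate y z))) z

open Classical in
/-- The joint identification-error and excess-distortion probability: the probability that the
estimate of the index differs from `W` or the distortion between `X^n(W)` and the reproduction
exceeds `D`. -/
def Model.errorProb (P : Model X Y Z Xh) {n : ℕ} (C : Code Y Z Xh n) (D : ℝ) : ℝ :=
  ∑ w : Fin C.M, ∑ x : Fin C.M → Fin n → X, ∑ y : Fin C.M → Fin n → Y, ∑ z : Fin n → Z,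
    if C.estimate y z ≠ w ∨ D < P.blockDist (x w) (C.reproduction y z)
    then P.jointProb w x y z else 0

/-- The probability of correct decoding. -/
def Model.correctProb (P : Model X Y Z Xh) {n : ℕ} (C : Code Y Z Xh n) (D : ℝ) : ℝ :=
  1 - P.errorProb C D

/-- The rate conditions `liminf (1/n) log M ≥ Ri` and `limsup (1/n) log L ≤ Rc` on a sequence of
codes; the limits are taken in the extended reals, as `(1/n) log M` may be unbounded. -/
def HasRates (C : ∀ n, Code Y Z Xh n) (Ri Rc : ℝ) : Prop :=
  (Ri : EReal) ≤ liminf (fun n : ℕ => (((1 / (n : ℝ)) * Real.log (C n).M : ℝ) : EReal)) atTop ∧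
  limsup (fun n : ℕ => (((1 / (n : ℝ)) * Real.log (C n).L : ℝ) : EReal)) atTop ≤ (Rc : EReal)

/-- The triple `(Ri, Rc, D)` is `ε`-achievable. -/
def Model.Achievable (P : Model X Y Z Xh) (ε Ri Rc D : ℝ) : Prop :=
  ∃ C : ∀ n, Code Y Z Xh n, HasRates C Ri Rc ∧
    limsup (fun n : ℕ => ((P.errorProb (C n) D : ℝ) : EReal)) atTop ≤ (ε : EReal)

/-- The `ε`-rate-distortion region: the closure of the set of `ε`-achievable triples. -/
def Model.epsRegion (P : Model X Y Z Xh) (ε : ℝ) : Set (ℝ × ℝ × ℝ) :=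
  closure {t | P.Achievable ε t.1 t.2.1 t.2.2}

/-- The rate-distortion region. -/
def Model.region (P : Model X Y Z Xh) : Set (ℝ × ℝ × ℝ) :=
  ⋂ ε ∈ Set.Ioo (0 : ℝ) 1, P.epsRegion ε

end Operational

section Information

variable {Ω α β γ : Type*} [Fintype Ω] [Fintype α] [Fintype β] [Fintype γ]

open Classical in
/-- The law of the random variable `A` when the finite space `Ω` has probability mass function
`Q`. -/
def law (Q : Ω → ℝ) (A : Ω → α) (a : α) : ℝ :=
  ∑ ω, if A ω = a then Q ω else 0

/-- The mutual information `I(A; B)` under `Q`, in nats. -/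
def mutualInfo (Q : Ω → ℝ) (A : Ω → α) (B : Ω → β) : ℝ :=
  ∑ a, ∑ b, law Q (fun ω => (A ω, B ω)) (a, b) *
    Real.log (law Q (fun ω => (A ω, B ω)) (a, b) / (law Q A a * law Q B b))

/-- The conditional mutual information `I(A; B | C)` under `Q`, in nats. -/
def condMutualInfo (Q : Ω → ℝ) (A : Ω → α) (B : Ω → β) (C : Ω → γ) : ℝ :=
  ∑ a, ∑ b, ∑ c, law Q (fun ω => (A ω, B ω, C ω)) (a, b, c) *
    Real.log (law Q (fun ω => (A ω, B ω, C ω)) (a, b, c) * law Q C c /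
      (law Q (fun ω => (A ω, C ω)) (a, c) * law Q (fun ω => (B ω, C ω)) (b, c)))

end Information

section SingleLetter

variable {X Y Z Xh : Type*} [Fintype X] [Fintype Y] [Fintype Z] [Fintype Xh]

open Classical in
/-- The set `P*` of joint laws `Q` of `(X, Y, Z, U, Xh)`, for the alphabet `U = {1..k}`, with
`Q_X = P_X`, `Q_{Y|X} = P_{Y|X}`, `Q_{Z|X} = P_{Z|X}`, the Markov chain `Z - X - Y - U`, and
`Xh = φ(U, Z)` for a function `φ`. Here `V y u` is `Q_{U|Y}(u|y)`. -/
def Model.testLaws (P : Model X Y Z Xh) (k : ℕ) : Set (X × Y × Z × Fin k × Xh → ℝ) :=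
  {Q | ∃ (V : Y → Fin k → ℝ) (φ : Fin k → Z → Xh), (∀ y, V y ∈ stdSimplex ℝ (Fin k)) ∧
    ∀ x y z u xh, Q (x, y, z, u, xh) =
      P.PX x * P.PYX x y * P.PZX x z * V y u * (if xh = φ u z then 1 else 0)}

/-- The region `R(Q)`: `Ri ≤ I(U; Z)`, `Rc - Ri ≥ I(U; Y | Z)` and `D ≥ E[d(X, Xh)]`. -/
def Model.regionOf (P : Model X Y Z Xh) {k : ℕ} (Q : X × Y × Z × Fin k × Xh → ℝ) :
    Set (ℝ × ℝ × ℝ) :=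
  {t | t.1 ≤ mutualInfo Q (fun ω => ω.2.2.2.1) (fun ω => ω.2.2.1) ∧
    condMutualInfo Q (fun ω => ω.2.2.2.1) (fun ω => ω.2.1) (fun ω => ω.2.2.1) ≤ t.2.1 - t.1 ∧
    ∑ ω, Q ω * P.d ω.1 ω.2.2.2.2 ≤ t.2.2}

/-- The single-letter region `R*`: the union of the regions `R(Q)` over all `Q` in `P*`, with
`|U| ≤ |Y| + 2`. -/
def Model.starRegion (P : Model X Y Z Xh) : Set (ℝ × ℝ × ℝ) :=
  {t | ∃ k : ℕ, k ≤ Fintype.card Y + 2 ∧ ∃ Q ∈ P.testLaws k, t ∈ P.regionOf Q}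

end SingleLetter

end ContentId

end

/-! Converse. Take the letters (X^n, Y^n, Z^n) of the item W and condition them on correct decoding.
The resulting law Q has density at most 1/P_c with respect to the i.i.d. law, and under Q the
distortion never exceeds D. So the entropy inequalities of a weak converse hold under Q up to
multiples of κ = -log P_c (`Model.exists_changed_measure`). The bound on log M rests on
`Model.sum_hitProb`: if Z^n were independent of the database, any code would identify with
probability exactly 1/M. Hence M · P_S · P_{Z^n} · (probability of identification) is a probability
law on (S, Z^n), to which Gibbs' inequality applies.

Single letters come from U_i = (S, Y^{i-1}, Z_{i+1}^n). Under Q the Markov conditions on X_i, Y_i,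
Z_i, U_i and the reproduction letter hold only approximately. The defect is a relative entropy,
`Model.markovGap`, and the sum over i of its averages over U_i is at most κ (`sum_markov_le`). Thus
a code with P_c ≥ e^{-γn} yields, at its own blocklength n, a mixture of conditional laws of (X, Y,
Z, Xh) that meets the single-letter constraints within 4γ (`Model.exists_mixture`). Carathéodory
bounds the number of components independently of n, the laws range over a compact set and the
functionals are continuous, so a limit point as γ → 0 meets the constraints exactly
(`Model.exists_limit_mixture`). A vanishing gap means that Xh depends on the letters only through
(U, Z), so a deterministic φ minimizing the conditional distortion does at least as well. A
linear-programming argument cuts the alphabet of U to |Y| + 2 (`exists_basic_solution`). The limit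
lies in R* itself, so no closure of R* is needed (`Model.mem_starRegion_of_codes`).

Direct part. Random codewords with law P_U^n are split into bins. An item is stored as the bin of a
codeword typical with its Y^n, and Z^n is matched to the bins. A union bound with Chernoff estimates
gives vanishing error for every rate pair allowed by I(U;Z) and I(U;Y|Z) = I(U;Y) - I(U;Z)
(`Model.achievable_of_test`).

Part (a): success that does not decay exponentially puts (max(Ri, 0), Rc, D) in R*, hence in R by
the direct part. Part (b): for ε < 1 the success probability stays bounded away from 0, so the same
converse applies. -/

noncomputable section

namespace ContentId

open Classical

/-! ### Entropy and Gibbs inequalities on finite spaces. -/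

section Entropy

variable {Ω Ω' α β γ δ : Type*} [Fintype Ω] [Fintype Ω']

/-- `Q` is a probability mass function. -/
structure IsPMF (Q : Ω → ℝ) : Prop where
  nonneg : ∀ ω, 0 ≤ Q ω
  sum_eq : ∑ ω, Q ω = 1

/-- The Shannon entropy of `A` under `Q`, in nats. -/
def ent (Q : Ω → ℝ) (A : Ω → α) : ℝ := -∑ ω, Q ω * Real.log (law Q A (A ω))

theorem law_nonneg {Q : Ω → ℝ} (hQ : ∀ ω, 0 ≤ Q ω) (A : Ω → α) (a : α) : 0 ≤ law Q A a :=
  Finset.sum_nonneg fun ω _ => by split_ifs <;> simp [hQ]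

theorem le_law {Q : Ω → ℝ} (hQ : ∀ ω, 0 ≤ Q ω) (A : Ω → α) (ω : Ω) : Q ω ≤ law Q A (A ω) := by
  have := Finset.single_le_sum (f := fun ω' => if A ω' = A ω then Q ω' else 0)
    (fun ω' _ => by split_ifs <;> simp [hQ]) (Finset.mem_univ ω)
  simpa [law] using this

theorem law_pos {Q : Ω → ℝ} (hQ : ∀ ω, 0 ≤ Q ω) (A : Ω → α) {ω : Ω} (h : 0 < Q ω) :
    0 < law Q A (A ω) := h.trans_le (le_law hQ A ω)

theorem law_eq_sum (Q : Ω → ℝ) (A : Ω → α) (a : α) :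
    law Q A a = ∑ ω, Q ω * if A ω = a then 1 else 0 := by simp [law]

theorem law_id (Q : Ω → ℝ) (ω : Ω) : law Q (fun ω => ω) ω = Q ω := by simp [law]

theorem exists_of_law_pos {Q : Ω → ℝ} {A : Ω → α} {a : α} (h : law Q A a ≠ 0) :
    ∃ ω, A ω = a ∧ Q ω ≠ 0 := by
  by_contra! hc
  exact h (Finset.sum_eq_zero fun ω _ => by split_ifs with h' <;> simp [*])

/-- Expectations of functions of `A` are sums against the law of `A`. -/
theorem sum_law [Fintype α] (Q : Ω → ℝ) (A : Ω → α) (F : α → ℝ) :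
    ∑ a, law Q A a * F a = ∑ ω, Q ω * F (A ω) := by
  simp only [law, Finset.sum_mul, ite_mul, zero_mul]
  rw [Finset.sum_comm]
  simp

theorem law_comp [Fintype α] (Q : Ω → ℝ) (A : Ω → α) (B : α → β) :
    law (law Q A) B = law Q (fun ω => B (A ω)) := by
  ext b
  have := sum_law Q A (fun a => if B a = b then 1 else 0)
  simpa [law] using this

theorem IsPMF.law [Fintype α] {Q : Ω → ℝ} (hQ : IsPMF Q) (A : Ω → α) : IsPMF (law Q A) :=
  ⟨law_nonneg hQ.nonneg A, by simpa [hQ.sum_eq] using sum_law Q A (fun _ => 1)⟩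

theorem law_congr {Q : Ω → ℝ} {A : Ω → α} {B : Ω → β} (h : ∀ ω ω', A ω = A ω' ↔ B ω = B ω')
    (ω : Ω) : law Q A (A ω) = law Q B (B ω) := by
  simp only [law, h]

/-- Entropy only depends on the partition induced by the random variable. -/
theorem ent_congr {Q : Ω → ℝ} {A : Ω → α} {B : Ω → β} (h : ∀ ω ω', A ω = A ω' ↔ B ω = B ω') :
    ent Q A = ent Q B := by
  simp only [ent, law_congr h]

theorem ent_law [Fintype β] (Q : Ω → ℝ) (B : Ω → β) (A : β → α) :
    ent (law Q B) A = ent Q (fun ω => A (B ω)) := by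
  simp only [ent, law_comp]
  rw [sum_law Q B (fun b => Real.log (law Q (fun ω => A (B ω)) (A b)))]

theorem ent_eq_sum [Fintype α] (Q : Ω → ℝ) (A : Ω → α) :
    ent Q A = ∑ a, Real.negMulLog (law Q A a) := by
  rw [ent, ← sum_law Q A (fun a => Real.log (law Q A a)), ← Finset.sum_neg_distrib]
  simp [Real.negMulLog]

/-- Gibbs' inequality on the log-ratio: if `r` is a positive weight on the support of `Q` with
`∑ Q · r ≤ 1` then `∑ Q log r ≤ 0`. -/
theorem sum_mul_log_le {Q : Ω → ℝ} (hQ : IsPMF Q) (r : Ω → ℝ) (hr : ∀ ω, 0 < Q ω → 0 < r ω)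
    (hs : ∑ ω, Q ω * r ω ≤ 1) : ∑ ω, Q ω * Real.log (r ω) ≤ 0 := by
  have : ∑ ω, Q ω * Real.log (r ω) ≤ ∑ ω, (Q ω * r ω - Q ω) := by
    refine Finset.sum_le_sum fun ω _ => ?_
    rcases (hQ.nonneg ω).eq_or_lt with h | h
    · simp [← h]
    · have := Real.log_le_sub_one_of_pos (hr ω h)
      nlinarith
  rw [Finset.sum_sub_distrib, hQ.sum_eq] at this
  linarith

/-- Points of zero mass contribute nothing, so the logarithm rule needs positivity only on the
support of `Q`. -/
theorem sum_mul_log_div {Q r s : Ω → ℝ} (hQ : ∀ ω, 0 ≤ Q ω) (hr : ∀ ω, 0 < Q ω → 0 < r ω)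
    (hs : ∀ ω, 0 < Q ω → 0 < s ω) : ∑ ω, Q ω * Real.log (r ω / s ω) =
      ∑ ω, Q ω * Real.log (r ω) - ∑ ω, Q ω * Real.log (s ω) := by
  rw [← Finset.sum_sub_distrib]
  refine Finset.sum_congr rfl fun ω _ => ?_
  rcases (hQ ω).eq_or_lt with h | h
  · simp [← h]
  · rw [Real.log_div (hr ω h).ne' (hs ω h).ne', mul_sub]

theorem sum_mul_log_mul {Q r s : Ω → ℝ} (hQ : ∀ ω, 0 ≤ Q ω) (hr : ∀ ω, 0 < Q ω → 0 < r ω)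
    (hs : ∀ ω, 0 < Q ω → 0 < s ω) : ∑ ω, Q ω * Real.log (r ω * s ω) =
      ∑ ω, Q ω * Real.log (r ω) + ∑ ω, Q ω * Real.log (s ω) := by
  rw [← Finset.sum_add_distrib]
  refine Finset.sum_congr rfl fun ω _ => ?_
  rcases (hQ ω).eq_or_lt with h | h
  · simp [← h]
  · rw [Real.log_mul (hr ω h).ne' (hs ω h).ne', mul_add]

/-- The conditional Gibbs inequality: `H(A | B) ≤ E[-log r(A | B)]`. -/
theorem ent_sub_ent_le [Fintype α] [Fintype β] {Q : Ω → ℝ} (hQ : IsPMF Q) (A : Ω → α) (B : Ω → β)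
    (r : α → β → ℝ) (hr0 : ∀ a b, 0 ≤ r a b) (hr1 : ∀ b, ∑ a, r a b ≤ 1)
    (hr : ∀ ω, 0 < Q ω → 0 < r (A ω) (B ω)) :
    ent Q (fun ω => (A ω, B ω)) - ent Q B ≤ -∑ ω, Q ω * Real.log (r (A ω) (B ω)) := by
  -- The weight is r(A|B) P(B) / P(A,B); its `Q`-average telescopes to a sum of r(a|b) P(b), which
  -- is at most 1.
  have key := sum_mul_log_le hQ
    (fun ω => r (A ω) (B ω) * law Q B (B ω) / law Q (fun ω => (A ω, B ω)) (A ω, B ω))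
    (fun ω h => div_pos (mul_pos (hr ω h) (law_pos hQ.nonneg B h))
      (law_pos hQ.nonneg (fun ω => (A ω, B ω)) h)) ?_
  · have h1 := sum_mul_log_div (r := fun ω => r (A ω) (B ω) * law Q B (B ω)) hQ.nonneg
      (fun ω h => mul_pos (hr ω h) (law_pos hQ.nonneg B h))
      (fun ω h => law_pos hQ.nonneg (fun ω => (A ω, B ω)) h)
    have h2 := sum_mul_log_mul hQ.nonneg hr (fun ω h => law_pos hQ.nonneg B h)
    simp only [ent] at key ⊢
    linarith
  · rw [← sum_law Q (fun ω => (A ω, B ω)) (fun p => r p.1 p.2 * law Q B p.2 /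
      law Q (fun ω => (A ω, B ω)) p)]
    calc _ ≤ ∑ p : α × β, r p.1 p.2 * law Q B p.2 := by
          refine Finset.sum_le_sum fun p _ => ?_
          rcases eq_or_ne (law Q (fun ω => (A ω, B ω)) p) 0 with h | h
          · simp [h, mul_nonneg (hr0 _ _) (law_nonneg hQ.nonneg _ _)]
          · rw [mul_div_cancel₀ _ h]
      _ = ∑ b, (∑ a, r a b) * law Q B b := by
          rw [Fintype.sum_prod_type_right]
          simp [Finset.sum_mul]
      _ ≤ ∑ b, 1 * law Q B b := Finset.sum_le_sum fun b _ =>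
          mul_le_mul_of_nonneg_right (hr1 b) (law_nonneg hQ.nonneg _ _)
      _ = 1 := by simpa using (hQ.law B).sum_eq

theorem ent_const {Q : Ω → ℝ} (hQ : IsPMF Q) {A : Ω → α} (h : ∀ ω ω', A ω = A ω') :
    ent Q A = 0 := by
  simp only [ent, law]
  have : ∀ ω, (∑ x, if A x = A ω then Q x else 0) = 1 := fun ω => by
    simp [fun x => h x ω, hQ.sum_eq]
  simp [this]

/-- Gibbs' inequality: `H(A) ≤ E[-log r(A)]`. -/
theorem ent_le [Fintype α] {Q : Ω → ℝ} (hQ : IsPMF Q) (A : Ω → α)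
    (r : α → ℝ) (hr0 : ∀ a, 0 ≤ r a) (hr1 : ∑ a, r a ≤ 1) (hr : ∀ ω, 0 < Q ω → 0 < r (A ω)) :
    ent Q A ≤ -∑ ω, Q ω * Real.log (r (A ω)) := by
  have := ent_sub_ent_le hQ A (fun _ => ()) (fun a _ => r a) (fun a _ => hr0 a) (fun _ => hr1) hr
  rw [ent_const hQ (A := fun _ => ()) (fun _ _ => rfl),
    ent_congr (B := A) (by simp)] at this
  linarith

/-- Conditioning reduces entropy: if `B` determines `C` then `H(A | B) ≤ H(A | C)`. -/
theorem ent_submod [Fintype α] [Fintype β] [Fintype γ] {Q : Ω → ℝ} (hQ : IsPMF Q)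
    (A : Ω → α) (B : Ω → β) (C : Ω → γ) (hBC : ∀ ω ω', B ω = B ω' → C ω = C ω') :
    ent Q (fun ω => (A ω, B ω)) - ent Q B ≤ ent Q (fun ω => (A ω, C ω)) - ent Q C := by
  -- Gibbs' inequality for the conditional law P(A|C), viewed as a kernel from the finer variable
  -- (B, C).
  have key := ent_sub_ent_le hQ A (fun ω => (B ω, C ω))
    (fun a bc => law Q (fun ω => (A ω, C ω)) (a, bc.2) / law Q C bc.2)
    (fun a bc => div_nonneg (law_nonneg hQ.nonneg _ _) (law_nonneg hQ.nonneg _ _))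
    (fun bc => ?_)
    (fun ω h => div_pos (law_pos hQ.nonneg (fun ω => (A ω, C ω)) h) (law_pos hQ.nonneg C h))
  · rw [ent_congr (A := fun ω => (B ω, C ω)) (B := B) (by simp; grind),
      ent_congr (A := fun ω => (A ω, B ω, C ω)) (B := fun ω => (A ω, B ω)) (by simp; grind)] at key
    have h2 := sum_mul_log_div (Q := Q) (r := fun ω => law Q (fun ω => (A ω, C ω)) (A ω, C ω))
      (s := fun ω => law Q C (C ω)) hQ.nonneg
      (fun ω h => law_pos hQ.nonneg (fun ω => (A ω, C ω)) h) (fun ω h => law_pos hQ.nonneg C h)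
    simp only [ent] at key ⊢
    linarith
  · rw [← Finset.sum_div]
    have : ∑ a, law Q (fun ω => (A ω, C ω)) (a, bc.2) = law Q C bc.2 := by
      simp only [law, Prod.mk.injEq, ite_and]
      rw [Finset.sum_comm]
      simp
    rw [this]
    exact div_self_le_one _

/-- Data processing for relative entropy, in the form
`H_Q - H_Q(A) ≤ E_Q[-log R] - E_Q[-log R_A]`. -/
theorem ent_sub_ent_le_cross [Fintype α] {Q R : Ω → ℝ} (hQ : IsPMF Q) (hR : ∀ ω, 0 ≤ R ω)
    (hQR : ∀ ω, 0 < Q ω → 0 < R ω) (A : Ω → α) :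
    ent Q (fun ω => ω) - ent Q A ≤
      -∑ ω, Q ω * Real.log (R ω) + ∑ ω, Q ω * Real.log (law R A (A ω)) := by
  -- Conditional Gibbs with the kernel of `R` given `A`.
  have key := ent_sub_ent_le hQ (fun ω => ω) A
    (fun ω a => (if A ω = a then R ω else 0) / law R A a)
    (fun ω a => div_nonneg (by split_ifs <;> simp [hR]) (law_nonneg hR _ _))
    (fun a => by rw [← Finset.sum_div]; exact div_self_le_one _)
    (fun ω h => by simpa using div_pos (hQR ω h) (law_pos hR A (hQR ω h)))
  rw [ent_congr (A := fun ω => (ω, A ω)) (B := fun ω => ω) (by simp)] at key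
  simp only [if_true] at key
  rw [sum_mul_log_div hQ.nonneg hQR (fun ω h => law_pos hR A (hQR ω h))] at key
  linarith

/-- `Q` conditioned on `U = u`. -/
def cond (Q : Ω → ℝ) (U : Ω → β) (u : β) (ω : Ω) : ℝ := (if U ω = u then Q ω else 0) / law Q U u

theorem cond_isPMF {Q : Ω → ℝ} (hQ : IsPMF Q) {U : Ω → β} {u : β} (hu : law Q U u ≠ 0) :
    IsPMF (cond Q U u) :=
  ⟨fun ω => div_nonneg (by split_ifs <;> simp [hQ.nonneg]) (law_nonneg hQ.nonneg _ _), by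
    simp only [cond]; rw [← Finset.sum_div]; exact div_self hu⟩

/-- No positivity of P(U = u) is required: if it vanishes, so does `Q` on the whole fibre. -/
theorem law_mul_cond {Q : Ω → ℝ} (hQ : IsPMF Q) (U : Ω → β) (u : β) (ω : Ω) :
    law Q U u * cond Q U u ω = if U ω = u then Q ω else 0 := by
  rcases eq_or_ne (law Q U u) 0 with h | h
  · have : (if U ω = u then Q ω else 0) ≤ law Q U u := Finset.single_le_sum
      (f := fun ω' => if U ω' = u then Q ω' else 0)
      (fun ω' _ => by split_ifs <;> simp [hQ.nonneg]) (Finset.mem_univ ω)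
    rw [h] at this
    rw [h, zero_mul]
    refine le_antisymm ?_ this
    split_ifs <;> simp [hQ.nonneg]
  · rw [cond, mul_div_cancel₀ _ h]

theorem law_cond {Q : Ω → ℝ} (U : Ω → β) (u : β) (A : Ω → α) (a : α) :
    law (cond Q U u) A a = law Q (fun ω => (A ω, U ω)) (a, u) / law Q U u := by
  simp only [cond, law, Prod.mk.injEq, ite_and, Finset.sum_div]
  refine Finset.sum_congr rfl fun ω _ => ?_
  split_ifs <;> simp

theorem sum_cond [Fintype β] {Q : Ω → ℝ} (hQ : IsPMF Q) (U : Ω → β) (F : β → Ω → ℝ) :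
    ∑ u, law Q U u * ∑ ω, cond Q U u ω * F u ω = ∑ ω, Q ω * F (U ω) ω := by
  simp only [Finset.mul_sum, ← mul_assoc, law_mul_cond hQ]
  rw [Finset.sum_comm]
  simp

/-- `H(A | U)` is the average of the entropies of `A` conditioned on `U = u`. -/
theorem sum_ent_cond [Fintype β] {Q : Ω → ℝ} (hQ : IsPMF Q) (U : Ω → β) (A : Ω → α) :
    ∑ u, law Q U u * ent (cond Q U u) A = ent Q (fun ω => (A ω, U ω)) - ent Q U := by
  have h := sum_cond hQ U (fun u ω => Real.log (law (cond Q U u) A (A ω)))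
  simp only [ent, mul_neg, Finset.sum_neg_distrib]
  rw [h]
  simp only [law_cond]
  rw [sum_mul_log_div hQ.nonneg (fun ω h => law_pos hQ.nonneg (fun ω => (A ω, U ω)) h)
    (fun ω h => law_pos hQ.nonneg U h)]
  ring

theorem ent_comp_of_law [Fintype α] {Q : Ω → ℝ} {A : Ω → α} {R : α → ℝ} (h : law Q A = R)
    (F : α → γ) : ent Q (fun ω => F (A ω)) = ent R F := by
  rw [← h, ent_law]

/-- Chain rule for a law given as a mixture of components `R u` with weights `l u`; it evaluates the
information quantities of test channels. -/
theorem ent_pair_of_law [Fintype α] [Fintype β] {Q : Ω → ℝ} (hQ : IsPMF Q) {A : Ω → α} {U : Ω → β}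
    {l : β → ℝ} {R : β → α → ℝ} (hU : law Q U = l) (hl : ∀ u, l u ≠ 0)
    (hA : ∀ a u, law Q (fun ω => (A ω, U ω)) (a, u) = l u * R u a) (F : α → γ) :
    ent Q (fun ω => (F (A ω), U ω)) = ent Q U + ∑ u, l u * ent (R u) F := by
  rw [← sub_eq_iff_eq_add', ← sum_ent_cond hQ, hU]
  refine Finset.sum_congr rfl fun u _ => ?_
  congr 1
  refine ent_comp_of_law ?_ F
  ext a
  rw [law_cond, hA, hU, mul_div_cancel_left₀ _ (hl u)]

theorem mutualInfo_eq_sum [Fintype α] [Fintype β] (Q : Ω → ℝ) (A : Ω → α) (B : Ω → β) :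
    mutualInfo Q A B = ∑ ω, Q ω * Real.log (law Q (fun ω => (A ω, B ω)) (A ω, B ω) /
      (law Q A (A ω) * law Q B (B ω))) := by
  rw [← sum_law Q (fun ω => (A ω, B ω))
    (fun p => Real.log (law Q (fun ω => (A ω, B ω)) p / (law Q A p.1 * law Q B p.2))),
    Fintype.sum_prod_type]
  rfl

theorem mutualInfo_eq_ent [Fintype α] [Fintype β] {Q : Ω → ℝ} (hQ : IsPMF Q)
    (A : Ω → α) (B : Ω → β) :
    mutualInfo Q A B = ent Q A + ent Q B - ent Q (fun ω => (A ω, B ω)) := by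
  have hA := fun ω h => law_pos hQ.nonneg A (ω := ω) h
  have hB := fun ω h => law_pos hQ.nonneg B (ω := ω) h
  rw [mutualInfo_eq_sum, sum_mul_log_div hQ.nonneg
    (fun ω h => law_pos hQ.nonneg (fun ω => (A ω, B ω)) h)
    (fun ω h => mul_pos (hA ω h) (hB ω h)), sum_mul_log_mul hQ.nonneg hA hB]
  simp only [ent]
  ring

theorem condMutualInfo_eq_ent [Fintype α] [Fintype β] [Fintype γ] {Q : Ω → ℝ} (hQ : IsPMF Q)
    (A : Ω → α) (B : Ω → β) (C : Ω → γ) :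
    condMutualInfo Q A B C = ent Q (fun ω => (A ω, C ω)) + ent Q (fun ω => (B ω, C ω)) -
      ent Q (fun ω => (A ω, B ω, C ω)) - ent Q C := by
  have hAC := fun ω h => law_pos hQ.nonneg (fun ω => (A ω, C ω)) (ω := ω) h
  have hBC := fun ω h => law_pos hQ.nonneg (fun ω => (B ω, C ω)) (ω := ω) h
  have hABC := fun ω h => law_pos hQ.nonneg (fun ω => (A ω, B ω, C ω)) (ω := ω) h
  have hC := fun ω h => law_pos hQ.nonneg C (ω := ω) h
  have : condMutualInfo Q A B C = ∑ ω, Q ω * Real.log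
      (law Q (fun ω => (A ω, B ω, C ω)) (A ω, B ω, C ω) * law Q C (C ω) /
        (law Q (fun ω => (A ω, C ω)) (A ω, C ω) * law Q (fun ω => (B ω, C ω)) (B ω, C ω))) := by
    rw [← sum_law Q (fun ω => (A ω, B ω, C ω)) (fun p => Real.log
      (law Q (fun ω => (A ω, B ω, C ω)) p * law Q C p.2.2 /
        (law Q (fun ω => (A ω, C ω)) (p.1, p.2.2) * law Q (fun ω => (B ω, C ω)) p.2))),
      Fintype.sum_prod_type]
    simp only [Fintype.sum_prod_type]
    rfl
  rw [this, sum_mul_log_div hQ.nonneg (fun ω h => mul_pos (hABC ω h) (hC ω h))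
    (fun ω h => mul_pos (hAC ω h) (hBC ω h)), sum_mul_log_mul hQ.nonneg hABC hC,
    sum_mul_log_mul hQ.nonneg hAC hBC]
  simp only [ent]
  ring

/-- The equality case of Gibbs' inequality. -/
theorem eq_of_sum_mul_log_le {Q r : Ω → ℝ} (hQ : IsPMF Q) (hr0 : ∀ ω, 0 ≤ r ω)
    (hr1 : ∑ ω, r ω ≤ 1) (hQr : ∀ ω, 0 < Q ω → 0 < r ω)
    (h : ∑ ω, Q ω * Real.log (Q ω) - ∑ ω, Q ω * Real.log (r ω) ≤ 0) : Q = r := by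
  -- Each term is nonnegative by log x ≤ x - 1 while the total is at most 0, so every term vanishes;
  -- the inequality is strict unless r = Q at the point.
  have hpt : ∀ ω, 0 ≤ r ω - Q ω - Q ω * Real.log (r ω / Q ω) := fun ω => by
    rcases (hQ.nonneg ω).eq_or_lt with h0 | h0
    · simp [← h0, hr0]
    · have := Real.log_le_sub_one_of_pos (div_pos (hQr ω h0) h0)
      have h2 : Q ω * (r ω / Q ω) = r ω := mul_div_cancel₀ _ h0.ne'
      nlinarith
  have hsum : ∑ ω, (r ω - Q ω - Q ω * Real.log (r ω / Q ω)) ≤ 0 := by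
    rw [Finset.sum_sub_distrib, Finset.sum_sub_distrib,
      sum_mul_log_div hQ.nonneg hQr (fun _ h => h), hQ.sum_eq]
    linarith
  have hz := (Finset.sum_eq_zero_iff_of_nonneg fun ω _ => hpt ω).1
    (le_antisymm hsum (Finset.sum_nonneg fun ω _ => hpt ω))
  ext ω
  have hω := hz ω (Finset.mem_univ _)
  rcases (hQ.nonneg ω).eq_or_lt with h0 | h0
  · simp only [← h0, zero_mul] at hω ⊢
    linarith
  · by_contra hne
    have h1 : r ω / Q ω ≠ 1 := fun h1 => hne ((div_eq_one_iff_eq h0.ne').1 h1).symm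
    have := Real.log_lt_sub_one_of_pos (div_pos (hQr ω h0) h0) h1
    have h2 : Q ω * (r ω / Q ω) = r ω := mul_div_cancel₀ _ h0.ne'
    nlinarith

end Entropy

/-! ### Product laws and resampling of one coordinate. -/

section Product

variable {ι α β : Type*} [Fintype ι]

/-- The product weight `∏ i, p (a i)`. -/
def prodWeight (p : α → ℝ) (a : ι → α) : ℝ := ∏ i, p (a i)

theorem sum_prod_eq_prod_sum [DecidableEq ι] [Fintype α] (F : ι → α → ℝ) :
    ∑ a : ι → α, ∏ i, F i (a i) = ∏ i, ∑ x, F i x := by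
  rw [Finset.prod_univ_sum, Fintype.piFinset_univ]

theorem IsPMF.prodWeight [DecidableEq ι] [Fintype α] {p : α → ℝ} (hp : IsPMF p) :
    IsPMF (prodWeight (ι := ι) p) :=
  ⟨fun a => Finset.prod_nonneg fun i _ => hp.nonneg _, by
    simp [ContentId.prodWeight, sum_prod_eq_prod_sum (fun _ => p), hp.sum_eq]⟩

/-- The law of a coordinatewise image of an i.i.d. vector. -/
theorem law_prodWeight [DecidableEq ι] [Fintype α] (p : α → ℝ) (F : α → β) :
    law (prodWeight (ι := ι) p) (fun a i => F (a i)) = prodWeight (law p F) := by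
  ext b
  simp only [law, prodWeight]
  rw [← sum_prod_eq_prod_sum (fun i x => if F x = b i then p x else 0)]
  refine Finset.sum_congr rfl fun a _ => ?_
  rw [Finset.prod_ite_zero]
  simp [funext_iff]

theorem prodWeight_pos {p : α → ℝ} (hp : ∀ a, 0 ≤ p a) {a : ι → α} :
    0 < prodWeight p a ↔ ∀ i, 0 < p (a i) := by
  refine ⟨fun h i => (hp _).lt_of_ne fun h0 => h.ne' ?_, fun h => Finset.prod_pos fun i _ => h i⟩
  exact Finset.prod_eq_zero (Finset.mem_univ i) h0.symm

theorem log_prodWeight {p : α → ℝ} {a : ι → α} (h : ∀ i, 0 < p (a i)) :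
    Real.log (prodWeight p a) = ∑ i, Real.log (p (a i)) :=
  Real.log_prod fun i _ => (h i).ne'

/-- One coordinate of an i.i.d. vector may be resampled. -/
theorem sum_prodWeight_update [DecidableEq ι] [Fintype α] {p : α → ℝ}
    (hp : ∑ a, p a = 1) (w : ι) (F : (ι → α) → ℝ) :
    ∑ x, prodWeight p x * F x =
      ∑ a, p a * ∑ x, prodWeight p x * F (Function.update x w a) := by
  have hW : ∀ (x : ι → α) a, prodWeight p (Function.update x w a) * p (x w) =
      prodWeight p x * p a := fun x a => by
    simp only [prodWeight]
    rw [← Finset.mul_prod_erase _ _ (Finset.mem_univ w),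
      ← Finset.mul_prod_erase _ (fun i => p (x i)) (Finset.mem_univ w),
      Finset.prod_congr rfl fun i hi => by
        rw [Function.update_of_ne (Finset.ne_of_mem_erase hi)]]
    simp only [Function.update_self]
    ring
  -- Exchanging coordinate `w` with an independent fresh letter is an involution that preserves the
  -- product weight.
  have hinv : Function.Involutive
      (fun z : (ι → α) × α => (Function.update z.1 w z.2, z.1 w)) := fun z => by simp
  calc _ = ∑ x, ∑ a, prodWeight p x * p a * F x := by
        simp only [mul_right_comm _ (p _), ← Finset.mul_sum, hp, mul_one]
    _ = ∑ z : (ι → α) × α, prodWeight p z.1 * p z.2 * F z.1 := by rw [Fintype.sum_prod_type]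
    _ = ∑ z : (ι → α) × α, prodWeight p z.1 * p z.2 * F (Function.update z.1 w z.2) := by
        rw [← Equiv.sum_comp hinv.toPerm]
        simp [hW]
    _ = _ := by
        rw [Fintype.sum_prod_type_right]
        simp only [Finset.mul_sum]
        exact Finset.sum_congr rfl fun a _ => Finset.sum_congr rfl fun x _ => by ring

theorem sum_prodWeight_eval [DecidableEq ι] [Fintype α] {p : α → ℝ}
    (hp : ∑ a, p a = 1) (w : ι) (F : α → ℝ) :
    ∑ x : ι → α, prodWeight p x * F (x w) = ∑ a, p a * F a := by
  have hs : ∑ x : ι → α, prodWeight p x = 1 := by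
    simp [prodWeight, sum_prod_eq_prod_sum (fun _ => p), hp]
  rw [sum_prodWeight_update hp w]
  simp [← Finset.sum_mul, hs]

end Product

/-! ### Reduction of the error probability to the letters of one item. -/

section OneShot

variable {X Y Z Xh : Type*} [Fintype X] [Fintype Y] [Fintype Z]

/-- The joint law of one letter `(X, Y, Z)`. -/
def Model.joint (P : Model X Y Z Xh) (t : X × Y × Z) : ℝ :=
  P.PX t.1 * P.PYX t.1 t.2.1 * P.PZX t.1 t.2.2

/-- The law of one letter `Y`. -/
def Model.pY (P : Model X Y Z Xh) : Y → ℝ := law P.joint (fun t => t.2.1)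

/-- The law of one letter `Z`. -/
def Model.pZ (P : Model X Y Z Xh) : Z → ℝ := law P.joint (fun t => t.2.2)

/-- The law of one pair of letters `(Y, Z)`. -/
def Model.pYZ (P : Model X Y Z Xh) : Y × Z → ℝ := law P.joint (fun t => t.2)

theorem Model.joint_isPMF (P : Model X Y Z Xh) : IsPMF P.joint := by
  refine ⟨fun t => mul_nonneg (mul_nonneg (P.PX_mem.1 _) ((P.PYX_mem _).1 _)) ((P.PZX_mem _).1 _), ?_⟩
  simp only [Fintype.sum_prod_type, Model.joint, ← Finset.mul_sum, (P.PZX_mem _).2, mul_one,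
    (P.PYX_mem _).2, P.PX_mem.2]

theorem Model.pY_isPMF (P : Model X Y Z Xh) : IsPMF P.pY := P.joint_isPMF.law _

theorem Model.pZ_isPMF (P : Model X Y Z Xh) : IsPMF P.pZ := P.joint_isPMF.law _

theorem Model.pY_apply (P : Model X Y Z Xh) (y : Y) : P.pY y = ∑ x, P.PX x * P.PYX x y := by
  simp only [Model.pY, law, Model.joint, Fintype.sum_prod_type]
  refine Finset.sum_congr rfl fun x _ => ?_
  rw [Finset.sum_comm]
  simp [← Finset.mul_sum, (P.PZX_mem _).2]

/-- The block of the inputs. -/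
def xs {n : ℕ} (ω : Fin n → X × Y × Z) : Fin n → X := fun i => (ω i).1

/-- The block of the outputs of the enrollment channel. -/
def ys {n : ℕ} (ω : Fin n → X × Y × Z) : Fin n → Y := fun i => (ω i).2.1

/-- The block of the outputs of the identification channel. -/
def zs {n : ℕ} (ω : Fin n → X × Y × Z) : Fin n → Z := fun i => (ω i).2.2

theorem Model.law_ys (P : Model X Y Z Xh) (n : ℕ) :
    law (prodWeight (ι := Fin n) P.joint) ys = prodWeight P.pY :=
  law_prodWeight P.joint (fun t => t.2.1)

theorem Model.law_zs (P : Model X Y Z Xh) (n : ℕ) :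
    law (prodWeight (ι := Fin n) P.joint) zs = prodWeight P.pZ :=
  law_prodWeight P.joint (fun t => t.2.2)

theorem sum_blocks {n : ℕ} (F : (Fin n → X) → (Fin n → Y) → (Fin n → Z) → ℝ) :
    ∑ ω : Fin n → X × Y × Z, F (xs ω) (ys ω) (zs ω) = ∑ x, ∑ y, ∑ z, F x y z := by
  let e : (Fin n → X × Y × Z) ≃ (Fin n → X) × (Fin n → Y) × (Fin n → Z) :=
    (Equiv.arrowProdEquivProdArrow (Fin n) (fun _ => X) (fun _ => Y × Z)).trans
      ((Equiv.refl _).prodCongr (Equiv.arrowProdEquivProdArrow (Fin n) (fun _ => Y) (fun _ => Z)))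
  calc _ = ∑ ω, F (e ω).1 (e ω).2.1 (e ω).2.2 := rfl
    _ = _ := by
      rw [Equiv.sum_comp e (fun t => F t.1 t.2.1 t.2.2)]
      simp only [Fintype.sum_prod_type]

/-- Averaging over the whole database amounts to averaging over the letters of the item `w` and,
independently, over fresh enrollment outputs for the other items. -/
theorem Model.sum_jointProb (P : Model X Y Z Xh) {n M : ℕ} (w : Fin M)
    (F : (Fin n → X) → (Fin M → Fin n → Y) → (Fin n → Z) → ℝ) :
    ∑ x, ∑ y, ∑ z, P.jointProb w x y z * F (x w) y z =
      (1 / (M : ℝ)) * ∑ ω : Fin n → X × Y × Z, prodWeight P.joint ω *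
        ∑ y', prodWeight (prodWeight P.pY) y' * F (xs ω) (Function.update y' w (ys ω)) (zs ω) := by
  -- The items are i.i.d. with this law of (X^n, Y^n), so item `w` can be resampled while only the
  -- Y-blocks of the other items are kept.
  set pA : (Fin n → X) × (Fin n → Y) → ℝ := fun a => ∏ i, P.PX (a.1 i) * P.PYX (a.1 i) (a.2 i)
    with hpA
  have hlaw : law pA Prod.snd = prodWeight P.pY := by
    ext y
    simp only [law, Fintype.sum_prod_type, prodWeight, P.pY_apply, pA]
    simp only [Finset.sum_ite_eq', Finset.mem_univ, if_true]
    exact sum_prod_eq_prod_sum (fun i x => P.PX x * P.PYX x (y i))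
  have hone : ∑ a, pA a = 1 := by
    have := sum_law pA Prod.snd (fun _ => 1)
    rw [hlaw] at this
    simpa [P.pY_isPMF.prodWeight.sum_eq] using this.symm
  let G : (Fin M → (Fin n → X) × (Fin n → Y)) → ℝ := fun a =>
    ∑ z, (∏ i, P.PZX ((a w).1 i) (z i)) * F (a w).1 (fun m => (a m).2) z
  have h1 : ∑ x, ∑ y, ∑ z, P.jointProb w x y z * F (x w) y z =
      (1 / (M : ℝ)) * ∑ a, prodWeight pA a * G a := by
    rw [← Equiv.sum_comp (Equiv.arrowProdEquivProdArrow (Fin M) (fun _ => Fin n → X)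
      (fun _ => Fin n → Y)).symm, Fintype.sum_prod_type]
    simp only [Finset.mul_sum, G]
    refine Finset.sum_congr rfl fun x _ => Finset.sum_congr rfl fun y _ =>
      Finset.sum_congr rfl fun z _ => ?_
    simp only [Model.jointProb, prodWeight, pA, Equiv.arrowProdEquivProdArrow]
    simp only [Equiv.coe_fn_symm_mk]
    ring
  rw [h1, sum_prodWeight_update hone w]
  congr 1
  have h2 : ∀ a0, ∑ a, prodWeight pA a * G (Function.update a w a0) =
      ∑ y', prodWeight (prodWeight P.pY) y' * ∑ z, (∏ i, P.PZX (a0.1 i) (z i)) *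
        F a0.1 (Function.update y' w a0.2) z := fun a0 => by
    rw [← hlaw, ← law_prodWeight, sum_law (prodWeight pA) (fun a i => (a i).2)
      (fun y' => ∑ z, (∏ i, P.PZX (a0.1 i) (z i)) * F a0.1 (Function.update y' w a0.2) z)]
    refine Finset.sum_congr rfl fun a _ => ?_
    simp only [G, Function.update_self]
    congr 1
    refine Finset.sum_congr rfl fun z _ => ?_
    congr 2
    ext m
    rcases eq_or_ne m w with rfl | hm <;> simp [*]
  simp only [h2]
  have h3 : ∀ ω : Fin n → X × Y × Z, prodWeight P.joint ω = pA (xs ω, ys ω) *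
      ∏ i, P.PZX (xs ω i) (zs ω i) := fun ω => by
    simp only [prodWeight, Model.joint, pA, xs, ys, zs, ← Finset.prod_mul_distrib]
  simp only [h3]
  rw [sum_blocks (fun x y z => pA (x, y) * (∏ i, P.PZX (x i) (z i)) *
        ∑ y', prodWeight (prodWeight P.pY) y' * F x (Function.update y' w y) z),
    Fintype.sum_prod_type]
  refine Finset.sum_congr rfl fun x _ => Finset.sum_congr rfl fun y _ => ?_
  simp only [Finset.mul_sum]
  rw [Finset.sum_comm]
  refine Finset.sum_congr rfl fun z _ => Finset.sum_congr rfl fun y' _ => ?_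
  ring

theorem Model.errorProb_eq (P : Model X Y Z Xh) {n : ℕ} (C : Code Y Z Xh n) (D : ℝ) :
    P.errorProb C D = (1 / (C.M : ℝ)) * ∑ w, ∑ ω : Fin n → X × Y × Z, prodWeight P.joint ω *
      ∑ y', prodWeight (prodWeight P.pY) y' *
        (if C.estimate (Function.update y' w (ys ω)) (zs ω) ≠ w ∨
          D < P.blockDist (xs ω) (C.reproduction (Function.update y' w (ys ω)) (zs ω))
          then 1 else 0) := by
  rw [Finset.mul_sum, Model.errorProb]
  refine Finset.sum_congr rfl fun w _ => ?_
  rw [← P.sum_jointProb w (fun x y z => if C.estimate y z ≠ w ∨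
          D < P.blockDist x (C.reproduction y z) then 1 else 0)]
  simp

/-- The probability that the item with stored message `s` is identified from `z`. -/
def Model.hitProb (P : Model X Y Z Xh) {n : ℕ} (C : Code Y Z Xh n) (s : Fin C.L)
    (z : Fin n → Z) : ℝ :=
  (1 / (C.M : ℝ)) * ∑ w, ∑ y', prodWeight (prodWeight P.pY) y' *
    (if C.g (Function.update (fun m => C.f (y' m)) w s) z = w then 1 else 0)

theorem Code.estimate_update {Y Z Xh : Type*} {n : ℕ} (C : Code Y Z Xh n)
    (y' : Fin C.M → Fin n → Y) (w : Fin C.M)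
    (y : Fin n → Y) (z : Fin n → Z) : C.estimate (Function.update y' w y) z =
      C.g (Function.update (fun m => C.f (y' m)) w (C.f y)) z := by
  rw [Code.estimate]
  congr 1
  ext m
  rcases eq_or_ne m w with rfl | hm <;> simp [*]

/-- The code sees item W only through S(W). Once the other items and the index are averaged out,
identification becomes a factor depending on (S, Z^n) alone, and on its event the reproduction is
computed from S(W). -/
theorem Model.correctProb_eq (P : Model X Y Z Xh) {n : ℕ} (C : Code Y Z Xh n) (D : ℝ) :
    P.correctProb C D = ∑ ω : Fin n → X × Y × Z, prodWeight P.joint ω *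
      (P.hitProb C (C.f (ys ω)) (zs ω) *
        if P.blockDist (xs ω) (C.h (C.f (ys ω)) (zs ω)) ≤ D then 1 else 0) := by
  have hM : (C.M : ℝ) ≠ 0 := by exact_mod_cast C.M_pos.ne'
  have hone : (1 : ℝ) = (1 / (C.M : ℝ)) * ∑ _w : Fin C.M, ∑ ω : Fin n → X × Y × Z,
      prodWeight P.joint ω * ∑ y' : Fin C.M → Fin n → Y, prodWeight (prodWeight P.pY) y' * 1 := by
    simp [P.pY_isPMF.prodWeight.prodWeight.sum_eq, P.joint_isPMF.prodWeight.sum_eq, hM]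
  rw [Model.correctProb, P.errorProb_eq]
  refine (congrArg (· - _) hone).trans ?_
  rw [← mul_sub, ← Finset.sum_sub_distrib]
  simp only [← Finset.sum_sub_distrib, ← mul_sub]
  rw [Finset.sum_comm, Finset.mul_sum]
  refine Finset.sum_congr rfl fun ω _ => ?_
  rw [← Finset.mul_sum, Model.hitProb, mul_left_comm, mul_assoc]
  congr 2
  rw [Finset.sum_mul]
  refine Finset.sum_congr rfl fun w _ => ?_
  rw [Finset.sum_mul]
  refine Finset.sum_congr rfl fun y' _ => ?_
  rw [mul_assoc, ← C.estimate_update y' w]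
  congr 1
  rw [Code.reproduction]
  by_cases h : C.estimate (Function.update y' w (ys ω)) (zs ω) = w
  · simp only [h, ne_eq, not_true_eq_false, false_or, Function.update_self, if_true, one_mul]
    split_ifs <;> linarith
  · simp [h]

theorem Model.hitProb_nonneg (P : Model X Y Z Xh) {n : ℕ} (C : Code Y Z Xh n) (s : Fin C.L)
    (z : Fin n → Z) : 0 ≤ P.hitProb C s z :=
  mul_nonneg (by positivity) (Finset.sum_nonneg fun w _ => Finset.sum_nonneg fun y' _ =>
    mul_nonneg (P.pY_isPMF.prodWeight.prodWeight.nonneg _) (by split_ifs <;> simp))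

theorem Model.hitProb_le_one (P : Model X Y Z Xh) {n : ℕ} (C : Code Y Z Xh n) (s : Fin C.L)
    (z : Fin n → Z) : P.hitProb C s z ≤ 1 := by
  have hM : (C.M : ℝ) ≠ 0 := by exact_mod_cast C.M_pos.ne'
  calc _ ≤ (1 / (C.M : ℝ)) * ∑ _w : Fin C.M, ∑ y' : Fin C.M → Fin n → Y,
        prodWeight (prodWeight P.pY) y' * 1 := by
        rw [Model.hitProb]
        gcongr
        · exact P.pY_isPMF.prodWeight.prodWeight.nonneg _
        · split_ifs <;> simp
    _ = 1 := by simp [P.pY_isPMF.prodWeight.prodWeight.sum_eq, hM]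

/-- When the observation is independent of the database, the item is identified with
probability `1 / M`. -/
theorem Model.sum_hitProb (P : Model X Y Z Xh) {n : ℕ} (C : Code Y Z Xh n) (z : Fin n → Z) :
    ∑ s, law (prodWeight P.pY) C.f s * P.hitProb C s z = 1 / (C.M : ℝ) := by
  rw [sum_law (prodWeight P.pY) C.f (fun s => P.hitProb C s z)]
  calc _ = (1 / (C.M : ℝ)) * ∑ w, ∑ y, prodWeight P.pY y * ∑ y', prodWeight (prodWeight P.pY) y' *
        (if C.estimate (Function.update y' w y) z = w then 1 else 0) := by
        simp only [Model.hitProb, mul_left_comm _ (1 / (C.M : ℝ)), ← C.estimate_update]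
        rw [← Finset.mul_sum, Finset.sum_comm]
        simp only [Finset.mul_sum]
    _ = (1 / (C.M : ℝ)) * ∑ w, ∑ y, prodWeight (prodWeight P.pY) y *
        (if C.estimate y z = w then 1 else 0) := by
        -- With the observation independent of the database, the resampled item rejoins the others;
        -- for each database exactly one index `w` equals the estimate.
        congr 1
        exact Finset.sum_congr rfl fun w _ => (sum_prodWeight_update P.pY_isPMF.prodWeight.sum_eq w
          (fun y => if C.estimate y z = w then (1 : ℝ) else 0)).symm
    _ = _ := by
        rw [Finset.sum_comm]
        simp only [← Finset.mul_sum]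
        simp [P.pY_isPMF.prodWeight.prodWeight.sum_eq]

end OneShot

/-! ### Conditioning on correct decoding. -/

section ChangeOfMeasure

variable {X Y Z Xh : Type*} [Fintype X] [Fintype Y] [Fintype Z]

/-- Under the law conditioned on correct decoding, the code satisfies the inequalities of the weak
converse up to `-log P_c`. -/
theorem Model.exists_changed_measure (P : Model X Y Z Xh) {n : ℕ} (C : Code Y Z Xh n) (D : ℝ)
    (hc : 0 < P.correctProb C D) {κ : ℝ} (hκ : -Real.log (P.correctProb C D) ≤ κ) :
    ∃ Q : (Fin n → X × Y × Z) → ℝ, IsPMF Q ∧ (∀ ω, 0 < Q ω → ∀ i, 0 < P.joint (ω i)) ∧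
      (∀ ω, 0 < Q ω → P.blockDist (xs ω) (C.h (C.f (ys ω)) (zs ω)) ≤ D) ∧
      Real.log C.M ≤ -∑ ω, Q ω * Real.log (prodWeight P.pZ (zs ω)) -
        ent Q (fun ω => (C.f (ys ω), zs ω)) + ent Q (fun ω => C.f (ys ω)) + κ ∧
      Real.log C.M - ∑ ω, Q ω * Real.log (prodWeight P.pYZ (fun i => (ω i).2)) +
        ∑ ω, Q ω * Real.log (prodWeight P.pZ (zs ω)) -
        (ent Q (fun ω => (ys ω, zs ω)) - ent Q (fun ω => (C.f (ys ω), zs ω))) - 2 * κ ≤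
          Real.log C.L ∧
      ent Q ys - ent Q (fun ω => ω) - ∑ ω, Q ω * Real.log (prodWeight P.joint ω) +
        ∑ ω, Q ω * Real.log (prodWeight P.pY (ys ω)) ≤ κ ∧
      -∑ ω, Q ω * Real.log (prodWeight P.pY (ys ω)) - ent Q ys ≤ κ := by
  set c := P.correctProb C D with hcdef
  set W : (Fin n → X × Y × Z) → ℝ := prodWeight P.joint with hW
  set S : (Fin n → X × Y × Z) → Fin C.L := fun ω => C.f (ys ω) with hS
  have hW0 : IsPMF W := P.joint_isPMF.prodWeight
  set t : (Fin n → X × Y × Z) → ℝ := fun ω => P.hitProb C (S ω) (zs ω) with ht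
  have ht0 : ∀ ω, 0 ≤ t ω := fun ω => P.hitProb_nonneg C _ _
  have ht1 : ∀ ω, t ω ≤ 1 := fun ω => P.hitProb_le_one C _ _
  -- The conditional law given correct decoding: the i.i.d. weight is tilted by the identification
  -- probability and restricted to small distortion.
  set Q : (Fin n → X × Y × Z) → ℝ := fun ω => W ω * (t ω *
    if P.blockDist (xs ω) (C.h (S ω) (zs ω)) ≤ D then 1 else 0) / c with hQdef
  have hQ : IsPMF Q := by
    refine ⟨fun ω => div_nonneg (mul_nonneg (hW0.nonneg ω) (mul_nonneg (ht0 ω) ?_)) hc.le, ?_⟩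
    · split_ifs <;> simp
    · simp only [hQdef]
      rw [← Finset.sum_div, div_eq_one_iff_eq hc.ne', hcdef, P.correctProb_eq]
  have hQpos : ∀ ω, 0 < Q ω → 0 < W ω ∧ 0 < t ω ∧
      P.blockDist (xs ω) (C.h (S ω) (zs ω)) ≤ D ∧ Q ω = W ω * t ω / c := fun ω h => by
    have hd : P.blockDist (xs ω) (C.h (S ω) (zs ω)) ≤ D := by
      by_contra hd
      simp [hQdef, hd] at h
    have e : Q ω = W ω * t ω / c := by simp only [hQdef, if_pos hd, mul_one]
    have hWt : W ω * t ω ≠ 0 := fun h0 => by simp [e, h0] at h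
    exact ⟨(hW0.nonneg ω).lt_of_ne' (left_ne_zero_of_mul hWt),
      (ht0 ω).lt_of_ne' (right_ne_zero_of_mul hWt), hd, e⟩
  have hWp : ∀ ω, 0 < Q ω → 0 < W ω := fun ω h => (hQpos ω h).1
  have htp : ∀ ω, 0 < Q ω → 0 < t ω := fun ω h => (hQpos ω h).2.1
  -- the entropy of the conditioned law
  have hB : ∑ ω, Q ω * Real.log (t ω) ≤ 0 := Finset.sum_nonpos fun ω _ =>
    mul_nonpos_of_nonneg_of_nonpos (hQ.nonneg ω) (Real.log_nonpos (ht0 ω) (ht1 ω))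
  have hent : ent Q (fun ω => ω) = -∑ ω, Q ω * Real.log (W ω) - ∑ ω, Q ω * Real.log (t ω) +
      Real.log c := by
    have h1 : ∀ ω, Q ω * Real.log (law Q (fun ω => ω) ω) =
        Q ω * Real.log (W ω * t ω) - Q ω * Real.log c := fun ω => by
      have : law Q (fun ω => ω) ω = Q ω := law_id Q ω
      rw [this]
      rcases (hQ.nonneg ω).eq_or_lt with h | h
      · simp [← h]
      · obtain ⟨h1, h2, -, h3⟩ := hQpos ω h
        rw [← mul_sub, ← Real.log_div (mul_pos h1 h2).ne' hc.ne', ← h3]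
    rw [ent, Finset.sum_congr rfl fun ω _ => h1 ω, Finset.sum_sub_distrib,
      sum_mul_log_mul hQ.nonneg hWp htp, ← Finset.sum_mul, hQ.sum_eq]
    ring
  have hlawS : law W S = law (prodWeight P.pY) C.f := by
    rw [← P.law_ys, law_comp]
  have hlawYZ : law W (fun ω i => (ω i).2) = prodWeight P.pYZ :=
    law_prodWeight P.joint (fun t => t.2)
  -- Data processing for the divergence of Q from the i.i.d. law `W`, whose value `hent` gives as
  -- E[log t] - log P_c.
  have hSent := ent_sub_ent_le_cross hQ hW0.nonneg hWp S
  have hYent := ent_sub_ent_le_cross hQ hW0.nonneg hWp ys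
  have hYZent := ent_sub_ent_le_cross hQ hW0.nonneg hWp (fun ω i => (ω i).2)
  rw [P.law_ys] at hYent
  rw [hlawYZ, ent_congr (A := fun (ω : Fin n → X × Y × Z) i => (ω i).2)
    (B := fun ω => (ys ω, zs ω)) (by simp [ys, zs, funext_iff, Prod.ext_iff, forall_and])] at hYZent
  have hSp : ∀ ω, 0 < Q ω → 0 < law W S (S ω) := fun ω h => law_pos hW0.nonneg S (hWp ω h)
  have hZp : ∀ ω, 0 < Q ω → 0 < prodWeight P.pZ (zs ω) := fun ω h => by
    rw [← P.law_zs]; exact law_pos hW0.nonneg zs (hWp ω h)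
  have hYp : ∀ ω, 0 < Q ω → 0 < prodWeight P.pY (ys ω) := fun ω h => by
    rw [← P.law_ys]; exact law_pos hW0.nonneg ys (hWp ω h)
  have hM : 0 < (C.M : ℝ) := by exact_mod_cast C.M_pos
  have hL : 0 < (C.L : ℝ) := by exact_mod_cast C.L_pos
  -- identification
  have hMent : Real.log C.M ≤ -∑ ω, Q ω * Real.log (prodWeight P.pZ (zs ω)) -
      ∑ ω, Q ω * Real.log (law W S (S ω)) - ∑ ω, Q ω * Real.log (t ω) -
        ent Q (fun ω => (S ω, zs ω)) := by
    -- Gibbs' inequality for M · P_S(s) · P_Z(z) · hitProb(s, z), which has total mass exactly 1 by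
    -- `P.sum_hitProb`.
    have := ent_le hQ (fun ω => (S ω, zs ω))
      (fun p => C.M * (law W S p.1 * (prodWeight P.pZ p.2 * P.hitProb C p.1 p.2)))
      (fun p => mul_nonneg hM.le (mul_nonneg (law_nonneg hW0.nonneg _ _)
        (mul_nonneg (P.pZ_isPMF.prodWeight.nonneg _) (P.hitProb_nonneg C _ _)))) ?_
      (fun ω h => mul_pos hM (mul_pos (hSp ω h) (mul_pos (hZp ω h) (htp ω h))))
    · rw [sum_mul_log_mul hQ.nonneg (fun _ _ => hM)
        (fun ω h => mul_pos (hSp ω h) (mul_pos (hZp ω h) (htp ω h))),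
        sum_mul_log_mul hQ.nonneg hSp (fun ω h => mul_pos (hZp ω h) (htp ω h)),
        sum_mul_log_mul hQ.nonneg hZp htp, ← Finset.sum_mul, hQ.sum_eq] at this
      linarith
    · rw [Fintype.sum_prod_type_right, hlawS]
      simp only [← Finset.mul_sum, mul_left_comm _ (prodWeight P.pZ _), P.sum_hitProb]
      rw [← Finset.sum_mul, P.pZ_isPMF.prodWeight.sum_eq, one_mul, mul_one_div, div_self hM.ne']
  have hLent : ent Q S ≤ Real.log C.L := by
    have := ent_le hQ S (fun _ => 1 / (C.L : ℝ)) (fun _ => by positivity) (by simp [hL.ne'])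
      (fun _ _ => by positivity)
    rw [← Finset.sum_mul, hQ.sum_eq, one_div, Real.log_inv] at this
    linarith
  have hYle : ent Q ys ≤ -∑ ω, Q ω * Real.log (prodWeight P.pY (ys ω)) :=
    ent_le hQ ys (prodWeight P.pY) P.pY_isPMF.prodWeight.nonneg
      P.pY_isPMF.prodWeight.sum_eq.le hYp
  -- In the bound on log M, the terms E[log P_S] and E[log t] of `hMent` are absorbed by `hSent` and
  -- `hent` at the cost κ. The bound on log L adds H(S) ≤ log L and the divergence of the (Y^n,
  -- Z^n)-marginal, hence 2κ. The last two use E[log t] ≤ 0 and data processing to Y^n.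
  refine ⟨Q, hQ, fun ω h => (prodWeight_pos P.joint_isPMF.nonneg).1 (hWp ω h),
    fun ω h => (hQpos ω h).2.2.1, ?_, ?_, ?_, ?_⟩
  · change Real.log C.M ≤ _ - ent Q (fun ω => (S ω, zs ω)) + ent Q S + κ
    linarith
  · change _ - (_ - ent Q (fun ω => (S ω, zs ω))) - 2 * κ ≤ _
    linarith
  · linarith
  · linarith

end ChangeOfMeasure

/-! ### Convex combinations with null weights. -/

section Hull

/-- Points of weight zero are unconstrained, as needed when conditioning on null events gives no
probability law. -/
theorem sum_smul_mem_convexHull {E ι : Type*} [AddCommGroup E] [Module ℝ E] [Fintype ι]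
    {s : Set E} {w : ι → ℝ} {v : ι → E} (hw : IsPMF w) (hv : ∀ i, w i ≠ 0 → v i ∈ s) :
    ∑ i, w i • v i ∈ convexHull ℝ s := by
  have h1 : ∑ i ∈ Finset.univ.filter (fun i => w i ≠ 0), w i = 1 := by
    rw [Finset.sum_filter_ne_zero, hw.sum_eq]
  have h2 : ∑ i, w i • v i = ∑ i ∈ Finset.univ.filter (fun i => w i ≠ 0), w i • v i := by
    refine (Finset.sum_subset (Finset.filter_subset _ _) fun i _ hi => ?_).symm
    simp only [Finset.mem_filter, Finset.mem_univ, true_and, not_not] at hi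
    simp [hi]
  rw [h2]
  exact (convex_convexHull ℝ s).sum_mem (fun i _ => hw.nonneg i) h1
    fun i hi => subset_convexHull ℝ s (hv i (Finset.mem_filter.1 hi).2)

end Hull

/-! ### Prefixes and suffixes of blocks. -/

section Blocks

variable {α : Type*} {n : ℕ}

/-- The entries of a block before position `i`. -/
def pre (i : ℕ) (y : Fin n → α) (j : Fin n) : Option α := if j.1 < i then some (y j) else none

/-- The entries of a block from position `i` on. -/
def suf (i : ℕ) (z : Fin n → α) (j : Fin n) : Option α := if i ≤ j.1 then some (z j) else none

theorem pre_eq_iff {i : ℕ} {y y' : Fin n → α} :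
    pre i y = pre i y' ↔ ∀ j : Fin n, j.1 < i → y j = y' j := by
  simp only [funext_iff, pre]
  refine forall_congr' fun j => ?_
  by_cases h : j.1 < i <;> simp [h]

theorem suf_eq_iff {i : ℕ} {y y' : Fin n → α} :
    suf i y = suf i y' ↔ ∀ j : Fin n, i ≤ j.1 → y j = y' j := by
  simp only [funext_iff, suf]
  refine forall_congr' fun j => ?_
  by_cases h : i ≤ j.1 <;> simp [h]

theorem pre_succ_eq_iff {i : Fin n} {y y' : Fin n → α} :
    pre (i.1 + 1) y = pre (i.1 + 1) y' ↔ y i = y' i ∧ pre i.1 y = pre i.1 y' := by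
  simp only [pre_eq_iff]
  refine ⟨fun h => ⟨h i (by omega), fun j hj => h j (by omega)⟩, fun h j hj => ?_⟩
  rcases Nat.lt_succ_iff_lt_or_eq.1 hj with h1 | h1
  · exact h.2 j h1
  · rw [Fin.ext h1]; exact h.1

theorem suf_eq_iff_succ {i : Fin n} {y y' : Fin n → α} :
    suf i.1 y = suf i.1 y' ↔ y i = y' i ∧ suf (i.1 + 1) y = suf (i.1 + 1) y' := by
  simp only [suf_eq_iff]
  refine ⟨fun h => ⟨h i le_rfl, fun j hj => h j (by omega)⟩, fun h j hj => ?_⟩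
  rcases hj.eq_or_lt with h1 | h1
  · rw [← Fin.ext h1]; exact h.1
  · exact h.2 j h1

theorem pre_zero_eq {y y' : Fin n → α} : pre 0 y = pre 0 y' := by simp [pre_eq_iff]

theorem suf_length_eq {y y' : Fin n → α} : suf n y = suf n y' := by
  simp [suf_eq_iff]

theorem pre_length_eq_iff {y y' : Fin n → α} : pre n y = pre n y' ↔ y = y' := by
  rw [pre_eq_iff, funext_iff]
  simp

theorem suf_zero_eq_iff {y y' : Fin n → α} : suf 0 y = suf 0 y' ↔ y = y' := by
  rw [suf_eq_iff, funext_iff]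
  simp

theorem suf_congr {i k : ℕ} (h : i ≤ k) {y y' : Fin n → α} (hy : suf i y = suf i y') :
    suf k y = suf k y' := by
  rw [suf_eq_iff] at hy ⊢
  exact fun j hj => hy j (by omega)

theorem sum_log_prodWeight {Ω β : Type*} [Fintype Ω] {Q : Ω → ℝ} (hQ : ∀ ω, 0 ≤ Q ω)
    {p : β → ℝ} {A : Ω → Fin n → β} (h : ∀ ω, 0 < Q ω → ∀ i, 0 < p (A ω i)) :
    ∑ ω, Q ω * Real.log (prodWeight p (A ω)) = ∑ i, ∑ ω, Q ω * Real.log (p (A ω i)) := by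
  rw [Finset.sum_comm]
  refine Finset.sum_congr rfl fun ω _ => ?_
  rcases (hQ ω).eq_or_lt with h0 | h0
  · simp [← h0]
  · rw [log_prodWeight (h ω h0), Finset.mul_sum]

end Blocks

/-! ### Single-letterization by telescoping entropies. -/

section Chain

variable {X Y Z Xh : Type*} [Fintype X] [Fintype Y] [Fintype Z] [Fintype Xh] {n : ℕ}
  {Q : (Fin n → X × Y × Z) → ℝ} {σ : Type*} (f : (Fin n → Y) → σ)

/-- The joint entropy of `f(Y^n)`, the `Y_j` with `j < i` and the `Z_j` with `k ≤ j`. -/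
def chainEnt (Q : (Fin n → X × Y × Z) → ℝ) (i k : ℕ) : ℝ :=
  ent Q (fun ω => (f (ys ω), pre i (ys ω), suf k (zs ω)))

/-- The auxiliary random variable `U_i`. -/
def aux (i : Fin n) (ω : Fin n → X × Y × Z) : σ × (Fin n → Option Y) × (Fin n → Option Z) :=
  (f (ys ω), pre i.1 (ys ω), suf (i.1 + 1) (zs ω))

/-- Adjoining Z_i to U_i extends the suffix by one letter, adjoining Y_i extends the prefix. All the
entropies thus sit on the grid `chainEnt f Q i k`, where sums over i telescope. -/
theorem ent_z_aux (i : Fin n) :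
    ent Q (fun ω => (zs ω i, aux f i ω)) = chainEnt f Q i.1 i.1 := by
  refine ent_congr fun ω ω' => ?_
  simp only [aux, Prod.mk.injEq, suf_eq_iff_succ]
  tauto

theorem ent_y_aux (i : Fin n) :
    ent Q (fun ω => (ys ω i, aux f i ω)) = chainEnt f Q (i.1 + 1) (i.1 + 1) := by
  refine ent_congr fun ω ω' => ?_
  simp only [aux, Prod.mk.injEq, pre_succ_eq_iff]
  tauto

theorem ent_yz_aux (i : Fin n) :
    ent Q (fun ω => ((ys ω i, zs ω i), aux f i ω)) = chainEnt f Q (i.1 + 1) i.1 := by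
  refine ent_congr fun ω ω' => ?_
  simp only [aux, Prod.mk.injEq, pre_succ_eq_iff, suf_eq_iff_succ]
  tauto

theorem ent_aux (i : Fin n) : ent Q (aux f i) = chainEnt f Q i.1 (i.1 + 1) := rfl

/-- `∑ H(Z_i | U_i) ≤ H(Z^n | S)`. -/
theorem sum_ent_z_le [Fintype σ] (hQ : IsPMF Q) :
    ∑ i : Fin n, (chainEnt f Q i.1 i.1 - chainEnt f Q i.1 (i.1 + 1)) ≤
      ent Q (fun ω => (f (ys ω), zs ω)) - ent Q (fun ω => f (ys ω)) := by
  have h0 : chainEnt f Q 0 0 = ent Q (fun ω => (f (ys ω), zs ω)) := ent_congr fun ω ω' => by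
    simp [pre_zero_eq (y := ys ω) (y' := ys ω'), suf_zero_eq_iff]
  have hn : chainEnt f Q 0 n = ent Q (fun ω => f (ys ω)) := ent_congr fun ω ω' => by
    simp [pre_zero_eq (y := ys ω) (y' := ys ω'), suf_length_eq (y := zs ω) (y' := zs ω')]
  have : ∀ i : Fin n, chainEnt f Q i.1 i.1 - chainEnt f Q i.1 (i.1 + 1) ≤
      chainEnt f Q 0 i.1 - chainEnt f Q 0 (i.1 + 1) := fun i => by
    -- Dropping Y^{i-1} from the conditioning leaves the chain rule of H(Z^n | S), taken from the
    -- last letter backwards.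
    have h := ent_submod hQ (fun ω => zs ω i) (aux f i)
      (fun ω => (f (ys ω), pre 0 (ys ω), suf (i.1 + 1) (zs ω))) (fun ω ω' h => by
        simp only [aux, Prod.mk.injEq] at h ⊢
        exact ⟨h.1, pre_zero_eq, h.2.2⟩)
    rw [ent_z_aux, ent_aux, ent_congr (A := fun ω => (zs ω i, f (ys ω), pre 0 (ys ω),
      suf (i.1 + 1) (zs ω))) (B := fun ω => (f (ys ω), pre 0 (ys ω), suf i.1 (zs ω)))
      (by simp only [Prod.mk.injEq, suf_eq_iff_succ]; tauto)] at h
    exact h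
  refine (Finset.sum_le_sum fun i _ => this i).trans (le_of_eq ?_)
  rw [Fin.sum_univ_eq_sum_range (fun i => chainEnt f Q 0 i - chainEnt f Q 0 (i + 1)),
    Finset.sum_range_sub', h0, hn]

theorem chainEnt_length_zero : chainEnt f Q n 0 = ent Q (fun ω => (ys ω, zs ω)) :=
  ent_congr fun ω ω' => by
    simp only [Prod.mk.injEq, pre_length_eq_iff, suf_zero_eq_iff]
    exact ⟨fun h => h.2, fun h => ⟨by rw [h.1], h⟩⟩

/-- `H(Y^n | S, Z^n) ≤ ∑ H(Y_i | U_i, Z_i)`. -/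
theorem le_sum_ent_y [Fintype σ] (hQ : IsPMF Q) :
    ent Q (fun ω => (ys ω, zs ω)) - ent Q (fun ω => (f (ys ω), zs ω)) ≤
      ∑ i : Fin n, (chainEnt f Q (i.1 + 1) i.1 - chainEnt f Q i.1 i.1) := by
  have h0 : chainEnt f Q 0 0 = ent Q (fun ω => (f (ys ω), zs ω)) := ent_congr fun ω ω' => by
    simp [pre_zero_eq (y := ys ω) (y' := ys ω'), suf_zero_eq_iff]
  have : ∀ i : Fin n, chainEnt f Q (i.1 + 1) 0 - chainEnt f Q i.1 0 ≤
      chainEnt f Q (i.1 + 1) i.1 - chainEnt f Q i.1 i.1 := fun i => by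
    -- H(Y_i | S, Y^{i-1}, Z^n) increases when the letters Z_j with j < i are dropped.
    have h := ent_submod hQ (fun ω => ys ω i)
      (fun ω => (f (ys ω), pre i.1 (ys ω), suf 0 (zs ω)))
      (fun ω => (f (ys ω), pre i.1 (ys ω), suf i.1 (zs ω))) (fun ω ω' h => by
        simp only [Prod.mk.injEq] at h ⊢
        exact ⟨h.1, h.2.1, suf_congr (Nat.zero_le _) h.2.2⟩)
    have hk : ∀ k, ent Q (fun ω => (ys ω i, f (ys ω), pre i.1 (ys ω), suf k (zs ω))) =
        chainEnt f Q (i.1 + 1) k := fun k => ent_congr fun ω ω' => by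
      simp only [Prod.mk.injEq, pre_succ_eq_iff]; tauto
    rw [hk, hk] at h
    exact h
  refine le_trans (le_of_eq ?_) (Finset.sum_le_sum fun i _ => this i)
  rw [Fin.sum_univ_eq_sum_range (fun i => chainEnt f Q (i + 1) 0 - chainEnt f Q i 0),
    Finset.sum_range_sub (fun i => chainEnt f Q i 0), h0, chainEnt_length_zero]

/-- The sum of the terms measuring how far the single-letter laws are from satisfying the Markov
conditions. -/
theorem sum_markov_le [Fintype σ] (hQ : IsPMF Q) (h : σ → (Fin n → Z) → Fin n → Xh) :
    ∑ i : Fin n, (chainEnt f Q (i.1 + 1) (i.1 + 1) +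
      ent Q (fun ω => ((zs ω i, h (f (ys ω)) (zs ω) i), aux f i ω)) - chainEnt f Q i.1 i.1 -
      ent Q (fun ω => ((xs ω i, ys ω i, zs ω i, h (f (ys ω)) (zs ω) i), aux f i ω))) ≤
      ent Q ys - ent Q (fun ω => ω) := by
  -- The chain rule of H(X^n | Y^n, Z^n) telescopes along H(X^{i-1}, Y^n, Z^n).
  set ξ : ℕ → ℝ := fun i => ent Q (fun ω => (pre i (xs ω), ys ω, zs ω)) with hξ
  have hξ0 : ξ 0 = chainEnt f Q n 0 := by
    rw [chainEnt_length_zero]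
    exact ent_congr fun ω ω' => by simp [pre_zero_eq (y := xs ω) (y' := xs ω')]
  have hξn : ξ n = ent Q (fun ω => ω) := ent_congr fun ω ω' => by
    simp only [Prod.mk.injEq, pre_length_eq_iff]
    simp [xs, ys, zs, funext_iff, Prod.ext_iff, forall_and]
  have hnn : chainEnt f Q n n = ent Q ys := ent_congr fun ω ω' => by
    simp only [Prod.mk.injEq, pre_length_eq_iff, suf_length_eq (y := zs ω) (y' := zs ω'), and_true]
    exact ⟨fun h => h.2, fun h => ⟨by rw [h], h⟩⟩
  have : ∀ i : Fin n, chainEnt f Q (i.1 + 1) (i.1 + 1) +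
      ent Q (fun ω => ((zs ω i, h (f (ys ω)) (zs ω) i), aux f i ω)) - chainEnt f Q i.1 i.1 -
      ent Q (fun ω => ((xs ω i, ys ω i, zs ω i, h (f (ys ω)) (zs ω) i), aux f i ω)) ≤
      (chainEnt f Q (i.1 + 1) (i.1 + 1) - chainEnt f Q i.1 i.1) -
      (chainEnt f Q (i.1 + 1) 0 - chainEnt f Q i.1 0) - (ξ (i.1 + 1) - ξ i.1) := fun i => by
    -- Since (S, Y^{i-1}, Z^n) determines U_i, Z_i and the reproduction letter, H(X_i, Y_i | Z_i,
    -- Xh_i, U_i) is at least H(X_i, Y_i | S, Y^{i-1}, Z^n).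
    have h1 := ent_submod hQ (fun ω => (xs ω i, ys ω i))
      (fun ω => (f (ys ω), pre i.1 (ys ω), suf 0 (zs ω)))
      (fun ω => ((zs ω i, h (f (ys ω)) (zs ω) i), aux f i ω)) (fun ω ω' h => by
        simp only [aux, Prod.mk.injEq] at h ⊢
        have hz := suf_zero_eq_iff.1 h.2.2
        simp [h.1, h.2.1, hz])
    -- The part of X_i that remains after Y_i is bounded below by conditioning on X^{i-1} and on all
    -- of Y^n, Z^n.
    have h2 := ent_submod hQ (fun ω => xs ω i) (fun ω => (pre i.1 (xs ω), ys ω, zs ω))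
      (fun ω => (f (ys ω), pre (i.1 + 1) (ys ω), suf 0 (zs ω))) (fun ω ω' h => by
        simp only [Prod.mk.injEq] at h ⊢
        simp [h.2.1, h.2.2])
    have e1 : ent Q (fun ω => ((xs ω i, ys ω i), (zs ω i, h (f (ys ω)) (zs ω) i), aux f i ω)) =
        ent Q (fun ω => ((xs ω i, ys ω i, zs ω i, h (f (ys ω)) (zs ω) i), aux f i ω)) :=
      ent_congr fun ω ω' => by simp only [Prod.mk.injEq]; tauto
    have e2 : ent Q (fun ω => ((xs ω i, ys ω i), f (ys ω), pre i.1 (ys ω), suf 0 (zs ω))) =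
        ent Q (fun ω => (xs ω i, f (ys ω), pre (i.1 + 1) (ys ω), suf 0 (zs ω))) :=
      ent_congr fun ω ω' => by simp only [Prod.mk.injEq, pre_succ_eq_iff]; tauto
    have e3 : ent Q (fun ω => (xs ω i, pre i.1 (xs ω), ys ω, zs ω)) = ξ (i.1 + 1) :=
      ent_congr fun ω ω' => by simp only [Prod.mk.injEq, pre_succ_eq_iff]; tauto
    rw [e1, e2] at h1
    rw [e3] at h2
    simp only [chainEnt, hξ] at h1 h2 ⊢
    linarith
  refine (Finset.sum_le_sum fun i _ => this i).trans (le_of_eq ?_)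
  rw [Finset.sum_sub_distrib, Finset.sum_sub_distrib,
    Fin.sum_univ_eq_sum_range (fun i => chainEnt f Q (i + 1) (i + 1) - chainEnt f Q i i),
    Fin.sum_univ_eq_sum_range (fun i => chainEnt f Q (i + 1) 0 - chainEnt f Q i 0),
    Fin.sum_univ_eq_sum_range (fun i => ξ (i + 1) - ξ i),
    Finset.sum_range_sub (fun i => chainEnt f Q i i),
    Finset.sum_range_sub (fun i => chainEnt f Q i 0), Finset.sum_range_sub ξ, hξ0, hξn, hnn]
  ring

end Chain

/-! ### Single-letter functionals and mixtures of conditional laws. -/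

section SingleLetterFunctionals

variable {X Y Z Xh : Type*} [Fintype X] [Fintype Y] [Fintype Z] [Fintype Xh]

/-- The identification rate `E[-log P_Z] - H(Z)` of a conditional law given `U = u`. -/
def Model.rateZ (P : Model X Y Z Xh) (q : X × Y × Z × Xh → ℝ) : ℝ :=
  -∑ t, q t * Real.log (P.pZ t.2.2.1) - ent q (fun t => t.2.2.1)

/-- The rate `E[-log P_{Y|Z}] - H(Y|Z)` of a conditional law given `U = u`. -/
def Model.rateY (P : Model X Y Z Xh) (q : X × Y × Z × Xh → ℝ) : ℝ :=
  -∑ t, q t * (Real.log (P.pYZ (t.2.1, t.2.2.1)) - Real.log (P.pZ t.2.2.1)) -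
    ent q (fun t => (t.2.1, t.2.2.1)) + ent q (fun t => t.2.2.1)

/-- The divergence of a conditional law given `U = u` from the laws satisfying the Markov
conditions. -/
def Model.markovGap (P : Model X Y Z Xh) (q : X × Y × Z × Xh → ℝ) : ℝ :=
  -∑ t, q t * (Real.log (P.joint (t.1, t.2.1, t.2.2.1)) - Real.log (P.pY t.2.1)) +
    ent q (fun t => t.2.1) + ent q (fun t => t.2.2) - ent q (fun t => t.2.2.1) -
    ent q (fun t => t)

/-- The expected distortion. -/
def Model.expDist (P : Model X Y Z Xh) (q : X × Y × Z × Xh → ℝ) : ℝ :=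
  ∑ t, q t * P.d t.1 t.2.2.2

/-- All the functionals of a conditional law. -/
def Model.functionals (P : Model X Y Z Xh) (q : X × Y × Z × Xh → ℝ) :
    (Y → ℝ) × ℝ × ℝ × ℝ × ℝ :=
  (law q (fun t => t.2.1), P.rateZ q, P.rateY q, P.markovGap q, P.expDist q)

/-- The laws of `(X, Y, Z, Xh)` whose marginal is supported in the support of `P_{XYZ}`. -/
def Model.condLaws (P : Model X Y Z Xh) : Set (X × Y × Z × Xh → ℝ) :=
  {q | IsPMF q ∧ ∀ t, P.joint (t.1, t.2.1, t.2.2.1) = 0 → q t = 0}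

/-- Averaging over U turns linear functionals of the conditional laws into expectations, and (next
lemma) entropies into conditional entropies. -/
theorem mul_sum_mixture {Ω T α : Type*} [Fintype Ω] [Fintype T] [Fintype α] {Q : Ω → ℝ}
    (hQ : IsPMF Q) (U : Ω → α) (A : Ω → T) (φ : T → ℝ) :
    ∑ u, law Q U u * ∑ t, law (cond Q U u) A t * φ t = ∑ ω, Q ω * φ (A ω) := by
  rw [← sum_cond hQ U (fun _ ω => φ (A ω))]
  exact Finset.sum_congr rfl fun u _ => by rw [sum_law]

theorem mul_ent_mixture {Ω T α β : Type*} [Fintype Ω] [Fintype T] [Fintype α] {Q : Ω → ℝ}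
    (hQ : IsPMF Q) (U : Ω → α) (A : Ω → T) (B : T → β) :
    ∑ u, law Q U u * ent (law (cond Q U u) A) B =
      ent Q (fun ω => (B (A ω), U ω)) - ent Q U := by
  simp only [ent_law]
  exact sum_ent_cond hQ U _

/-- Single-letterization: the mixture of the conditional laws given the auxiliary variables. -/
theorem Model.exists_mixture (P : Model X Y Z Xh) {n : ℕ} (hn : 0 < n) (C : Code Y Z Xh n) (D : ℝ)
    (hc : 0 < P.correctProb C D) {κ : ℝ} (hκ : -Real.log (P.correctProb C D) ≤ κ) :
    ∃ v ∈ convexHull ℝ (P.functionals '' P.condLaws),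
      Real.log C.M - κ ≤ n * v.2.1 ∧
      n * v.2.2.1 ≤ Real.log C.L - Real.log C.M + 2 * κ ∧
      n * v.2.2.2.1 ≤ κ ∧ v.2.2.2.2 ≤ D ∧
      n * (-∑ y, v.1 y * Real.log (P.pY y) - ∑ y, Real.negMulLog (v.1 y)) ≤ κ := by
  obtain ⟨Q, hQ, hsupp, hd, hM, hL, hmk, hY⟩ := P.exists_changed_measure C D hc hκ
  have hn' : (n : ℝ) ≠ 0 := by exact_mod_cast hn.ne'
  set A : Fin n → (Fin n → X × Y × Z) → X × Y × Z × Xh := fun i ω =>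
    (xs ω i, ys ω i, zs ω i, C.h (C.f (ys ω)) (zs ω) i) with hA
  set U := aux (X := X) (Z := Z) (n := n) C.f with hU
  set q := fun i u => law (cond Q (U i) u) (A i) with hq
  -- The position i, uniform on the n letters, acts as a time-sharing component of the auxiliary
  -- variable.
  set v : (Y → ℝ) × ℝ × ℝ × ℝ × ℝ :=
    ∑ iu : Fin n × (Fin C.L × (Fin n → Option Y) × (Fin n → Option Z)),
      ((1 / (n : ℝ)) * law Q (U iu.1) iu.2) • P.functionals (q iu.1 iu.2) with hv
  have hvn : (n : ℝ) • v = ∑ i, ∑ u, law Q (U i) u • P.functionals (q i u) := by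
    rw [hv, Fintype.sum_prod_type, Finset.smul_sum]
    refine Finset.sum_congr rfl fun i _ => ?_
    rw [Finset.smul_sum]
    refine Finset.sum_congr rfl fun u _ => ?_
    rw [smul_smul, ← mul_assoc, mul_one_div_cancel hn', one_mul]
  -- positivity of the marginals
  have hpY : ∀ ω, 0 < Q ω → ∀ i, 0 < P.pY (ys ω i) := fun ω h i =>
    law_pos P.joint_isPMF.nonneg (fun t => t.2.1) (hsupp ω h i)
  have hpZ : ∀ ω, 0 < Q ω → ∀ i, 0 < P.pZ (zs ω i) := fun ω h i =>
    law_pos P.joint_isPMF.nonneg (fun t => t.2.2) (hsupp ω h i)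
  have hpYZ : ∀ ω, 0 < Q ω → ∀ i, 0 < P.pYZ (ω i).2 := fun ω h i =>
    law_pos P.joint_isPMF.nonneg (fun t => t.2) (hsupp ω h i)
  have sY := sum_log_prodWeight hQ.nonneg hpY
  have sZ := sum_log_prodWeight hQ.nonneg hpZ
  have sYZ := sum_log_prodWeight (A := fun ω i => (ω i).2) hQ.nonneg hpYZ
  have sXYZ := sum_log_prodWeight (A := fun ω => ω) hQ.nonneg hsupp
  -- the functionals of the mixture
  have ha : (n : ℝ) * v.2.1 = -∑ ω, Q ω * Real.log (prodWeight P.pZ (zs ω)) -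
      ∑ i : Fin n, (chainEnt C.f Q i.1 i.1 - chainEnt C.f Q i.1 (i.1 + 1)) := by
    have h := congrArg (fun v => v.2.1) hvn
    simp only [Prod.smul_snd, Prod.smul_fst, smul_eq_mul, Prod.snd_sum, Prod.fst_sum,
      Model.functionals, Model.rateZ] at h
    rw [h, sZ, ← Finset.sum_neg_distrib, ← Finset.sum_sub_distrib]
    refine Finset.sum_congr rfl fun i _ => ?_
    simp only [mul_sub, mul_neg, Finset.sum_sub_distrib, Finset.sum_neg_distrib, hq]
    rw [mul_sum_mixture hQ (U i) (A i) (fun t => Real.log (P.pZ t.2.2.1)),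
      mul_ent_mixture hQ (U i) (A i) (fun t => t.2.2.1)]
    simp only [hA, hU]
    rw [ent_z_aux, ent_aux]
  have hb : (n : ℝ) * v.2.2.1 = -∑ ω, Q ω * Real.log (prodWeight P.pYZ (fun i => (ω i).2)) +
      ∑ ω, Q ω * Real.log (prodWeight P.pZ (zs ω)) -
      ∑ i : Fin n, (chainEnt C.f Q (i.1 + 1) i.1 - chainEnt C.f Q i.1 i.1) := by
    have h := congrArg (fun v => v.2.2.1) hvn
    simp only [Prod.smul_snd, Prod.smul_fst, smul_eq_mul, Prod.snd_sum, Prod.fst_sum,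
      Model.functionals, Model.rateY] at h
    rw [h, sZ, sYZ, ← Finset.sum_neg_distrib, ← Finset.sum_add_distrib, ← Finset.sum_sub_distrib]
    refine Finset.sum_congr rfl fun i _ => ?_
    simp only [mul_sub, mul_add, mul_neg, Finset.sum_sub_distrib, Finset.sum_add_distrib,
      Finset.sum_neg_distrib, hq]
    rw [mul_sum_mixture hQ (U i) (A i) (fun t => Real.log (P.pZ t.2.2.1)),
      mul_sum_mixture hQ (U i) (A i) (fun t => Real.log (P.pYZ (t.2.1, t.2.2.1))),
      mul_ent_mixture hQ (U i) (A i) (fun t => t.2.2.1),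
      mul_ent_mixture hQ (U i) (A i) (fun t => (t.2.1, t.2.2.1))]
    simp only [hA, hU]
    rw [ent_z_aux, ent_yz_aux]
    simp only [ys, zs]
    ring
  have hm : (n : ℝ) * v.2.2.2.1 = -∑ ω, Q ω * Real.log (prodWeight P.joint ω) +
      ∑ ω, Q ω * Real.log (prodWeight P.pY (ys ω)) + ∑ i : Fin n,
      (chainEnt C.f Q (i.1 + 1) (i.1 + 1) +
        ent Q (fun ω => ((zs ω i, C.h (C.f (ys ω)) (zs ω) i), aux C.f i ω)) -
        chainEnt C.f Q i.1 i.1 -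
        ent Q (fun ω => ((xs ω i, ys ω i, zs ω i, C.h (C.f (ys ω)) (zs ω) i), aux C.f i ω))) := by
    have h := congrArg (fun v => v.2.2.2.1) hvn
    simp only [Prod.smul_snd, Prod.smul_fst, smul_eq_mul, Prod.snd_sum, Prod.fst_sum,
      Model.functionals, Model.markovGap] at h
    rw [h, sY, sXYZ, ← Finset.sum_neg_distrib, ← Finset.sum_add_distrib, ← Finset.sum_add_distrib]
    refine Finset.sum_congr rfl fun i _ => ?_
    simp only [mul_sub, mul_add, mul_neg, Finset.sum_sub_distrib, Finset.sum_add_distrib,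
      Finset.sum_neg_distrib, hq]
    rw [mul_sum_mixture hQ (U i) (A i) (fun t => Real.log (P.pY t.2.1)),
      mul_sum_mixture hQ (U i) (A i) (fun t => Real.log (P.joint (t.1, t.2.1, t.2.2.1))),
      mul_ent_mixture hQ (U i) (A i) (fun t => t.2.2.1),
      mul_ent_mixture hQ (U i) (A i) (fun t => t.2.1),
      mul_ent_mixture hQ (U i) (A i) (fun t => t.2.2),
      mul_ent_mixture hQ (U i) (A i) (fun t => t)]
    simp only [hA, hU]
    rw [ent_z_aux, ent_y_aux]
    simp only [xs, ys, zs]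
    ring
  have hdist : (n : ℝ) * v.2.2.2.2 = ∑ ω, Q ω * ∑ i, P.d (xs ω i) (C.h (C.f (ys ω)) (zs ω) i) := by
    have h := congrArg (fun v => v.2.2.2.2) hvn
    simp only [Prod.smul_snd, smul_eq_mul, Prod.snd_sum,
      Model.functionals, Model.expDist, hq] at h
    rw [h]
    calc _ = ∑ i : Fin n, ∑ ω, Q ω * P.d (xs ω i) (C.h (C.f (ys ω)) (zs ω) i) :=
          Finset.sum_congr rfl fun i _ =>
            mul_sum_mixture hQ (U i) (A i) (fun t => P.d t.1 t.2.2.2)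
      _ = _ := by
          rw [Finset.sum_comm]
          simp only [Finset.mul_sum]
  -- The first component of the mixture is the average over i of the laws of Y_i under Q.
  have hvY : ∀ φ : Y → ℝ, (n : ℝ) * ∑ y, v.1 y * φ y = ∑ i, ∑ ω, Q ω * φ (ys ω i) := fun φ => by
    have h := congrArg (fun v => v.1) hvn
    simp only [Prod.smul_fst, Prod.fst_sum, Model.functionals, hq] at h
    have h' : ∀ y, (n : ℝ) * v.1 y = ∑ i : Fin n, law Q (fun ω => ys ω i) y := fun y => by
      have := congrFun h y
      simp only [Pi.smul_apply, smul_eq_mul, Finset.sum_apply, law_comp] at this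
      rw [this]
      refine Finset.sum_congr rfl fun i _ => ?_
      have := sum_cond hQ (U i) (fun _ ω => if ys ω i = y then 1 else 0)
      simpa [law, A] using this
    simp only [Finset.mul_sum, ← mul_assoc, h', Finset.sum_mul]
    rw [Finset.sum_comm]
    exact Finset.sum_congr rfl fun i _ => sum_law Q (fun ω => ys ω i) φ
  have hv0 : ∀ y, 0 ≤ v.1 y := fun y => by
    have h := hvY (fun y' => if y' = y then 1 else 0)
    simp only [mul_ite, mul_one, mul_zero, Finset.sum_ite_eq', Finset.mem_univ, if_true] at h
    have h0 : 0 ≤ (n : ℝ) * v.1 y := h ▸ Finset.sum_nonneg fun i _ => Finset.sum_nonneg fun ω _ => by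
      split_ifs <;> simp [hQ.nonneg]
    exact nonneg_of_mul_nonneg_right h0 (by positivity)
  have hv1 : ∑ y, v.1 y = 1 := by
    have h := hvY (fun _ => 1)
    simp only [mul_one, hQ.sum_eq, Finset.sum_const, Finset.card_univ, Fintype.card_fin,
      nsmul_eq_mul] at h
    exact mul_left_cancel₀ hn' (by simpa using h)
  have hvp : ∀ ω, 0 < Q ω → ∀ i, 0 < v.1 (ys ω i) := fun ω h i => by
    refine (hv0 _).lt_of_ne fun h0 => ?_
    have h' := hvY (fun y' => if y' = ys ω i then 1 else 0)
    simp only [mul_ite, mul_one, mul_zero, Finset.sum_ite_eq', Finset.mem_univ, if_true] at h'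
    rw [← h0, mul_zero] at h'
    have hn1 : ∀ j, ∀ ω' , 0 ≤ (if ys ω' j = ys ω i then Q ω' else 0) := fun j ω' => by
      split_ifs <;> simp [hQ.nonneg]
    have h1 := (Finset.sum_eq_zero_iff_of_nonneg fun j _ =>
      Finset.sum_nonneg fun ω' _ => hn1 j ω').1 h'.symm i (Finset.mem_univ _)
    have h2 := (Finset.sum_eq_zero_iff_of_nonneg fun ω' _ => hn1 i ω').1 h1 ω (Finset.mem_univ _)
    simp at h2
    exact h.ne' h2
  refine ⟨v, sum_smul_mem_convexHull ⟨fun iu => mul_nonneg (by positivity)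
    (law_nonneg hQ.nonneg _ _), ?_⟩ fun iu hiu => ?_, ?_, ?_, ?_, ?_, ?_⟩
  · rw [Fintype.sum_prod_type]
    simp only [← Finset.mul_sum, (hQ.law _).sum_eq]
    simp [hn']
  · refine ⟨_, ⟨(cond_isPMF hQ (right_ne_zero_of_mul hiu)).law _, fun t ht => ?_⟩, rfl⟩
    by_contra hne
    obtain ⟨ω, hω, hω'⟩ := exists_of_law_pos hne
    have hQω : Q ω ≠ 0 := fun h0 => hω' (by simp [cond, h0])
    have := hsupp ω ((hQ.nonneg ω).lt_of_ne' hQω) iu.1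
    rw [← hω] at ht
    exact this.ne' ht
  · rw [ha]
    have := sum_ent_z_le C.f hQ
    linarith
  · rw [hb]
    have := le_sum_ent_y C.f hQ
    linarith
  · rw [hm]
    have := sum_markov_le C.f hQ C.h
    linarith
  · have : (n : ℝ) * v.2.2.2.2 ≤ n * D := by
      rw [hdist]
      calc _ ≤ ∑ ω, Q ω * (n * D) := by
            refine Finset.sum_le_sum fun ω _ => ?_
            rcases (hQ.nonneg ω).eq_or_lt with h0 | h0
            · simp [← h0]
            · refine mul_le_mul_of_nonneg_left ?_ h0.le
              have := hd ω h0
              rw [Model.blockDist, one_div, inv_mul_le_iff₀ (by positivity)] at this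
              exact this
        _ = n * D := by rw [← Finset.sum_mul, hQ.sum_eq, one_mul]
    exact le_of_mul_le_mul_left this (by positivity)
  -- Gibbs' inequality for the product of the averaged marginal gives H(Y^n) ≤ n H(v.1), so n D(v.1
  -- ‖ P_Y) is at most the divergence of Y^n, which is at most κ.
  · have h1 : ent Q ys ≤ -∑ ω, Q ω * Real.log (prodWeight v.1 (ys ω)) :=
      ent_le hQ ys (prodWeight v.1) (IsPMF.prodWeight ⟨hv0, hv1⟩).nonneg
        (IsPMF.prodWeight ⟨hv0, hv1⟩).sum_eq.le fun ω h => (prodWeight_pos hv0).2 (hvp ω h)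
    rw [sum_log_prodWeight hQ.nonneg hvp, ← hvY (fun y => Real.log (v.1 y))] at h1
    rw [sY, ← hvY (fun y => Real.log (P.pY y))] at hY
    simp only [Real.negMulLog, neg_mul, Finset.sum_neg_distrib, mul_sub, mul_neg]
    linarith

end SingleLetterFunctionals

/-! ### Carathéodory's theorem and basic solutions. -/

section ConvexGeometry

theorem sum_extend_zero {ι κ E : Type*} [Fintype ι] [Fintype κ] [AddCommMonoid E] (e : ι ↪ κ)
    (G : ι → E) : ∑ j, Function.extend e G 0 j = ∑ i, G i := by
  rw [← Finset.sum_subset (Finset.subset_univ (Finset.univ.map e)), Finset.sum_map]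
  · exact Finset.sum_congr rfl fun i _ => e.injective.extend_apply _ _ _
  · intro j _ hj
    rw [Function.extend_apply']
    · rfl
    · simpa using hj

/-- Points of the convex hull of an image are mixtures of boundedly many points. -/
theorem exists_mixture_of_mem_convexHull {E T : Type*} [AddCommGroup E] [Module ℝ E]
    [FiniteDimensional ℝ E] {F : T → E} {K : Set T} {v : E} (hv : v ∈ convexHull ℝ (F '' K)) :
    ∃ w ∈ stdSimplex ℝ (Fin (Module.finrank ℝ E + 1)), ∃ q : Fin (Module.finrank ℝ E + 1) → T,
      (∀ i, q i ∈ K) ∧ ∑ i, w i • F (q i) = v := by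
  obtain ⟨ι, _, z, w, hz, hai, hw0, hw1, hwz⟩ := eq_pos_convex_span_of_mem_convexHull hv
  have hne : Nonempty ι := by
    by_contra h
    rw [not_nonempty_iff] at h
    simp at hw1
  have hcard : Fintype.card ι ≤ Fintype.card (Fin (Module.finrank ℝ E + 1)) := by
    rw [← hai.finrank_vectorSpan_add_one, Fintype.card_fin]
    exact Nat.succ_le_succ (Submodule.finrank_le _)
  obtain ⟨e⟩ := Function.Embedding.nonempty_of_card_le hcard
  choose p hpK hp using fun i => hz (Set.mem_range_self i)
  -- Padding with zero weights and one fixed element of `K` makes the number of points depend only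
  -- on the dimension, as the compactness argument requires.
  refine ⟨Function.extend e w 0, ⟨fun j => ?_, by rw [sum_extend_zero, hw1]⟩,
    Function.extend e p (fun _ => p hne.some), fun j => ?_, ?_⟩
  · by_cases h : ∃ i, e i = j
    · obtain ⟨i, rfl⟩ := h
      rw [e.injective.extend_apply]
      exact (hw0 i).le
    · rw [Function.extend_apply' _ _ _ h]
      simp
  · by_cases h : ∃ i, e i = j
    · obtain ⟨i, rfl⟩ := h
      rw [e.injective.extend_apply]
      exact hpK i
    · rw [Function.extend_apply' _ _ _ h]
      exact hpK _
  · rw [← hwz, ← sum_extend_zero e (fun i => w i • z i)]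
    refine Finset.sum_congr rfl fun j _ => ?_
    by_cases h : ∃ i, e i = j
    · obtain ⟨i, rfl⟩ := h
      simp only [e.injective.extend_apply, hp]
    · simp [Function.extend_apply' _ _ _ h]

/-- Basic solutions of a linear program: a nonnegative combination can be supported on at most
`dim E` points, without changing its value and without increasing the cost. -/
theorem exists_basic_solution {E ι : Type*} [AddCommGroup E] [Module ℝ E] [FiniteDimensional ℝ E]
    [Fintype ι] (v : ι → E) (c : ι → ℝ) (l : E →ₗ[ℝ] ℝ) (hl : ∀ i, l (v i) = 1) (m : ℕ) :
    ∀ w : ι → ℝ, (∀ i, 0 ≤ w i) → (Finset.univ.filter (fun i => w i ≠ 0)).card ≤ m →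
    ∃ w' : ι → ℝ, (∀ i, 0 ≤ w' i) ∧ (∀ i, w i = 0 → w' i = 0) ∧
      ∑ i, w' i • v i = ∑ i, w i • v i ∧ ∑ i, w' i * c i ≤ ∑ i, w i * c i ∧
      (Finset.univ.filter (fun i => w' i ≠ 0)).card ≤ Module.finrank ℝ E := by
  induction m with
  | zero =>
    intro w hw hm
    exact ⟨w, hw, fun _ h => h, rfl, le_rfl, hm.trans (Nat.zero_le _)⟩
  | succ m ih =>
    intro w hw hm
    set s := Finset.univ.filter (fun i => w i ≠ 0) with hs
    by_cases hcard : s.card ≤ Module.finrank ℝ E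
    · exact ⟨w, hw, fun _ h => h, rfl, le_rfl, hcard⟩
    have hdep : ¬ LinearIndependent ℝ (fun i : s => v i) := fun h => by
      have := h.fintype_card_le_finrank
      rw [Fintype.card_coe] at this
      exact hcard this
    obtain ⟨g0, hg0, ⟨i0, hi0⟩⟩ := Fintype.not_linearIndependent_iff.1 hdep
    obtain ⟨g, hgs, hgv, hgne, hgc⟩ : ∃ g : ι → ℝ, (∀ i, w i = 0 → g i = 0) ∧
        ∑ i, g i • v i = 0 ∧ (∃ i, g i ≠ 0) ∧ ∑ i, g i * c i ≤ 0 := by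
      set g1 : ι → ℝ := fun i => if h : i ∈ s then g0 ⟨i, h⟩ else 0 with hg1
      have h1 : ∀ i, w i = 0 → g1 i = 0 := fun i hi => by simp [hg1, hs, hi]
      have h2 : ∑ i, g1 i • v i = 0 := by
        rw [← hg0, ← Finset.sum_subset (Finset.subset_univ s), ← Finset.sum_attach]
        · exact Finset.sum_congr rfl fun i _ => by simp [hg1]
        · intro i _ hi
          simp [hg1, hi]
      have h3 : g1 i0 ≠ 0 := by simpa [hg1] using hi0
      -- A dependence relation may be negated, so its direction can be chosen not to raise the cost.
      rcases le_total (∑ i, g1 i * c i) 0 with h | h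
      · exact ⟨g1, h1, h2, ⟨i0, h3⟩, h⟩
      · refine ⟨fun i => -g1 i, fun i hi => by simp [h1 i hi], by simp [h2], ⟨i0, by simpa using h3⟩,
          by simpa using h⟩
    -- Since `l` is 1 on every vector, the coefficients of a dependence sum to 0, so one is
    -- negative. This saves the extra point of Carathéodory's bound.
    have hgsum : ∑ i, g i = 0 := by
      have := congrArg l hgv
      simpa [map_sum, hl] using this
    obtain ⟨i1, hi1⟩ : ∃ i, g i < 0 := by
      by_contra! h
      obtain ⟨i, hi⟩ := hgne
      exact hi ((Finset.sum_eq_zero_iff_of_nonneg fun i _ => h i).1 hgsum i (Finset.mem_univ _))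
    obtain ⟨j, hj, hmin⟩ := Finset.exists_min_image (Finset.univ.filter (fun i => g i < 0))
      (fun i => w i / -g i) ⟨i1, by simpa using hi1⟩
    simp only [Finset.mem_filter, Finset.mem_univ, true_and] at hj hmin
    -- The largest step along `g` that keeps all weights nonnegative; it annihilates the weight at
    -- `j`.
    set t := w j / -g j with ht
    have ht0 : 0 ≤ t := div_nonneg (hw j) (by linarith)
    set w1 : ι → ℝ := fun i => w i + t * g i with hw1
    have hw1n : ∀ i, 0 ≤ w1 i := fun i => by
      rcases lt_or_ge (g i) 0 with h | h
      · have := hmin i h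
        rw [le_div_iff₀ (by linarith)] at this
        simp only [hw1]
        linarith
      · exact add_nonneg (hw i) (mul_nonneg ht0 h)
    have hw1z : ∀ i, w i = 0 → w1 i = 0 := fun i hi => by simp [hw1, hi, hgs i hi]
    have hj0 : w1 j = 0 := by
      have := hj.ne
      simp only [hw1, ht]
      field_simp
      ring
    have hjs : j ∈ s := by
      simp only [hs, Finset.mem_filter, Finset.mem_univ, true_and]
      exact fun h => hj.ne (hgs j h)
    have hcard1 : (Finset.univ.filter (fun i => w1 i ≠ 0)).card ≤ m := by
      have : Finset.univ.filter (fun i => w1 i ≠ 0) ⊆ s.erase j := fun i hi => by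
        simp only [Finset.mem_filter, Finset.mem_univ, true_and, Finset.mem_erase, hs] at hi ⊢
        exact ⟨fun h => hi (h ▸ hj0), fun h => hi (hw1z i h)⟩
      have := Finset.card_le_card this
      rw [Finset.card_erase_of_mem hjs] at this
      omega
    obtain ⟨w', h1, h2, h3, h4, h5⟩ := ih w1 hw1n hcard1
    refine ⟨w', h1, fun i hi => h2 i (hw1z i hi), h3.trans ?_, h4.trans ?_, h5⟩
    · simp only [hw1, add_smul, Finset.sum_add_distrib, mul_smul, ← Finset.smul_sum, hgv, smul_zero,
        add_zero]
    · simp only [hw1, add_mul, Finset.sum_add_distrib, mul_assoc, ← Finset.mul_sum]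
      nlinarith

end ConvexGeometry

/-! ### Continuity of the functionals and compactness of the laws. -/

section Continuity

theorem continuous_law {Ω α : Type*} [Fintype Ω] (A : Ω → α) (a : α) :
    Continuous (fun Q : Ω → ℝ => law Q A a) := by
  unfold law
  refine continuous_finsetSum _ fun ω _ => ?_
  split_ifs <;> fun_prop

theorem continuous_ent {Ω α : Type*} [Fintype Ω] [Fintype α] (A : Ω → α) :
    Continuous (fun Q : Ω → ℝ => ent Q A) := by
  simp only [ent_eq_sum]
  exact continuous_finsetSum _ fun a _ => Real.continuous_negMulLog.comp (continuous_law A a)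

variable {X Y Z Xh : Type*} [Fintype X] [Fintype Y] [Fintype Z] [Fintype Xh]

/-- The logarithms outside the entropies are those of the fixed laws of the model, so these terms
are linear in `q`; the entropies are sums of `Real.negMulLog`. -/
theorem Model.continuous_functionals (P : Model X Y Z Xh) : Continuous P.functionals := by
  unfold Model.functionals Model.rateZ Model.rateY Model.markovGap Model.expDist
  have h1 := continuous_ent (Ω := X × Y × Z × Xh) (fun t => t.2.2.1)
  have h2 := continuous_ent (Ω := X × Y × Z × Xh) (fun t => (t.2.1, t.2.2.1))
  have h3 := continuous_ent (Ω := X × Y × Z × Xh) (fun t => t.2.1)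
  have h4 := continuous_ent (Ω := X × Y × Z × Xh) (fun t => t.2.2)
  have h5 := continuous_ent (Ω := X × Y × Z × Xh) (fun t => t)
  have h6 : Continuous (fun q : X × Y × Z × Xh → ℝ => law q (fun t => t.2.1)) :=
    continuous_pi fun y => continuous_law _ y
  fun_prop

/-- The support condition is closed. It must be kept in the limit, since with log 0 = 0 the
functionals do not see mass placed off the support of the model. -/
theorem Model.isCompact_condLaws (P : Model X Y Z Xh) : IsCompact P.condLaws := by
  have : P.condLaws = stdSimplex ℝ (X × Y × Z × Xh) ∩
      ⋂ t, {q | P.joint (t.1, t.2.1, t.2.2.1) = 0 → q t = 0} := by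
    ext q
    simp only [Model.condLaws, Set.mem_ofPred_eq, Set.mem_inter_iff, Set.mem_iInter]
    exact and_congr_left fun _ => ⟨fun h => ⟨h.1, h.2⟩, fun h => ⟨h.1, h.2⟩⟩
  rw [this]
  refine (isCompact_stdSimplex ℝ _).inter_right (isClosed_iInter fun t => ?_)
  by_cases h : P.joint (t.1, t.2.1, t.2.2.1) = 0
  · simp only [h, true_imp_iff]
    exact isClosed_eq (continuous_apply t) continuous_const
  · simp [h]

end Continuity

/-! ### The Markov gap and the limit mixture. -/

section Markov

variable {X Y Z Xh : Type*} [Fintype X] [Fintype Y] [Fintype Z]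

/-- The joint law of `(X, Y, Z)` when `Y` has law `π`. -/
def Model.drive (P : Model X Y Z Xh) (π : Y → ℝ) (t : X × Y × Z) : ℝ :=
  π t.2.1 * (P.joint t / P.pY t.2.1)

theorem Model.drive_nonneg (P : Model X Y Z Xh) {π : Y → ℝ} (hπ : ∀ y, 0 ≤ π y) (t) :
    0 ≤ P.drive π t :=
  mul_nonneg (hπ _) (div_nonneg (P.joint_isPMF.nonneg _) (P.pY_isPMF.nonneg _))

theorem Model.law_drive (P : Model X Y Z Xh) {π : Y → ℝ} (hπ : ∀ y, P.pY y = 0 → π y = 0) :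
    law (P.drive π) (fun t => t.2.1) = π := by
  ext y
  have h : law (P.drive π) (fun t => t.2.1) y = π y * (P.pY y / P.pY y) := by
    simp only [Model.drive, law, Model.pY, Finset.sum_div, Finset.mul_sum]
    refine Finset.sum_congr rfl fun t _ => ?_
    split_ifs with h
    · rw [h]
    · simp
  rw [h]
  rcases eq_or_ne (P.pY y) 0 with h0 | h0
  · simp [hπ y h0]
  · rw [div_self h0, mul_one]

theorem Model.drive_isPMF (P : Model X Y Z Xh) {π : Y → ℝ} (hπ : IsPMF π)
    (h : ∀ y, P.pY y = 0 → π y = 0) : IsPMF (P.drive π) := by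
  refine ⟨P.drive_nonneg hπ.nonneg, ?_⟩
  have := sum_law (P.drive π) (fun t => t.2.1) (fun _ => 1)
  rw [P.law_drive h] at this
  simpa [hπ.sum_eq] using this.symm

theorem Model.pY_pos_of_joint (P : Model X Y Z Xh) {t : X × Y × Z} (h : P.joint t ≠ 0) :
    0 < P.pY t.2.1 :=
  law_pos P.joint_isPMF.nonneg (fun t => t.2.1) ((P.joint_isPMF.nonneg t).lt_of_ne' h)

variable [Fintype Xh]

theorem Model.law_y_of_condLaws (P : Model X Y Z Xh) {q : X × Y × Z × Xh → ℝ}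
    (hq : q ∈ P.condLaws) : ∀ y, P.pY y = 0 → law q (fun t => t.2.1) y = 0 := fun y hy => by
  by_contra hne
  obtain ⟨t, rfl, ht⟩ := exists_of_law_pos hne
  exact (P.pY_pos_of_joint fun h0 => ht (hq.2 t h0)).ne' hy

/-- The Markov gap is nonnegative, and when it vanishes the law of `(X, Y, Z, Xh)` factorizes. -/
theorem Model.markovGap_spec (P : Model X Y Z Xh) {q : X × Y × Z × Xh → ℝ}
    (hq : q ∈ P.condLaws) : 0 ≤ P.markovGap q ∧ (P.markovGap q ≤ 0 →
      ∃ κ : Z → Xh → ℝ, (∀ z, IsPMF (κ z)) ∧ ∀ t, q t =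
        P.drive (law q (fun t => t.2.1)) (t.1, t.2.1, t.2.2.1) * κ t.2.2.1 t.2.2.2) := by
  have hq1 := hq.1
  have hne : Nonempty (X × Y × Z × Xh) := by
    by_contra h
    rw [not_nonempty_iff] at h
    simpa using hq1.sum_eq
  obtain ⟨⟨-, -, -, xh0⟩⟩ := hne
  set π := law q (fun t => t.2.1) with hπ
  set qZ := law q (fun t => t.2.2.1) with hqZ
  set qW := law q (fun t => t.2.2) with hqW
  have hmarg : ∀ z, ∑ xh, qW (z, xh) = qZ z := fun z => by
    have : qZ = law qW (fun p => p.1) := by rw [hqW, law_comp]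
    rw [this]
    simp only [law, Fintype.sum_prod_type]
    rw [Finset.sum_comm]
    simp
  -- The conditional law of Xh given Z, with a point mass as default where Z has probability zero.
  set κ : Z → Xh → ℝ := fun z xh => if qZ z = 0 then (if xh = xh0 then 1 else 0) else
    qW (z, xh) / qZ z with hκ
  have hκ1 : ∀ z, IsPMF (κ z) := fun z => by
    by_cases h : qZ z = 0
    · simp only [hκ, h, if_true]
      exact ⟨fun xh => by split_ifs <;> simp, by simp⟩
    · simp only [hκ, h, if_false]
      exact ⟨fun xh => div_nonneg (law_nonneg hq1.nonneg _ _) (law_nonneg hq1.nonneg _ _), by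
        rw [← Finset.sum_div, hmarg, div_self h]⟩
  have hdr := P.drive_isPMF (hq1.law (fun t => t.2.1)) (P.law_y_of_condLaws hq)
  set r : X × Y × Z × Xh → ℝ := fun t =>
    P.drive π (t.1, t.2.1, t.2.2.1) * κ t.2.2.1 t.2.2.2 with hr
  have hr0 : ∀ t, 0 ≤ r t := fun t => mul_nonneg (hdr.nonneg _) ((hκ1 _).nonneg _)
  have hr1 : ∑ t, r t = 1 := by
    simp only [hr, Fintype.sum_prod_type, ← Finset.mul_sum, (hκ1 _).sum_eq, mul_one]
    simpa only [Fintype.sum_prod_type] using hdr.sum_eq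
  have hpos : ∀ t, 0 < q t → 0 < π t.2.1 ∧ 0 < P.joint (t.1, t.2.1, t.2.2.1) ∧
      0 < P.pY t.2.1 ∧ 0 < qZ t.2.2.1 ∧ 0 < qW t.2.2 := fun t ht => by
    have hj : P.joint (t.1, t.2.1, t.2.2.1) ≠ 0 := fun h0 => ht.ne' (hq.2 t h0)
    exact ⟨law_pos hq1.nonneg (fun t => t.2.1) ht, (P.joint_isPMF.nonneg _).lt_of_ne' hj,
      P.pY_pos_of_joint hj, law_pos hq1.nonneg (fun t => t.2.2.1) ht,
      law_pos hq1.nonneg (fun t => t.2.2) ht⟩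
  have hrpos : ∀ t, 0 < q t → 0 < r t := fun t ht => by
    obtain ⟨h1, h2, h3, h4, h5⟩ := hpos t ht
    simp only [hr, hκ, if_neg h4.ne', Model.drive]
    exact mul_pos (mul_pos h1 (div_pos h2 h3)) (div_pos h5 h4)
  -- The gap is the relative entropy of q from q_Y · P_{XZ|Y} · q_{Xh|Z}, so its sign and its
  -- equality case follow from Gibbs.
  have hgap : P.markovGap q = ∑ t, q t * Real.log (q t) - ∑ t, q t * Real.log (r t) := by
    have h1 : ∀ t, q t * Real.log (r t) = q t * Real.log (π t.2.1) +
        q t * (Real.log (P.joint (t.1, t.2.1, t.2.2.1)) - Real.log (P.pY t.2.1)) +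
        (q t * Real.log (qW t.2.2) - q t * Real.log (qZ t.2.2.1)) := fun t => by
      rcases (hq1.nonneg t).eq_or_lt with h | h
      · simp [← h]
      obtain ⟨h1, h2, h3, h4, h5⟩ := hpos t h
      simp only [hr, hκ, if_neg h4.ne', Model.drive]
      rw [Real.log_mul (mul_pos h1 (div_pos h2 h3)).ne' (div_pos h5 h4).ne',
        Real.log_mul h1.ne' (div_pos h2 h3).ne', Real.log_div h2.ne' h3.ne',
        Real.log_div h5.ne' h4.ne']
      ring
    rw [Finset.sum_congr rfl fun t _ => h1 t, Finset.sum_add_distrib, Finset.sum_add_distrib,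
      Finset.sum_sub_distrib]
    simp only [Model.markovGap, ent, law_id]
    ring
  refine ⟨?_, fun h => ⟨κ, hκ1, fun t => ?_⟩⟩
  · have := sum_mul_log_le hq1 (fun t => r t / q t) (fun t h => div_pos (hrpos t h) h) ?_
    · rw [sum_mul_log_div hq1.nonneg hrpos (fun _ h => h)] at this
      linarith
    · rw [← hr1]
      refine Finset.sum_le_sum fun t _ => ?_
      rcases eq_or_ne (q t) 0 with h | h
      · simp [h, hr0]
      · rw [mul_div_cancel₀ _ h]
  · rw [hgap] at h
    exact congrFun (eq_of_sum_mul_log_le hq1 hr0 hr1.le hrpos h) t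

theorem tendsto_lim_le {α : Type*} [TopologicalSpace α] {F : α → ℝ} (hF : Continuous F)
    {p : ℕ → α} {a : α} (hp : Tendsto p atTop (𝓝 a)) {b : ℝ} {c : ℕ → ℝ}
    (hc : Tendsto c atTop (𝓝 0)) (h : ∀ k, F (p k) ≤ b + c k) : F a ≤ b := by
  have h1 := (hF.tendsto a).comp hp
  have h2 : Tendsto (fun k => b + c k) atTop (𝓝 (b + 0)) := tendsto_const_nhds.add hc
  rw [add_zero] at h2
  exact le_of_tendsto_of_tendsto' h1 h2 h

/-- If codes with nearly the rates `(Ri, Rc)` succeed with a probability that is not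
exponentially small, a mixture of conditional laws satisfies the single-letter conditions. -/
theorem Model.exists_limit_mixture (P : Model X Y Z Xh) {Ri Rc D : ℝ}
    (H : ∀ γ : ℝ, 0 < γ → ∃ n : ℕ, 0 < n ∧ ∃ C : Code Y Z Xh n,
      n * (Ri - γ) ≤ Real.log C.M ∧ Real.log C.L ≤ n * (Rc + γ) ∧
      Real.exp (-γ * n) ≤ P.correctProb C (D + γ)) :
    ∃ (N : ℕ) (w : Fin N → ℝ) (q : Fin N → X × Y × Z × Xh → ℝ), IsPMF w ∧
      (∀ i, q i ∈ P.condLaws) ∧ ∑ i, w i • law (q i) (fun t => t.2.1) = P.pY ∧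
      Ri ≤ ∑ i, w i * P.rateZ (q i) ∧ ∑ i, w i * P.rateY (q i) ≤ Rc - Ri ∧
      (∀ i, w i ≠ 0 → P.markovGap (q i) ≤ 0) ∧ ∑ i, w i * P.expDist (q i) ≤ D := by
  set N := Module.finrank ℝ ((Y → ℝ) × ℝ × ℝ × ℝ × ℝ) + 1 with hN
  set Φ : (Fin N → ℝ) × (Fin N → X × Y × Z × Xh → ℝ) → (Y → ℝ) × ℝ × ℝ × ℝ × ℝ :=
    fun p => ∑ i, p.1 i • P.functionals (p.2 i) with hΦ
  have hΦc : Continuous Φ := by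
    refine continuous_finsetSum _ fun i _ => ?_
    have := P.continuous_functionals
    fun_prop
  set γ : ℕ → ℝ := fun k => 1 / ((k : ℝ) + 1) with hγ
  have hγ0 : ∀ k, 0 < γ k := fun k => by positivity
  have hγt : Tendsto γ atTop (𝓝 0) := tendsto_one_div_add_atTop_nhds_zero_nat
  have hstep : ∀ k, ∃ p ∈ stdSimplex ℝ (Fin N) ×ˢ Set.univ.pi (fun _ => P.condLaws),
      -(Φ p).2.1 ≤ -Ri + 4 * γ k ∧ (Φ p).2.2.1 ≤ Rc - Ri + 4 * γ k ∧
      (Φ p).2.2.2.1 ≤ 0 + 4 * γ k ∧ (Φ p).2.2.2.2 ≤ D + 4 * γ k ∧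
      -∑ y, (Φ p).1 y * Real.log (P.pY y) - ∑ y, Real.negMulLog ((Φ p).1 y) ≤ 0 + 4 * γ k := by
    intro k
    obtain ⟨n, hn, C, hM, hL, hP⟩ := H (γ k) (hγ0 k)
    have hn' : (0 : ℝ) < n := by exact_mod_cast hn
    have hPpos := (Real.exp_pos _).trans_le hP
    have hκ : -Real.log (P.correctProb C (D + γ k)) ≤ n * γ k := by
      have := Real.log_le_log (Real.exp_pos _) hP
      rw [Real.log_exp] at this
      linarith
    obtain ⟨v, hv, h1, h2, h3, h4, h5⟩ := P.exists_mixture hn C _ hPpos hκ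
    obtain ⟨w, hw, q, hq, hwq⟩ := exists_mixture_of_mem_convexHull hv
    have := hγ0 k
    refine ⟨(w, q), ⟨hw, fun i _ => hq i⟩, ?_⟩
    have e : Φ (w, q) = v := hwq
    rw [e]
    -- With κ = nγ the losses are 2γ for the identification rate, 2γ + 2γ for the rate of Y given Z,
    -- and γ for each of the others; 4γ covers all.
    refine ⟨?_, ?_, ?_, by linarith, ?_⟩ <;> refine le_of_mul_le_mul_left ?_ hn' <;> nlinarith
  choose p hp h1 h2 h3 h4 h5 using hstep
  obtain ⟨⟨w, q⟩, ⟨hw, hq⟩, s, hs, hlim⟩ := ((isCompact_stdSimplex ℝ (Fin N)).prod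
    (isCompact_univ_pi fun _ => P.isCompact_condLaws)).tendsto_subseq hp
  have hc : Tendsto (fun k => 4 * γ (s k)) atTop (𝓝 0) := by
    simpa using (hγt.comp hs.tendsto_atTop).const_mul 4
  have g1 := tendsto_lim_le (F := fun p => -(Φ p).2.1) (by fun_prop) hlim hc fun k => h1 (s k)
  have g2 := tendsto_lim_le (F := fun p => (Φ p).2.2.1) (by fun_prop) hlim hc fun k => h2 (s k)
  have g3 := tendsto_lim_le (F := fun p => (Φ p).2.2.2.1) (by fun_prop) hlim hc fun k => h3 (s k)
  have g4 := tendsto_lim_le (F := fun p => (Φ p).2.2.2.2) (by fun_prop) hlim hc fun k => h4 (s k)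
  have g5 := tendsto_lim_le (F := fun p => -∑ y, (Φ p).1 y * Real.log (P.pY y) -
    ∑ y, Real.negMulLog ((Φ p).1 y)) (by fun_prop) hlim hc fun k => h5 (s k)
  have hq' : ∀ i, q i ∈ P.condLaws := fun i => hq i (Set.mem_univ i)
  simp only [hΦ, Prod.snd_sum, Prod.fst_sum, Prod.smul_snd, Prod.smul_fst, Model.functionals,
    smul_eq_mul] at g1 g2 g3 g4 g5
  set m := ∑ i, w i • law (q i) (fun t => t.2.1) with hm
  have hmy : ∀ y, m y = ∑ i, w i * law (q i) (fun t => t.2.1) y := fun y => by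
    simp [hm, Finset.sum_apply]
  have hmP : IsPMF m := by
    refine ⟨fun y => ?_, ?_⟩
    · rw [hmy]
      exact Finset.sum_nonneg fun i _ => mul_nonneg (hw.1 i) (law_nonneg (hq' i).1.nonneg _ _)
    · simp only [hmy]
      rw [Finset.sum_comm]
      simp only [← Finset.mul_sum, ((hq' _).1.law _).sum_eq, mul_one]
      exact hw.2
  -- `g5` says that the divergence of the limiting Y-marginal from P_Y is at most 0, and Gibbs'
  -- equality case applies.
  have hmeq : m = P.pY := by
    refine eq_of_sum_mul_log_le hmP P.pY_isPMF.nonneg P.pY_isPMF.sum_eq.le (fun y hy => ?_) ?_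
    · refine (P.pY_isPMF.nonneg y).lt_of_ne' fun h0 => hy.ne' ?_
      rw [hmy]
      exact Finset.sum_eq_zero fun i _ => by rw [P.law_y_of_condLaws (hq' i) y h0, mul_zero]
    · simp only [Real.negMulLog, neg_mul, Finset.sum_neg_distrib] at g5
      linarith
  refine ⟨N, w, q, ⟨hw.1, hw.2⟩, hq', hmeq, by linarith, g2, fun i hi => ?_, g4⟩
  -- The gaps are nonnegative with average at most 0, so each component of positive weight has gap
  -- 0.
  have hnn : ∀ i, 0 ≤ w i * P.markovGap (q i) := fun i =>
    mul_nonneg (hw.1 i) (P.markovGap_spec (hq' i)).1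
  have := (Finset.sum_eq_zero_iff_of_nonneg fun i _ => hnn i).1
    (le_antisymm g3 (Finset.sum_nonneg fun i _ => hnn i)) i (Finset.mem_univ _)
  exact ((mul_eq_zero.1 this).resolve_left hi).le

end Markov

/-! ### From mixtures to test channels. -/

section TestLaw

variable {X Y Z Xh : Type*} [Fintype X] [Fintype Y] [Fintype Z]

/-- Every component uses the same backward channel P_{XZ|Y}, so averaging the Y-marginals to P_Y
restores the model; off its support both sides vanish. -/
theorem Model.sum_drive (P : Model X Y Z Xh) {k : ℕ} {l : Fin k → ℝ} {π : Fin k → Y → ℝ}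
    (h : ∀ y, ∑ u, l u * π u y = P.pY y) (t : X × Y × Z) :
    ∑ u, l u * P.drive (π u) t = P.joint t := by
  simp only [Model.drive, ← mul_assoc, ← Finset.sum_mul, h]
  by_cases hj : P.joint t = 0
  · simp [hj]
  · exact mul_div_cancel₀ _ (P.pY_pos_of_joint hj).ne'

variable [Fintype Xh]

/-- The mixture of the laws driven by the `π u` is the law of a test channel. -/
theorem Model.exists_testLaw (P : Model X Y Z Xh) {k : ℕ} {l : Fin k → ℝ} {π : Fin k → Y → ℝ}
    (hl : IsPMF l) (hl0 : ∀ u, l u ≠ 0) (hπ : ∀ u, IsPMF (π u))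
    (h : ∀ y, ∑ u, l u * π u y = P.pY y) (φ : Fin k → Z → Xh) :
    ∃ Q ∈ P.testLaws k,
      mutualInfo Q (fun ω => ω.2.2.2.1) (fun ω => ω.2.2.1) =
        ent P.joint (fun t => t.2.2) - ∑ u, l u * ent (P.drive (π u)) (fun t => t.2.2) ∧
      condMutualInfo Q (fun ω => ω.2.2.2.1) (fun ω => ω.2.1) (fun ω => ω.2.2.1) =
        ∑ u, l u * ent (P.drive (π u)) (fun t => t.2.2) -
        ∑ u, l u * ent (P.drive (π u)) (fun t => t.2) +
        ent P.joint (fun t => t.2) - ent P.joint (fun t => t.2.2) ∧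
      ∑ ω, Q ω * P.d ω.1 ω.2.2.2.2 =
        ∑ u, l u * ∑ t, P.drive (π u) t * P.d t.1 (φ u t.2.2) := by
  set Q : X × Y × Z × Fin k × Xh → ℝ := fun ω => l ω.2.2.2.1 *
    P.drive (π ω.2.2.2.1) (ω.1, ω.2.1, ω.2.2.1) *
      (if ω.2.2.2.2 = φ ω.2.2.2.1 ω.2.2.1 then 1 else 0) with hQ
  have hπ0 : ∀ u y, P.pY y = 0 → π u y = 0 := fun u y hy => by
    have := (Finset.sum_eq_zero_iff_of_nonneg fun u _ =>
      mul_nonneg (hl.nonneg u) ((hπ u).nonneg y)).1 ((h y).trans hy) u (Finset.mem_univ u)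
    exact (mul_eq_zero.1 this).resolve_left (hl0 u)
  have hsum : ∀ F : X × Y × Z × Fin k × Xh → ℝ, ∑ ω, Q ω * F ω =
      ∑ u, l u * ∑ t, P.drive (π u) t * F (t.1, t.2.1, t.2.2, u, φ u t.2.2) := fun F => by
    simp only [hQ, Fintype.sum_prod_type, mul_ite, mul_one, mul_zero, ite_mul, zero_mul,
      Finset.sum_ite_eq', Finset.mem_univ, if_true, Finset.mul_sum]
    calc _ = ∑ x, ∑ u, ∑ y, ∑ z, l u * P.drive (π u) (x, y, z) * F (x, y, z, u, φ u z) := by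
          refine Finset.sum_congr rfl fun x _ => ?_
          rw [Finset.sum_comm]
          rw [Finset.sum_comm]
          refine (Finset.sum_congr rfl fun y _ => Finset.sum_comm).trans ?_
          rw [Finset.sum_comm]
      _ = _ := by
          rw [Finset.sum_comm]
          simp only [mul_assoc]
  have hQ0 : IsPMF Q := by
    refine ⟨fun ω => mul_nonneg (mul_nonneg (hl.nonneg _) (P.drive_nonneg (hπ _).nonneg _))
      (by split_ifs <;> simp), ?_⟩
    have := hsum (fun _ => 1)
    simpa [(P.drive_isPMF (hπ _) (hπ0 _)).sum_eq, hl.sum_eq] using this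
  have hlawXU : ∀ t u, law Q (fun ω => ((ω.1, ω.2.1, ω.2.2.1), ω.2.2.2.1)) (t, u) =
      l u * P.drive (π u) t := fun t u => by
    rw [law_eq_sum, hsum]
    simp only [Prod.mk.injEq, Prod.mk.eta, ite_and]
    simp
  have hlawU : law Q (fun ω => ω.2.2.2.1) = l := by
    ext u
    rw [law_eq_sum, hsum]
    simp [(P.drive_isPMF (hπ _) (hπ0 _)).sum_eq]
  have hlawX : law Q (fun ω => (ω.1, ω.2.1, ω.2.2.1)) = P.joint := by
    ext t
    rw [law_eq_sum, hsum]
    simp only [Prod.mk.eta, mul_ite, mul_one, mul_zero, Finset.sum_ite_eq', Finset.mem_univ, if_true]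
    exact P.sum_drive h t
  -- The channel from Y to U is the Bayes inverse of the `π u`; at null y any probability vector
  -- serves, and `l` is taken.
  refine ⟨Q, ⟨fun y u => if P.pY y = 0 then l u else l u * π u y / P.pY y, φ, fun y => ?_,
    fun x y z u xh => ?_⟩, ?_, ?_, hsum _⟩
  · by_cases hy : P.pY y = 0
    · simpa [hy] using (show l ∈ stdSimplex ℝ (Fin k) from ⟨hl.nonneg, hl.sum_eq⟩)
    · simp only [hy, if_false]
      exact ⟨fun u => div_nonneg (mul_nonneg (hl.nonneg u) ((hπ u).nonneg y)) (P.pY_isPMF.nonneg y),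
        by rw [← Finset.sum_div, h, div_self hy]⟩
  · simp only [hQ, Model.drive]
    have : P.joint (x, y, z) = P.PX x * P.PYX x y * P.PZX x z := rfl
    rw [← this]
    congr 1
    · split_ifs with hy
      · have : P.joint (x, y, z) = 0 := by
          by_contra hne
          exact (P.pY_pos_of_joint hne).ne' hy
        simp [this]
      · field_simp
  · rw [mutualInfo_eq_ent hQ0, ent_congr (A := fun ω : X × Y × Z × Fin k × Xh =>
      (ω.2.2.2.1, ω.2.2.1)) (B := fun ω => (ω.2.2.1, ω.2.2.2.1))
      (by simp only [Prod.mk.injEq]; tauto),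
      ent_pair_of_law hQ0 hlawU hl0 hlawXU (fun t => t.2.2), ent_comp_of_law hlawX (fun t => t.2.2)]
    ring
  · rw [condMutualInfo_eq_ent hQ0, ent_congr (A := fun ω : X × Y × Z × Fin k × Xh =>
      (ω.2.2.2.1, ω.2.2.1)) (B := fun ω => (ω.2.2.1, ω.2.2.2.1))
      (by simp only [Prod.mk.injEq]; tauto),
      ent_congr (A := fun ω : X × Y × Z × Fin k × Xh => (ω.2.2.2.1, ω.2.1, ω.2.2.1))
      (B := fun ω => ((ω.2.1, ω.2.2.1), ω.2.2.2.1))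
      (by simp only [Prod.mk.injEq]; tauto),
      ent_pair_of_law hQ0 hlawU hl0 hlawXU (fun t => t.2.2), ent_comp_of_law hlawX (fun t => t.2.2),
      ent_pair_of_law hQ0 hlawU hl0 hlawXU (fun t => t.2),
      ent_comp_of_law hlawX (fun t => t.2)]
    ring

/-- The converse: if codes with nearly the rates `(Ri, Rc)` succeed with a probability that is not
exponentially small, then `(Ri, Rc, D)` belongs to the single-letter region. -/
theorem Model.mem_starRegion_of_codes (P : Model X Y Z Xh) {Ri Rc D : ℝ}
    (H : ∀ γ : ℝ, 0 < γ → ∃ n : ℕ, 0 < n ∧ ∃ C : Code Y Z Xh n,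
      n * (Ri - γ) ≤ Real.log C.M ∧ Real.log C.L ≤ n * (Rc + γ) ∧
      Real.exp (-γ * n) ≤ P.correctProb C (D + γ)) :
    (Ri, Rc, D) ∈ P.starRegion := by
  obtain ⟨N, w, q, hw, hq, hY, hZ, hYZ, hgap, hD⟩ := P.exists_limit_mixture H
  set v : Fin N → (Y → ℝ) × ℝ × ℝ := fun i =>
    (law (q i) (fun t => t.2.1), P.rateZ (q i), P.rateY (q i)) with hv
  set l : (Y → ℝ) × ℝ × ℝ →ₗ[ℝ] ℝ := (∑ y, LinearMap.proj y) ∘ₗ LinearMap.fst ℝ (Y → ℝ) (ℝ × ℝ)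
  have hl : ∀ i, l (v i) = 1 := fun i => by
    simp [l, v, ((hq i).1.law _).sum_eq]
  obtain ⟨w', hw'0, hw'w, hv', hc', hcard⟩ := exists_basic_solution v (fun i => P.expDist (q i)) l hl
    _ w hw.nonneg le_rfl
  have hdim : Module.finrank ℝ ((Y → ℝ) × ℝ × ℝ) = Fintype.card Y + 2 := by
    simp [Module.finrank_prod]
  rw [hdim] at hcard
  set s := Finset.univ.filter (fun i => w' i ≠ 0) with hs
  set e := s.equivFin.symm
  have hsum : ∀ F : Fin N → ℝ, ∑ u, w' (e u) * F (e u) = ∑ i, w' i * F i := fun F => by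
    rw [Equiv.sum_comp e (fun i => w' i * F i), Finset.sum_coe_sort s (fun i => w' i * F i)]
    refine Finset.sum_subset (Finset.subset_univ _) fun i _ hi => ?_
    simp only [hs, Finset.mem_filter, Finset.mem_univ, true_and, not_not] at hi
    simp [hi]
  have he : ∀ u, w' (e u) ≠ 0 := fun u => (Finset.mem_filter.1 (e u).2).2
  have hY' : ∀ y, ∑ i, w' i * law (q i) (fun t => t.2.1) y = P.pY y := fun y => by
    have h1 := congrArg (fun v => v.1 y) hv'
    have h2 := congrFun hY y
    simp only [hv, Prod.fst_sum, Prod.smul_fst, Finset.sum_apply, Pi.smul_apply, smul_eq_mul] at h1 h2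
    rw [h1, h2]
  have hZ' : ∑ i, w' i * P.rateZ (q i) = ∑ i, w i * P.rateZ (q i) := by
    simpa [hv, Prod.snd_sum, Prod.fst_sum] using congrArg (fun v => v.2.1) hv'
  have hYZ' : ∑ i, w' i * P.rateY (q i) = ∑ i, w i * P.rateY (q i) := by
    simpa [hv, Prod.snd_sum, Prod.fst_sum] using congrArg (fun v => v.2.2) hv'
  have hw1 : ∑ i, w' i = 1 := by
    have h1 : ∑ y, ∑ i, w' i * law (q i) (fun t => t.2.1) y = 1 := by
      simp only [hY', P.pY_isPMF.sum_eq]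
    rw [Finset.sum_comm] at h1
    simpa only [← Finset.mul_sum, ((hq _).1.law _).sum_eq, mul_one] using h1
  -- The basic solution is supported where the original weights are nonzero, so the gap still
  -- vanishes on each kept component.
  have hgap' : ∀ u, _ := fun u =>
    (P.markovGap_spec (hq (e u))).2 (hgap _ fun h => he u (hw'w _ h))
  choose κ hκ hqκ using hgap'
  set π : Fin s.card → Y → ℝ := fun u => law (q (e u)) (fun t => t.2.1) with hπ
  have hlaw : ∀ u, law (q (e u)) (fun t => (t.1, t.2.1, t.2.2.1)) = P.drive (π u) := fun u => by
    ext t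
    simp only [law, Fintype.sum_prod_type, hqκ u]
    obtain ⟨x, y, z⟩ := t
    simp only [Prod.mk.injEq, ite_and]
    simp only [Finset.sum_const_zero, Finset.sum_ite_irrel, Finset.sum_ite_eq', Finset.mem_univ,
      if_true, ← Finset.mul_sum, (hκ u z).sum_eq, mul_one, hπ]
  have hne : Nonempty Xh ∧ Nonempty (Fin s.card) := by
    have hk : Nonempty (Fin s.card) := by
      by_contra h
      rw [not_nonempty_iff] at h
      have := hsum (fun _ => 1)
      simp [hw1] at this
    refine ⟨?_, hk⟩
    by_contra h
    rw [not_nonempty_iff] at h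
    have := (hq (e hk.some)).1.sum_eq
    simp at this
  have := hne.1
  -- The factorization makes the expected distortion given (u, z) linear in the law of Xh, so a
  -- minimizing letter is at least as good as the kernel κ.
  choose φ hφ using fun (u : Fin s.card) (z : Z) => Finite.exists_min
    (fun xh => ∑ x, ∑ y, P.drive (π u) (x, y, z) * P.d x xh)
  obtain ⟨Q, hQ, h1, h2, h3⟩ := P.exists_testLaw (l := fun u => w' (e u)) (π := π)
    ⟨fun u => hw'0 _, by have := hsum (fun _ => 1); simpa [hw1] using this⟩ he
    (fun u => (hq _).1.law _)
    (fun y => (hsum (fun i => law (q i) (fun t => t.2.1) y)).trans (hY' y)) φ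
  -- The mixture has exact (X, Y, Z)-law P_{XYZ}, so the cross terms E[-log P_Z] and E[-log P_{YZ}]
  -- become the entropies of the model.
  have hmix : ∀ F : X × Y × Z → ℝ, ∑ u, w' (e u) * ∑ t, q (e u) t * F (t.1, t.2.1, t.2.2.1) =
      ∑ t, P.joint t * F t := fun F => by
    have h4 : ∀ u, ∑ t, q (e u) t * F (t.1, t.2.1, t.2.2.1) = ∑ t, P.drive (π u) t * F t := fun u => by
      rw [← hlaw u, sum_law (q (e u)) (fun t => (t.1, t.2.1, t.2.2.1)) F]
    simp only [h4, Finset.mul_sum, ← mul_assoc]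
    rw [Finset.sum_comm]
    simp only [← Finset.sum_mul]
    refine Finset.sum_congr rfl fun t _ => ?_
    rw [P.sum_drive (fun y => (hsum (fun i => law (q i) (fun t => t.2.1) y)).trans (hY' y))]
  have eZ : ∑ i, w' i * P.rateZ (q i) = ent P.joint (fun t => t.2.2) -
      ∑ u, w' (e u) * ent (P.drive (π u)) (fun t => t.2.2) := by
    rw [← hsum]
    simp only [Model.rateZ, mul_sub, mul_neg, Finset.sum_sub_distrib, Finset.sum_neg_distrib]
    rw [hmix (fun t => Real.log (P.pZ t.2.2))]
    simp only [← ent_comp_of_law (hlaw _)]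
    rfl
  have eY : ∑ i, w' i * P.rateY (q i) = ∑ u, w' (e u) * ent (P.drive (π u)) (fun t => t.2.2) -
        ∑ u, w' (e u) * ent (P.drive (π u)) (fun t => t.2) +
        ent P.joint (fun t => t.2) - ent P.joint (fun t => t.2.2) := by
    rw [← hsum]
    simp only [Model.rateY, mul_sub, mul_add, mul_neg, Finset.sum_sub_distrib,
      Finset.sum_add_distrib, Finset.sum_neg_distrib]
    rw [hmix (fun t => Real.log (P.pZ t.2.2)), hmix (fun t => Real.log (P.pYZ t.2))]
    simp only [← ent_comp_of_law (hlaw _)]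
    have e1 : ent P.joint (fun t => t.2) = -∑ t, P.joint t * Real.log (P.pYZ t.2) := rfl
    have e2 : ent P.joint (fun t => t.2.2) = -∑ t, P.joint t * Real.log (P.pZ t.2.2) := rfl
    rw [e1, e2]
    ring
  refine ⟨s.card, hcard, Q, hQ, ?_, ?_, ?_⟩
  · rw [h1, ← eZ, hZ']
    exact hZ
  · rw [h2, ← eY, hYZ']
    exact hYZ
  · rw [h3]
    refine le_trans ?_ (hc'.trans hD)
    rw [← hsum]
    refine Finset.sum_le_sum fun u _ => mul_le_mul_of_nonneg_left ?_ (hw'0 _)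
    have e3 : P.expDist (q (e u)) =
        ∑ z, ∑ xh, κ u z xh * ∑ x, ∑ y, P.drive (π u) (x, y, z) * P.d x xh := by
      simp only [Model.expDist, hqκ u, Fintype.sum_prod_type, Finset.mul_sum]
      refine (Finset.sum_congr rfl fun x _ => Finset.sum_comm).trans ?_
      rw [Finset.sum_comm]
      refine Finset.sum_congr rfl fun z _ => ?_
      refine (Finset.sum_congr rfl fun x _ => Finset.sum_comm).trans ?_
      rw [Finset.sum_comm]
      exact Finset.sum_congr rfl fun xh _ => Finset.sum_congr rfl fun x _ =>
        Finset.sum_congr rfl fun y _ => by ring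
    have e4 : ∑ t, P.drive (π u) t * P.d t.1 (φ u t.2.2) =
        ∑ z, ∑ x, ∑ y, P.drive (π u) (x, y, z) * P.d x (φ u z) := by
      simp only [Fintype.sum_prod_type]
      refine (Finset.sum_congr rfl fun x _ => Finset.sum_comm).trans ?_
      rw [Finset.sum_comm]
    rw [e3, e4]
    refine Finset.sum_le_sum fun z _ => ?_
    calc _ = ∑ xh, κ u z xh * ∑ x, ∑ y, P.drive (π u) (x, y, z) * P.d x (φ u z) := by
          rw [← Finset.sum_mul, (hκ u z).sum_eq, one_mul]
      _ ≤ _ := Finset.sum_le_sum fun xh _ =>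
          mul_le_mul_of_nonneg_left (hφ u z xh) ((hκ u z).nonneg xh)

end TestLaw

/-! ### The binning code and its error events. -/

section RandomCoding

/-- The indicator of a proposition. -/
def ind (p : Prop) : ℝ := if p then 1 else 0

theorem ind_nonneg (p : Prop) : 0 ≤ ind p := by unfold ind; split_ifs <;> simp

theorem ind_le_one (p : Prop) : ind p ≤ 1 := by unfold ind; split_ifs <;> simp

theorem ind_of_true {p : Prop} (h : p) : ind p = 1 := if_pos h

theorem ind_of_false {p : Prop} (h : ¬p) : ind p = 0 := if_neg h

theorem exists_le_of_average_le {α : Type*} [Fintype α] {p : α → ℝ} (hp : IsPMF p) {F : α → ℝ}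
    {b : ℝ} (h : ∑ a, p a * F a ≤ b) : ∃ a, F a ≤ b := by
  by_contra! hc
  obtain ⟨a, -, ha⟩ : ∃ a ∈ Finset.univ, p a ≠ 0 := by
    refine Finset.exists_ne_zero_of_sum_ne_zero ?_
    rw [hp.sum_eq]
    exact one_ne_zero
  have : ∑ a, p a * b < ∑ a, p a * F a :=
    Finset.sum_lt_sum (fun a _ => mul_le_mul_of_nonneg_left (hc a).le (hp.nonneg a))
      ⟨a, Finset.mem_univ a, mul_lt_mul_of_pos_left (hc a) ((hp.nonneg a).lt_of_ne' ha)⟩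
  rw [← Finset.sum_mul, hp.sum_eq, one_mul] at this
  linarith

/-- Distinct coordinates of an i.i.d. vector are independent. -/
theorem sum_prodWeight_eval_eval {ι α : Type*} [Fintype ι] [DecidableEq ι] [Fintype α] {p : α → ℝ}
    (hp : ∑ a, p a = 1) {j j' : ι} (hj : j ≠ j') (F H : α → ℝ) :
    ∑ c : ι → α, prodWeight p c * (F (c j) * H (c j')) = (∑ a, p a * F a) * ∑ a, p a * H a := by
  rw [sum_prodWeight_update hp j]
  simp only [Function.update_self, Function.update_of_ne hj.symm, mul_left_comm _ (F _),
    ← Finset.mul_sum, sum_prodWeight_eval hp j' H]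
  rw [Finset.sum_mul]
  exact Finset.sum_congr rfl fun a _ => by ring

variable {X Y Z Xh 𝓤 : Type*} {n M L K : ℕ}

/-- The codeword chosen by the encoder. -/
def chosen (G : 𝓤 → (Fin n → Y) → Prop) (c : Fin L × Fin K → 𝓤) (y : Fin n → Y) :
    Option (Fin L × Fin K) :=
  if h : ∃ j, G (c j) y then some h.choose else none

theorem chosen_spec {G : 𝓤 → (Fin n → Y) → Prop} {c : Fin L × Fin K → 𝓤} {y : Fin n → Y}
    {j : Fin L × Fin K} (h : chosen G c y = some j) : G (c j) y := by
  unfold chosen at h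
  split_ifs at h with h'
  rw [← Option.some.inj h]
  exact h'.choose_spec

theorem exists_chosen {G : 𝓤 → (Fin n → Y) → Prop} {c : Fin L × Fin K → 𝓤} {y : Fin n → Y}
    (h : ∃ j, G (c j) y) : ∃ j, chosen G c y = some j := ⟨h.choose, by simp only [chosen, dif_pos h]⟩

/-- The encoder: the bin of the chosen codeword. -/
def encode (G : 𝓤 → (Fin n → Y) → Prop) (c : Fin L × Fin K → 𝓤) (y : Fin n → Y) : Fin (L + 1) :=
  (finSuccEquiv L).symm ((chosen G c y).map Prod.fst)

/-- The symbol 0 of `Fin (L + 1)`, sent to `none` by `finSuccEquiv`, is reserved for encoding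
failure; a stored bin therefore always contains a codeword typical with the item. -/
theorem encode_eq_iff {G : 𝓤 → (Fin n → Y) → Prop} {c : Fin L × Fin K → 𝓤} {y : Fin n → Y}
    {s : Fin L} : finSuccEquiv L (encode G c y) = some s ↔ ∃ k, chosen G c y = some (s, k) := by
  simp only [encode, Equiv.apply_symm_apply, Option.map_eq_some_iff]
  exact ⟨fun ⟨a, ha, h⟩ => ⟨a.2, by rw [ha, ← h]⟩, fun ⟨k, h⟩ => ⟨_, h, rfl⟩⟩

/-- The identifier: an item whose bin contains a codeword typical with `z`. -/
def identify (T : 𝓤 → (Fin n → Z) → Prop) (hM : 0 < M) (c : Fin L × Fin K → 𝓤)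
    (s : Fin M → Fin (L + 1)) (z : Fin n → Z) : Fin M :=
  if h : ∃ m, ∃ j : Fin L × Fin K, finSuccEquiv L (s m) = some j.1 ∧ T (c j) z
    then h.choose else ⟨0, hM⟩

/-- The reproduction from a codeword of the bin `s` that is typical with `z`. -/
def reproduce [Nonempty Xh] (T : 𝓤 → (Fin n → Z) → Prop) (φ : 𝓤 → (Fin n → Z) → Fin n → Xh)
    (c : Fin L × Fin K → 𝓤) (s : Fin (L + 1)) (z : Fin n → Z) : Fin n → Xh :=
  if h : ∃ j : Fin L × Fin K, finSuccEquiv L s = some j.1 ∧ T (c j) z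
    then φ (c h.choose) z else fun _ => Classical.arbitrary Xh

/-- The code obtained from the codebook `c`, which is partitioned into `L` bins of size `K`. -/
def binningCode [Nonempty Xh] (G : 𝓤 → (Fin n → Y) → Prop) (T : 𝓤 → (Fin n → Z) → Prop)
    (φ : 𝓤 → (Fin n → Z) → Fin n → Xh) (hM : 0 < M) (c : Fin L × Fin K → 𝓤) : Code Y Z Xh n where
  M := M
  L := L + 1
  M_pos := hM
  L_pos := Nat.succ_pos L
  f := encode G c
  g := identify T hM c
  h := reproduce T φ c

/-- The union bound for the error event of the binning code. -/
theorem Model.binningCode_error_le [Fintype X] [Fintype Y] [Fintype Z] [Nonempty Xh]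
    (P : Model X Y Z Xh)
    (G : 𝓤 → (Fin n → Y) → Prop) (T : 𝓤 → (Fin n → Z) → Prop)
    (φ : 𝓤 → (Fin n → Z) → Fin n → Xh) (hM : 0 < M) (c : Fin L × Fin K → 𝓤) (D : ℝ)
    (w : Fin M) (x : Fin n → X) (y : Fin n → Y) (z : Fin n → Z) (y' : Fin M → Fin n → Y)
    {m : Fin M} (hm : m = identify T hM c (fun i => encode G c (Function.update y' w y i)) z) :
    ind (m ≠ w ∨
        D < P.blockDist x (reproduce T φ c (encode G c (Function.update y' w y m)) z)) ≤
      ind (∀ j, ¬G (c j) y) +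
      ind (∃ j, chosen G c y = some j ∧ ¬(T (c j) z ∧ P.blockDist x (φ (c j) z) ≤ D)) +
      (∑ j : Fin L × Fin K, ∑ k ∈ Finset.univ.erase j.2, ind (G (c j) y) * ind (T (c (j.1, k)) z)) +
      ∑ m ∈ Finset.univ.erase w, (∑ j, ∑ j' ∈ Finset.univ.erase j, ∑ k : Fin K,
        ind (G (c j) y) * ind (T (c j') z) * ind (G (c (j'.1, k)) (y' m)) +
        ∑ j : Fin L × Fin K, ∑ k : Fin K, ind (G (c j) y) * ind (G (c (j.1, k)) (y' m))) := by
  -- The summands are: no typical codeword; the chosen one fails; a second codeword of its bin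
  -- matches z; another item's codeword shares a bin with a codeword matching z. The last two range
  -- over all typical j, because the choice depends on the whole codebook whereas codewords at fixed
  -- distinct indices are independent.
  have n1 := ind_nonneg (∀ j, ¬G (c j) y)
  have n2 := ind_nonneg (∃ j, chosen G c y = some j ∧
    ¬(T (c j) z ∧ P.blockDist x (φ (c j) z) ≤ D))
  have hGT : ∀ p q : Prop, 0 ≤ ind p * ind q := fun p q => mul_nonneg (ind_nonneg p) (ind_nonneg q)
  have hGTG : ∀ p q r : Prop, 0 ≤ ind p * ind q * ind r := fun p q r =>
    mul_nonneg (hGT p q) (ind_nonneg r)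
  have n3 : 0 ≤ ∑ j : Fin L × Fin K, ∑ k ∈ Finset.univ.erase j.2,
      ind (G (c j) y) * ind (T (c (j.1, k)) z) :=
    Finset.sum_nonneg fun _ _ => Finset.sum_nonneg fun _ _ => hGT _ _
  have n41 : ∀ m, 0 ≤ ∑ j, ∑ j' ∈ Finset.univ.erase j, ∑ k : Fin K,
        ind (G (c j) y) * ind (T (c j') z) * ind (G (c (j'.1, k)) (y' m)) := fun m =>
    Finset.sum_nonneg fun _ _ => Finset.sum_nonneg fun _ _ => Finset.sum_nonneg fun _ _ =>
      hGTG _ _ _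
  have n42 : ∀ m, 0 ≤ ∑ j : Fin L × Fin K, ∑ k : Fin K,
      ind (G (c j) y) * ind (G (c (j.1, k)) (y' m)) := fun m =>
    Finset.sum_nonneg fun _ _ => Finset.sum_nonneg fun _ _ => hGT _ _
  have n4 := Finset.sum_nonneg fun m (_ : m ∈ Finset.univ.erase w) => add_nonneg (n41 m) (n42 m)
  by_cases herr : m ≠ w ∨
      D < P.blockDist x (reproduce T φ c (encode G c (Function.update y' w y m)) z)
  swap
  · rw [ind_of_false herr]
    linarith
  rw [ind_of_true herr]
  by_cases h1 : ∀ j, ¬G (c j) y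
  · rw [ind_of_true h1]
    linarith
  push Not at h1
  obtain ⟨j, hj⟩ := exists_chosen h1
  have hGj := chosen_spec hj
  by_cases h2 : T (c j) z ∧ P.blockDist x (φ (c j) z) ≤ D
  swap
  · rw [ind_of_true (p := ∃ j, _) ⟨j, hj, h2⟩]
    linarith
  have hSw : finSuccEquiv L (encode G c y) = some j.1 := encode_eq_iff.2 ⟨j.2, hj⟩
  have hex : ∃ m, ∃ j : Fin L × Fin K,
      finSuccEquiv L (encode G c (Function.update y' w y m)) = some j.1 ∧ T (c j) z :=
    ⟨w, j, by rw [Function.update_self]; exact hSw, h2.1⟩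
  have hest : m = hex.choose := by
    rw [hm, identify, dif_pos hex]
  obtain ⟨j', hj', hT'⟩ := hex.choose_spec
  rw [← hest] at hj'
  by_cases hmw : m = w
  · have hex' : ∃ j : Fin L × Fin K, finSuccEquiv L (encode G c y) = some j.1 ∧ T (c j) z :=
      ⟨j, hSw, h2.1⟩
    have hrep : reproduce T φ c (encode G c (Function.update y' w y m)) z =
        φ (c hex'.choose) z := by
      rw [hmw, Function.update_self, reproduce, dif_pos hex']
    obtain ⟨hs, ht⟩ := hex'.choose_spec
    set i := hex'.choose with hi
    rw [hSw, Option.some.injEq] at hs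
    by_cases hk : i.2 = j.2
    · have : i = j := Prod.ext hs.symm hk
      rw [hrep, this] at herr
      exact absurd h2.2 (not_le.2 (herr.resolve_left (not_not.2 hmw)))
    · have : (1 : ℝ) ≤ ∑ j : Fin L × Fin K, ∑ k ∈ Finset.univ.erase j.2,
          ind (G (c j) y) * ind (T (c (j.1, k)) z) := by
        refine le_trans ?_ (Finset.single_le_sum (fun j _ => Finset.sum_nonneg fun _ _ => hGT _ _)
          (Finset.mem_univ j))
        refine le_trans ?_ (Finset.single_le_sum (fun _ _ => hGT _ _)
          (Finset.mem_erase.2 ⟨hk, Finset.mem_univ _⟩))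
        rw [ind_of_true hGj, ind_of_true (by rw [hs]; exact ht), one_mul]
      linarith
  · rw [Function.update_of_ne hmw] at hj'
    obtain ⟨k, hk⟩ := encode_eq_iff.1 hj'
    have hGm := chosen_spec hk
    have hle := Finset.single_le_sum (fun m (_ : m ∈ Finset.univ.erase w) =>
      add_nonneg (n41 m) (n42 m)) (Finset.mem_erase.2 ⟨hmw, Finset.mem_univ m⟩)
    have m1 := n41 m
    have m2 := n42 m
    -- If the matching codeword is the right one, its match with z is not independent of its match
    -- with y, so that factor is dropped.
    by_cases hjj : j' = j
    · have : (1 : ℝ) ≤ ∑ j : Fin L × Fin K, ∑ k : Fin K,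
          ind (G (c j) y) * ind (G (c (j.1, k)) (y' m)) := by
        refine le_trans ?_ (Finset.single_le_sum (fun j _ => Finset.sum_nonneg fun _ _ => hGT _ _)
          (Finset.mem_univ j))
        refine le_trans ?_ (Finset.single_le_sum (fun _ _ => hGT _ _) (Finset.mem_univ k))
        rw [ind_of_true hGj, ind_of_true (by rw [← hjj]; exact hGm), one_mul]
      linarith
    · have : (1 : ℝ) ≤ ∑ j, ∑ j' ∈ Finset.univ.erase j, ∑ k : Fin K,
          ind (G (c j) y) * ind (T (c j') z) * ind (G (c (j'.1, k)) (y' m)) := by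
        refine le_trans ?_ (Finset.single_le_sum (fun j _ => Finset.sum_nonneg fun _ _ =>
          Finset.sum_nonneg fun _ _ => hGTG _ _ _) (Finset.mem_univ j))
        refine le_trans ?_ (Finset.single_le_sum (fun _ _ => Finset.sum_nonneg fun _ _ =>
          hGTG _ _ _) (Finset.mem_erase.2 ⟨hjj, Finset.mem_univ j'⟩))
        refine le_trans ?_ (Finset.single_le_sum (fun _ _ => hGTG _ _ _) (Finset.mem_univ k))
        rw [ind_of_true hGj, ind_of_true hT', ind_of_true hGm, one_mul, one_mul]
      linarith

end RandomCoding

/-! ### Weighted averages. -/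

section Average

variable {α β ι : Type*} [Fintype α] [Fintype β]

/-- The average of `F` with weights `p`. -/
def avg (p : α → ℝ) (F : α → ℝ) : ℝ := ∑ a, p a * F a

theorem avg_sum (p : α → ℝ) (s : Finset ι) (F : ι → α → ℝ) :
    avg p (fun a => ∑ i ∈ s, F i a) = ∑ i ∈ s, avg p (F i) := by
  simp only [avg, Finset.mul_sum]
  exact Finset.sum_comm

theorem avg_add (p : α → ℝ) (F G : α → ℝ) : avg p (fun a => F a + G a) = avg p F + avg p G := by
  simp only [avg, mul_add, Finset.sum_add_distrib]

theorem avg_const_mul (p : α → ℝ) (c : ℝ) (F : α → ℝ) : avg p (fun a => c * F a) = c * avg p F := by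
  simp only [avg, Finset.mul_sum]
  exact Finset.sum_congr rfl fun a _ => by ring

theorem avg_const {p : α → ℝ} (hp : IsPMF p) (c : ℝ) : avg p (fun _ => c) = c := by
  rw [avg, ← Finset.sum_mul, hp.sum_eq, one_mul]

theorem avg_mono {p : α → ℝ} (hp : ∀ a, 0 ≤ p a) {F G : α → ℝ} (h : ∀ a, F a ≤ G a) :
    avg p F ≤ avg p G :=
  Finset.sum_le_sum fun a _ => mul_le_mul_of_nonneg_left (h a) (hp a)

theorem avg_le {p : α → ℝ} (hp : IsPMF p) {F : α → ℝ} {b : ℝ} (h : ∀ a, F a ≤ b) : avg p F ≤ b :=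
  (avg_mono hp.nonneg h).trans (avg_const hp b).le

theorem avg_nonneg {p : α → ℝ} (hp : ∀ a, 0 ≤ p a) {F : α → ℝ} (h : ∀ a, 0 ≤ F a) : 0 ≤ avg p F :=
  Finset.sum_nonneg fun a _ => mul_nonneg (hp a) (h a)

theorem avg_comm (p : α → ℝ) (q : β → ℝ) (F : α → β → ℝ) :
    avg p (fun a => avg q (F a)) = avg q (fun b => avg p (fun a => F a b)) := by
  simp only [avg, Finset.mul_sum]
  rw [Finset.sum_comm]
  exact Finset.sum_congr rfl fun a _ => Finset.sum_congr rfl fun b _ => by ring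

theorem avg_law (p : α → ℝ) (A : α → β) (F : β → ℝ) :
    avg p (fun a => F (A a)) = avg (law p A) F := (sum_law p A F).symm

end Average

/-! ### Averaging the error over the codebook. -/

section RandomCodingAverage

variable {X Y Z Xh 𝓤 : Type*} [Fintype X] [Fintype Y] [Fintype Z] [Nonempty Xh]
  {n M L K : ℕ}

/-- The error probability of the binning code with a given codebook. -/
theorem Model.binningCode_errorProb_le (P : Model X Y Z Xh)
    (G : 𝓤 → (Fin n → Y) → Prop) (T : 𝓤 → (Fin n → Z) → Prop)
    (φ : 𝓤 → (Fin n → Z) → Fin n → Xh) (hM : 0 < M) (c : Fin L × Fin K → 𝓤) (D : ℝ) {g θ : ℝ}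
    (hg : ∀ u, avg (prodWeight P.pY) (fun y => ind (G u y)) ≤ g) (hθ0 : 0 ≤ θ)
    (hθ : ∀ u y, G u y → avg (prodWeight P.joint) (fun ω => ind (ys ω = y ∧
      ¬(T u (zs ω) ∧ P.blockDist (xs ω) (φ u (zs ω)) ≤ D))) ≤ θ * prodWeight P.pY y) :
    P.errorProb (binningCode G T φ hM c) D ≤ avg (prodWeight P.joint) (fun ω =>
      ind (∀ j, ¬G (c j) (ys ω)) + (∑ j : Fin L × Fin K, ∑ k ∈ Finset.univ.erase j.2,
        ind (G (c j) (ys ω)) * ind (T (c (j.1, k)) (zs ω))) +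
      (M - 1) * (K * g) * (∑ j, ∑ j' ∈ Finset.univ.erase j,
        ind (G (c j) (ys ω)) * ind (T (c j') (zs ω)) + ∑ j, ind (G (c j) (ys ω)))) + θ := by
  set W := prodWeight (ι := Fin n) P.joint with hW
  have hW0 : IsPMF W := P.joint_isPMF.prodWeight
  set A1 : (Fin n → X × Y × Z) → ℝ := fun ω => ind (∀ j, ¬G (c j) (ys ω))
  set A2 : (Fin n → X × Y × Z) → ℝ := fun ω => ind (∃ j, chosen G c (ys ω) = some j ∧
    ¬(T (c j) (zs ω) ∧ P.blockDist (xs ω) (φ (c j) (zs ω)) ≤ D))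
  set A3 : (Fin n → X × Y × Z) → ℝ := fun ω => ∑ j : Fin L × Fin K, ∑ k ∈ Finset.univ.erase j.2,
        ind (G (c j) (ys ω)) * ind (T (c (j.1, k)) (zs ω))
  set N : (Fin n → X × Y × Z) → ℝ := fun ω => ∑ j, ∑ j' ∈ Finset.univ.erase j,
        ind (G (c j) (ys ω)) * ind (T (c j') (zs ω)) + ∑ j, ind (G (c j) (ys ω))
  -- The other M - 1 items are independent of everything else: each matches a given bin of K
  -- codewords with probability at most K g.
  have hpt : ∀ (w : Fin M) ω, avg (prodWeight (prodWeight P.pY)) (fun y' =>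
      A1 ω + A2 ω + A3 ω + ∑ m ∈ Finset.univ.erase w,
        (∑ j, ∑ j' ∈ Finset.univ.erase j, ∑ k : Fin K,
          ind (G (c j) (ys ω)) * ind (T (c j') (zs ω)) * ind (G (c (j'.1, k)) (y' m)) +
        ∑ j : Fin L × Fin K, ∑ k : Fin K, ind (G (c j) (ys ω)) * ind (G (c (j.1, k)) (y' m)))) ≤
      A1 ω + A2 ω + A3 ω + (M - 1) * (K * g) * N ω := fun w ω => by
    have hev : ∀ (u : 𝓤) (m : Fin M), avg (prodWeight (prodWeight P.pY))
        (fun y' : Fin M → Fin n → Y => ind (G u (y' m))) ≤ g := fun u m => by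
      rw [avg, sum_prodWeight_eval P.pY_isPMF.prodWeight.sum_eq m (fun y => ind (G u y))]
      exact hg u
    simp only [avg_add, avg_const P.pY_isPMF.prodWeight.prodWeight, avg_sum, avg_const_mul]
    gcongr
    calc _ ≤ ∑ m ∈ Finset.univ.erase w, (∑ j, ∑ j' ∈ Finset.univ.erase j, ∑ _k : Fin K,
          ind (G (c j) (ys ω)) * ind (T (c j') (zs ω)) * g +
          ∑ j : Fin L × Fin K, ∑ _k : Fin K, ind (G (c j) (ys ω)) * g) := by
          refine Finset.sum_le_sum fun m _ => add_le_add
            (Finset.sum_le_sum fun j _ => Finset.sum_le_sum fun j' _ => Finset.sum_le_sum fun k _ =>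
              mul_le_mul_of_nonneg_left (hev _ m) (mul_nonneg (ind_nonneg _) (ind_nonneg _)))
            (Finset.sum_le_sum fun j _ => Finset.sum_le_sum fun k _ =>
              mul_le_mul_of_nonneg_left (hev _ m) (ind_nonneg _))
      _ = _ := by
          have e : ∀ b : ℝ, ∑ _k : Fin K, b * g = K * g * b := fun b => by
            rw [Finset.sum_const, Finset.card_univ, Fintype.card_fin, nsmul_eq_mul]
            ring
          simp only [e, ← Finset.mul_sum (Finset.univ), ← Finset.mul_sum (Finset.univ.erase _),
            ← mul_add, Finset.sum_const, Finset.card_univ, Fintype.card_fin, nsmul_eq_mul,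
            Finset.card_erase_of_mem (Finset.mem_univ w), Nat.cast_sub (Nat.succ_le_of_lt hM), N]
          push_cast
          ring
  -- For fixed y the chosen codeword is fixed and typical with y, so `hθ` bounds its failure for
  -- every codebook, without averaging.
  have hA2 : avg W A2 ≤ θ := by
    have h1 : ∀ ω, A2 ω = ∑ y, ind (ys ω = y ∧ ∃ j, chosen G c y = some j ∧
        ¬(T (c j) (zs ω) ∧ P.blockDist (xs ω) (φ (c j) (zs ω)) ≤ D)) := fun ω => by
      rw [Finset.sum_eq_single (ys ω)]
      · simp [A2]
      · intro y _ hy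
        exact ind_of_false fun h => hy h.1.symm
      · simp
    rw [show A2 = fun ω => _ from funext h1, avg_sum]
    calc _ ≤ ∑ y, θ * prodWeight P.pY y := by
          refine Finset.sum_le_sum fun y _ => ?_
          rcases hch : chosen G c y with _ | j
          · simp only [reduceCtorEq, false_and, exists_false, and_false, ind, if_false, avg, mul_zero,
              Finset.sum_const_zero]
            exact mul_nonneg hθ0 (P.pY_isPMF.prodWeight.nonneg y)
          · simp only [Option.some.injEq, exists_eq_left']
            exact hθ (c j) y (chosen_spec hch)
      _ = θ := by rw [← Finset.mul_sum, P.pY_isPMF.prodWeight.sum_eq, mul_one]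
  have hMpos : (0 : ℝ) < M := by exact_mod_cast hM
  calc _ = (1 / (M : ℝ)) * ∑ w : Fin M, avg W (fun ω => avg (prodWeight (prodWeight P.pY)) (fun y' =>
        ind (identify T hM c (fun i => encode G c (Function.update y' w (ys ω) i)) (zs ω) ≠ w ∨
        D < P.blockDist (xs ω) (reproduce T φ c (encode G c (Function.update y' w (ys ω)
          (identify T hM c (fun i => encode G c (Function.update y' w (ys ω) i)) (zs ω))))
            (zs ω))))) := by
        rw [P.errorProb_eq]
        refine congrArg (fun t : ℝ => (1 / (M : ℝ)) * t) (Finset.sum_congr rfl fun w _ =>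
          Finset.sum_congr rfl fun ω _ => congrArg (fun t => W ω * t) (Finset.sum_congr rfl fun y' _ =>
            ?_))
        congr 1
        unfold ind
        congr 1
    _ ≤ (1 / (M : ℝ)) * ∑ w : Fin M, avg W (fun ω => A1 ω + A2 ω + A3 ω + (M - 1) * (K * g) * N ω) := by
        gcongr with w
        refine avg_mono hW0.nonneg fun ω => le_trans ?_ (hpt w ω)
        refine avg_mono P.pY_isPMF.prodWeight.prodWeight.nonneg fun y' => ?_
        exact P.binningCode_error_le G T φ hM c D w (xs ω) (ys ω) (zs ω) y' rfl
    _ = avg W (fun ω => A1 ω + A3 ω + (M - 1) * (K * g) * N ω) + avg W A2 := by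
        rw [Finset.sum_const, Finset.card_univ, Fintype.card_fin, nsmul_eq_mul, ← mul_assoc,
          one_div_mul_cancel hMpos.ne', one_mul, ← avg_add]
        congr 1
        ext ω
        ring
    _ ≤ _ := add_le_add le_rfl hA2

variable [Fintype 𝓤]

/-- The probability that no codeword is typical with `y`. -/
theorem avg_ind_forall_not {μ : 𝓤 → ℝ} (hμ : IsPMF μ) (G : 𝓤 → Prop) :
    avg (prodWeight μ) (fun c : Fin L × Fin K → 𝓤 => ind (∀ j, ¬G (c j))) =
      (1 - avg μ (fun u => ind (G u))) ^ (L * K) := by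
  have h1 : ∀ c : Fin L × Fin K → 𝓤, prodWeight μ c * ind (∀ j, ¬G (c j)) =
      ∏ j, μ (c j) * ind (¬G (c j)) := fun c => by
    rw [Finset.prod_mul_distrib, prodWeight]
    congr 1
    by_cases h : ∀ j, ¬G (c j)
    · rw [ind_of_true h, Finset.prod_eq_one fun j _ => ind_of_true (h j)]
    · rw [ind_of_false h]
      push Not at h
      obtain ⟨j, hj⟩ := h
      exact (Finset.prod_eq_zero (Finset.mem_univ j) (ind_of_false (not_not.2 hj))).symm
  have h2 : ∑ u, μ u * ind (¬G u) = 1 - avg μ (fun u => ind (G u)) := by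
    rw [avg, ← hμ.sum_eq, ← Finset.sum_sub_distrib]
    refine Finset.sum_congr rfl fun u _ => ?_
    by_cases h : G u <;> simp [ind, h]
  rw [avg, Finset.sum_congr rfl fun c _ => h1 c,
    sum_prod_eq_prod_sum (fun _ u => μ u * ind (¬G u)), h2]
  simp

theorem avg_ind_mul_ind_le {μ : 𝓤 → ℝ} (hμ : IsPMF μ) {G T : 𝓤 → Prop} {g τ : ℝ}
    (hg : avg μ (fun u => ind (G u)) ≤ g) (hτ : avg μ (fun u => ind (T u)) ≤ τ)
    {j j' : Fin L × Fin K} (hj : j ≠ j') :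
    avg (prodWeight μ) (fun c => ind (G (c j)) * ind (T (c j'))) ≤ g * τ := by
  rw [avg, sum_prodWeight_eval_eval hμ.sum_eq hj (fun u => ind (G u)) (fun u => ind (T u))]
  exact mul_le_mul hg hτ (avg_nonneg hμ.nonneg fun _ => ind_nonneg _)
    ((avg_nonneg hμ.nonneg fun _ => ind_nonneg _).trans hg)

/-- Random coding: some codebook performs as well as the average. -/
theorem Model.exists_code_errorProb_le (P : Model X Y Z Xh) {μ : 𝓤 → ℝ} (hμ : IsPMF μ)
    (G : 𝓤 → (Fin n → Y) → Prop) (T : 𝓤 → (Fin n → Z) → Prop)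
    (φ : 𝓤 → (Fin n → Z) → Fin n → Xh) (hM : 0 < M) (hK : 0 < K) (D : ℝ) {g τ θ : ℝ}
    (hg0 : 0 ≤ g) (hg1 : ∀ y, avg μ (fun u => ind (G u y)) ≤ g)
    (hg : ∀ u, avg (prodWeight P.pY) (fun y => ind (G u y)) ≤ g)
    (hτ : ∀ z, avg μ (fun u => ind (T u z)) ≤ τ) (hθ0 : 0 ≤ θ)
    (hθ : ∀ u y, G u y → avg (prodWeight P.joint) (fun ω => ind (ys ω = y ∧
      ¬(T u (zs ω) ∧ P.blockDist (xs ω) (φ u (zs ω)) ≤ D))) ≤ θ * prodWeight P.pY y) :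
    ∃ C : Code Y Z Xh n, C.M = M ∧ C.L = L + 1 ∧ P.errorProb C D ≤
      avg (prodWeight P.pY) (fun y => (1 - avg μ (fun u => ind (G u y))) ^ (L * K)) +
      L * K * (K - 1) * (g * τ) +
      (M - 1) * (K * g) * ((L * K) ^ 2 * (g * τ) + L * K * g) + θ := by
  set W := prodWeight (ι := Fin n) P.joint with hW
  have hW0 : IsPMF W := P.joint_isPMF.prodWeight
  have hc0 : IsPMF (prodWeight (ι := Fin L × Fin K) μ) := hμ.prodWeight
  suffices h : ∃ c : Fin L × Fin K → 𝓤, P.errorProb (binningCode G T φ hM c) D ≤ _ from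
    h.elim fun c hc => ⟨binningCode G T φ hM c, rfl, rfl, hc⟩
  refine exists_le_of_average_le hc0 ?_
  -- If there were no block z at all, the joint law could not have mass 1.
  have hτ0 : 0 ≤ τ := by
    by_cases hz : Nonempty (Fin n → Z)
    · exact (avg_nonneg hμ.nonneg fun _ => ind_nonneg _).trans (hτ hz.some)
    · have : IsEmpty (Fin n → X × Y × Z) := ⟨fun ω => hz ⟨zs ω⟩⟩
      simpa using hW0.sum_eq
  have hM1 : (0 : ℝ) ≤ M - 1 := by
    have : (1 : ℝ) ≤ M := by exact_mod_cast hM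
    linarith
  refine (avg_mono hc0.nonneg fun c => P.binningCode_errorProb_le G T φ hM c D hg hθ0 hθ).trans ?_
  rw [avg_add, avg_const hc0, avg_comm]
  refine add_le_add ?_ le_rfl
  have hpair : ∀ ω : Fin n → X × Y × Z, ∀ j j' : Fin L × Fin K, j ≠ j' →
      avg (prodWeight μ) (fun c => ind (G (c j) (ys ω)) * ind (T (c j') (zs ω))) ≤ g * τ :=
    fun ω j j' hj => avg_ind_mul_ind_le hμ (G := fun u => G u (ys ω)) (T := fun u => T u (zs ω))
      (hg1 _) (hτ _) hj
  have hsingle : ∀ ω : Fin n → X × Y × Z, ∀ j : Fin L × Fin K,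
      avg (prodWeight μ) (fun c => ind (G (c j) (ys ω))) ≤ g := fun ω j => by
    rw [avg, sum_prodWeight_eval hμ.sum_eq j (fun u => ind (G u (ys ω)))]
    exact hg1 _
  have hgτ : 0 ≤ g * τ := mul_nonneg hg0 hτ0
  have hpt : ∀ ω, avg (prodWeight μ) (fun c : Fin L × Fin K → 𝓤 =>
      ind (∀ j, ¬G (c j) (ys ω)) + (∑ j : Fin L × Fin K, ∑ k ∈ Finset.univ.erase j.2,
        ind (G (c j) (ys ω)) * ind (T (c (j.1, k)) (zs ω))) +
      (M - 1) * (K * g) * (∑ j, ∑ j' ∈ Finset.univ.erase j,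
        ind (G (c j) (ys ω)) * ind (T (c j') (zs ω)) + ∑ j, ind (G (c j) (ys ω)))) ≤
      (1 - avg μ (fun u => ind (G u (ys ω)))) ^ (L * K) + (L * K * (K - 1) * (g * τ) +
      (M - 1) * (K * g) * ((L * K) ^ 2 * (g * τ) + L * K * g)) := fun ω => by
    simp only [avg_add, avg_sum, avg_const_mul]
    rw [avg_ind_forall_not hμ (fun u => G u (ys ω)), add_assoc]
    refine add_le_add le_rfl (add_le_add ?_ (mul_le_mul_of_nonneg_left (add_le_add ?_ ?_)
      (mul_nonneg hM1 (mul_nonneg (Nat.cast_nonneg _) hg0))))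
    · calc _ ≤ ∑ j : Fin L × Fin K, ∑ k ∈ Finset.univ.erase j.2, g * τ :=
            Finset.sum_le_sum fun j _ => Finset.sum_le_sum fun k hk => hpair ω j (j.1, k)
              fun h => (Finset.ne_of_mem_erase hk) (congrArg Prod.snd h).symm
        _ = _ := by
            simp only [Finset.sum_const, Finset.card_erase_of_mem (Finset.mem_univ _),
              Finset.card_univ, Fintype.card_prod, Fintype.card_fin, nsmul_eq_mul,
              Nat.cast_sub (Nat.succ_le_of_lt hK)]
            push_cast
            ring
    · calc _ ≤ ∑ j : Fin L × Fin K, ∑ j' : Fin L × Fin K, g * τ :=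
            Finset.sum_le_sum fun j _ => (Finset.sum_le_sum fun j' hj' => hpair ω j j'
              (Finset.ne_of_mem_erase hj').symm).trans
              (Finset.sum_le_sum_of_subset_of_nonneg (Finset.erase_subset _ _) fun _ _ _ => hgτ)
        _ = _ := by
            simp only [Finset.sum_const, Finset.card_univ, Fintype.card_prod, Fintype.card_fin,
              nsmul_eq_mul]
            push_cast
            ring
    · calc _ ≤ ∑ j : Fin L × Fin K, g := Finset.sum_le_sum fun j _ => hsingle ω j
        _ = _ := by
            simp only [Finset.sum_const, Finset.card_univ, Fintype.card_prod, Fintype.card_fin,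
              nsmul_eq_mul]
            push_cast
            ring
  refine (avg_mono hW0.nonneg hpt).trans (le_of_eq ?_)
  rw [avg_add, avg_const hW0, avg_law W ys (fun y => (1 - avg μ (fun u => ind (G u y))) ^ (L * K)),
    P.law_ys]
  ring

end RandomCodingAverage

/-! ### Chernoff, change-of-measure and covering bounds. -/

section LargeDeviations

/-- The probability that an i.i.d. sum exceeds its mean by a linear amount is exponentially
small. -/
theorem exists_pow_bound {α : Type*} [Fintype α] {p : α → ℝ} (hp : IsPMF p) (F : α → ℝ) {m : ℝ}
    (hm : avg p F < m) : ∃ ρ : ℝ, 0 ≤ ρ ∧ ρ < 1 ∧ ∀ n : ℕ,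
      avg (prodWeight p) (fun a : Fin n → α => ind (n * m ≤ ∑ i, F (a i))) ≤ ρ ^ n := by
  set f : ℝ → ℝ := fun s => ∑ a, p a * Real.exp (s * (F a - m)) with hf
  have hf0 : f 0 = 1 := by simp [hf, hp.sum_eq]
  have hder : HasDerivAt f (avg p F - m) 0 := by
    have h1 : ∀ a, HasDerivAt (fun s : ℝ => p a * Real.exp (s * (F a - m)))
        (p a * (F a - m)) 0 := fun a => by
      have := (((hasDerivAt_id (0 : ℝ)).mul_const (F a - m)).exp).const_mul (p a)
      simpa using this
    have h2 := HasDerivAt.fun_sum (u := Finset.univ) fun a _ => h1 a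
    have h3 : ∑ a, p a * (F a - m) = avg p F - m := by
      simp only [mul_sub, Finset.sum_sub_distrib, ← Finset.sum_mul, hp.sum_eq, one_mul, avg]
    rw [h3] at h2
    exact h2
  -- The moment generating function of F - m equals 1 at 0 and has negative slope there, so it drops
  -- below 1 at some s > 0.
  obtain ⟨s, hs0, hs⟩ : ∃ s : ℝ, 0 < s ∧ f s < 1 := by
    have h1 := (hasDerivAt_iff_tendsto_slope.1 hder).eventually (gt_mem_nhds (sub_neg.2 hm))
    have h2 : ∀ᶠ s in 𝓝[>] (0 : ℝ), slope f 0 s < 0 :=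
      h1.filter_mono (nhdsWithin_mono _ fun s (hs : 0 < s) => hs.ne')
    obtain ⟨s, hs, hs0⟩ := (h2.and self_mem_nhdsWithin).exists
    refine ⟨s, hs0, ?_⟩
    rw [slope_def_field, hf0, sub_zero, div_neg_iff] at hs
    rcases hs with h | h
    · exact absurd h.2 (not_lt.2 (le_of_lt hs0))
    · linarith [h.1]
  refine ⟨f s, Finset.sum_nonneg fun a _ => mul_nonneg (hp.nonneg a) (Real.exp_pos _).le, hs,
    fun n => ?_⟩
  calc _ ≤ ∑ a : Fin n → α, ∏ i, p (a i) * Real.exp (s * (F (a i) - m)) := by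
        refine Finset.sum_le_sum fun a _ => ?_
        rw [Finset.prod_mul_distrib, ← Real.exp_sum]
        refine mul_le_mul_of_nonneg_left ?_ (hp.prodWeight.nonneg a)
        by_cases h : n * m ≤ ∑ i, F (a i)
        · beta_reduce
          rw [ind_of_true h]
          refine Real.one_le_exp ?_
          rw [← Finset.mul_sum, Finset.sum_sub_distrib]
          refine mul_nonneg hs0.le ?_
          simpa using h
        · beta_reduce
          rw [ind_of_false h]
          exact (Real.exp_pos _).le
    _ = f s ^ n := by
        rw [sum_prod_eq_prod_sum (fun (_ : Fin n) x => p x * Real.exp (s * (F x - m)))]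
        simp [hf]

/-- A change of measure bound: a set on which `μ` is much smaller than a conditional law is
unlikely. -/
theorem avg_ind_le_exp_neg {α : Type*} [Fintype α] {μ r : α → ℝ} {ν a : ℝ} (hr : ∀ u, 0 ≤ r u)
    (hν : ∑ u, r u = ν) {S : α → Prop}
    (hS : ∀ u, S u → 0 < r u ∧ Real.exp a * (μ u * ν) ≤ r u) :
    avg μ (fun u => ind (S u)) ≤ Real.exp (-a) := by
  have hν0 : 0 ≤ ν := hν ▸ Finset.sum_nonneg fun u _ => hr u
  rcases hν0.eq_or_lt with h0 | h0
  · have : ∀ u, ¬S u := fun u hu => by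
      have h1 := Finset.single_le_sum (fun u _ => hr u) (Finset.mem_univ u)
      rw [hν, ← h0] at h1
      exact (hS u hu).1.not_ge h1
    simp only [avg, ind_of_false (this _), mul_zero, Finset.sum_const_zero]
    exact (Real.exp_pos _).le
  · calc _ ≤ ∑ u, Real.exp (-a) * (r u / ν) := by
          refine Finset.sum_le_sum fun u _ => ?_
          beta_reduce
          by_cases h : S u
          · rw [ind_of_true h, mul_one, Real.exp_neg, inv_mul_eq_div, le_div_iff₀ (Real.exp_pos a),
              le_div_iff₀ h0]
            linarith [(hS u h).2]
          · rw [ind_of_false h, mul_zero]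
            exact mul_nonneg (Real.exp_pos _).le (div_nonneg (hr u) h0.le)
      _ = Real.exp (-a) := by
          rw [← Finset.mul_sum, ← Finset.sum_div, hν, div_self h0.ne', mul_one]

/-- The covering bound `(1 - α t) ^ N ≤ 1 - t + exp (-N α)`. -/
theorem one_sub_pow_le {q α t : ℝ} (hq : α * t ≤ q) (hq1 : q ≤ 1) (ht0 : 0 ≤ t)
    (ht1 : t ≤ 1) (N : ℕ) : (1 - q) ^ N ≤ 1 - t + Real.exp (-(N * α)) := by
  calc (1 - q) ^ N ≤ Real.exp (-q) ^ N := by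
        refine pow_le_pow_left₀ (by linarith) ?_ N
        linarith [Real.add_one_le_exp (-q)]
    _ = Real.exp (-(N * q)) := by rw [← Real.exp_nat_mul]; ring_nf
    -- The exponent becomes a convex combination of 0 and -Nα, so convexity of exp separates the
    -- failure probability 1 - t from the covering term.
    _ ≤ Real.exp ((1 - t) • 0 + t • (-(N * α))) := by
        refine Real.exp_le_exp.2 ?_
        simp only [smul_eq_mul]
        have := mul_le_mul_of_nonneg_left hq (Nat.cast_nonneg (α := ℝ) N)
        nlinarith
    _ ≤ (1 - t) • Real.exp 0 + t • Real.exp (-(N * α)) :=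
        convexOn_exp.2 (Set.mem_univ _) (Set.mem_univ _) (by linarith) ht0 (by ring)
    _ ≤ _ := by
        simp only [smul_eq_mul, Real.exp_zero, mul_one]
        have := mul_le_mul_of_nonneg_right ht1 (Real.exp_pos (-(N * α))).le
        linarith

end LargeDeviations

/-! ### Block laws of the source and the codeword. -/

section Typicality

variable {X Y Z Xh 𝓤 : Type*} [Fintype X] [Fintype Y] [Fintype Z] [Fintype 𝓤]

/-- The single-letter law of `(X, Y, Z)` and `U`. -/
def Model.full (P : Model X Y Z Xh) (V : Y → 𝓤 → ℝ) (t : (X × Y × Z) × 𝓤) : ℝ :=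
  P.joint t.1 * V t.1.2.1 t.2

theorem Model.full_isPMF (P : Model X Y Z Xh) {V : Y → 𝓤 → ℝ} (hV : ∀ y, IsPMF (V y)) :
    IsPMF (P.full V) := by
  refine ⟨fun t => mul_nonneg (P.joint_isPMF.nonneg _) ((hV _).nonneg _), ?_⟩
  rw [Fintype.sum_prod_type]
  simp only [Model.full, ← Finset.mul_sum, (hV _).sum_eq, mul_one, P.joint_isPMF.sum_eq]

theorem Model.law_full_fst (P : Model X Y Z Xh) {V : Y → 𝓤 → ℝ} (hV : ∀ y, IsPMF (V y)) :
    law (P.full V) (fun t => t.1) = P.joint := by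
  ext t
  rw [law, Fintype.sum_prod_type, Finset.sum_eq_single t]
  · simp [Model.full, ← Finset.mul_sum, (hV _).sum_eq]
  · intro s _ hs
    simp [hs]
  · simp

theorem Model.law_full_yu (P : Model X Y Z Xh) (V : Y → 𝓤 → ℝ) (y : Y) (u : 𝓤) :
    law (P.full V) (fun t => (t.1.2.1, t.2)) (y, u) = P.pY y * V y u := by
  rw [law, Model.pY, law, Finset.sum_mul, Fintype.sum_prod_type]
  refine Finset.sum_congr rfl fun t _ => ?_
  by_cases h : t.2.1 = y
  · simp [h, Model.full]
  · simp [h]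

/-- The block expectation over the letters and the codeword. -/
theorem Model.avg_full (P : Model X Y Z Xh) (V : Y → 𝓤 → ℝ) {n : ℕ}
    (F : (Fin n → X × Y × Z) → (Fin n → 𝓤) → ℝ) :
    avg (prodWeight (P.full V)) (fun a => F (fun i => (a i).1) (fun i => (a i).2)) =
      ∑ ω, ∑ u, prodWeight P.joint ω * (∏ i, V (ys ω i) (u i)) * F ω u := by
  rw [avg, ← Equiv.sum_comp (Equiv.arrowProdEquivProdArrow (Fin n) (fun _ => X × Y × Z)
    (fun _ => 𝓤)).symm, Fintype.sum_prod_type]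
  refine Finset.sum_congr rfl fun ω _ => Finset.sum_congr rfl fun u _ => ?_
  simp only [Equiv.arrowProdEquivProdArrow, Equiv.coe_fn_symm_mk, prodWeight, Model.full,
    Finset.prod_mul_distrib, ys]

/-- The joint block probability is the product of the marginals tilted by the sum of the information
densities; this turns concentration of the densities into typicality. -/
theorem prodWeight_eq_exp {n : ℕ} {r p q : Fin n → ℝ} (hr : ∀ i, 0 < r i)
    (hp : ∀ i, 0 < p i) (hq : ∀ i, 0 < q i) :
    ∏ i, r i = Real.exp (∑ i, Real.log (r i / (p i * q i))) * ((∏ i, p i) * ∏ i, q i) := by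
  rw [Real.exp_sum, ← Finset.prod_mul_distrib, ← Finset.prod_mul_distrib]
  refine Finset.prod_congr rfl fun i _ => ?_
  rw [Real.exp_log (div_pos (hr i) (mul_pos (hp i) (hq i))),
    div_mul_cancel₀ _ (mul_pos (hp i) (hq i)).ne']


theorem sum_prod_block {α β : Type*} [Fintype β] {q : α → β → ℝ} {p : α → ℝ}
    (h : ∀ a, ∑ b, q a b = p a) {n : ℕ} (a : Fin n → α) :
    ∑ b : Fin n → β, ∏ i, q (a i) (b i) = ∏ i, p (a i) := by
  rw [sum_prod_eq_prod_sum (fun i b => q (a i) b)]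
  simp only [h]

/-- The law of `U`. -/
def Model.pU (P : Model X Y Z Xh) (V : Y → 𝓤 → ℝ) : 𝓤 → ℝ := law (P.full V) (fun t => t.2)

/-- The law of `(Z, U)`. -/
def Model.pZU (P : Model X Y Z Xh) (V : Y → 𝓤 → ℝ) (z : Z) (u : 𝓤) : ℝ :=
  law (P.full V) (fun t => (t.1.2.2, t.2)) (z, u)

theorem Model.sum_pYU (P : Model X Y Z Xh) (V : Y → 𝓤 → ℝ) (u : 𝓤) :
    ∑ y, P.pY y * V y u = P.pU V u := by
  simp only [← P.law_full_yu]
  simp only [law, Model.pU, Prod.mk.injEq, ite_and]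
  rw [Finset.sum_comm]
  simp

theorem Model.sum_pZU_right (P : Model X Y Z Xh) {V : Y → 𝓤 → ℝ} (hV : ∀ y, IsPMF (V y)) (z : Z) :
    ∑ u, P.pZU V z u = P.pZ z := by
  rw [Model.pZ, ← P.law_full_fst hV, law_comp]
  simp only [law, Model.pZU, Prod.mk.injEq]
  rw [Finset.sum_comm]
  refine Finset.sum_congr rfl fun t _ => ?_
  by_cases h : t.1.2.2 = z <;> simp [h]

end Typicality

/-! ### Typical sets and their probabilities. -/

section TypicalSets

variable {X Y Z Xh 𝓤 : Type*} [Fintype X] [Fintype Y] [Fintype Z] [Fintype 𝓤] {n : ℕ}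

theorem avg_mono_of_pos {α : Type*} [Fintype α] {p : α → ℝ} (hp : ∀ a, 0 ≤ p a) {F G : α → ℝ}
    (h : ∀ a, 0 < p a → F a ≤ G a) : avg p F ≤ avg p G :=
  Finset.sum_le_sum fun a _ => by
    rcases (hp a).eq_or_lt with h0 | h0
    · simp [← h0]
    · exact mul_le_mul_of_nonneg_left (h a h0) h0.le

theorem ind_not_le_add {p q r : Prop} (h : ¬q → ¬r → p) : ind (¬p) ≤ ind q + ind r := by
  by_cases hq : q
  · rw [ind_of_true hq]
    linarith [ind_le_one (¬p), ind_nonneg r]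
  · by_cases hr : r
    · rw [ind_of_true hr]
      linarith [ind_le_one (¬p), ind_nonneg q]
    · rw [ind_of_false (not_not.2 (h hq hr))]
      exact add_nonneg (ind_nonneg q) (ind_nonneg r)

/-- The information density of `U` and `Z`. -/
def Model.densZ (P : Model X Y Z Xh) (V : Y → 𝓤 → ℝ) (t : (X × Y × Z) × 𝓤) : ℝ :=
  Real.log (P.pZU V t.1.2.2 t.2 / (P.pU V t.2 * P.pZ t.1.2.2))

/-- The information density of `U` and `Y`. -/
def Model.densY (P : Model X Y Z Xh) (V : Y → 𝓤 → ℝ) (t : (X × Y × Z) × 𝓤) : ℝ :=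
  Real.log (P.pY t.1.2.1 * V t.1.2.1 t.2 / (P.pU V t.2 * P.pY t.1.2.1))

/-- The codeword `u` and the block `z` have information density at least `t`. -/
def Model.TypZ (P : Model X Y Z Xh) (V : Y → 𝓤 → ℝ) (t : ℝ) (u : Fin n → 𝓤) (z : Fin n → Z) :
    Prop :=
  0 < ∏ i, P.pZU V (z i) (u i) ∧
    Real.exp t * ((∏ i, P.pU V (u i)) * ∏ i, P.pZ (z i)) ≤ ∏ i, P.pZU V (z i) (u i)

/-- The codeword `u` is identified and reproduces the source within distortion `D`. -/
def Model.Good (P : Model X Y Z Xh) (V : Y → 𝓤 → ℝ) (φ : 𝓤 → Z → Xh) (t D : ℝ)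
    (u : Fin n → 𝓤) (ω : Fin n → X × Y × Z) : Prop :=
  P.TypZ V t u (zs ω) ∧ P.blockDist (xs ω) (fun i => φ (u i) (zs ω i)) ≤ D

/-- The probability of the block `y` and of a failure of the codeword `u`. -/
def Model.badMass (P : Model X Y Z Xh) (V : Y → 𝓤 → ℝ) (φ : 𝓤 → Z → Xh) (t D : ℝ)
    (u : Fin n → 𝓤) (y : Fin n → Y) : ℝ :=
  avg (prodWeight P.joint) (fun ω => ind (ys ω = y ∧ ¬P.Good V φ t D u ω))

/-- The codeword `u` has information density between `a` and `b` with `y`, and it is likely to be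
good given `y`. -/
def Model.TypY (P : Model X Y Z Xh) (V : Y → 𝓤 → ℝ) (φ : 𝓤 → Z → Xh) (t D a b θ : ℝ)
    (u : Fin n → 𝓤) (y : Fin n → Y) : Prop :=
  (0 < ∏ i, P.pY (y i) * V (y i) (u i) ∧
    Real.exp a * ((∏ i, P.pU V (u i)) * ∏ i, P.pY (y i)) ≤ ∏ i, P.pY (y i) * V (y i) (u i) ∧
    ∏ i, P.pY (y i) * V (y i) (u i) ≤ Real.exp b * ((∏ i, P.pU V (u i)) * ∏ i, P.pY (y i))) ∧
  P.badMass V φ t D u y ≤ θ * prodWeight P.pY y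

theorem Model.full_pos_iff (P : Model X Y Z Xh) {V : Y → 𝓤 → ℝ} (hV : ∀ y, IsPMF (V y))
    {t : (X × Y × Z) × 𝓤} (h : 0 < P.full V t) :
    0 < P.pY t.1.2.1 * V t.1.2.1 t.2 ∧ 0 < P.pY t.1.2.1 ∧ 0 < P.pU V t.2 ∧ 0 < P.pZ t.1.2.2 ∧
      0 < P.pZU V t.1.2.2 t.2 := by
  have h0 := (P.full_isPMF hV).nonneg
  have h1 : 0 < P.joint t.1 := (P.joint_isPMF.nonneg _).lt_of_ne fun h' => by
    rw [Model.full, ← h', zero_mul] at h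
    exact h.false
  refine ⟨?_, law_pos P.joint_isPMF.nonneg (fun t => t.2.1) h1, law_pos h0 (fun t => t.2) h,
    law_pos P.joint_isPMF.nonneg (fun t => t.2.2) h1, law_pos h0 (fun t => (t.1.2.2, t.2)) h⟩
  rw [← P.law_full_yu]
  exact law_pos h0 (fun t => (t.1.2.1, t.2)) h

theorem Model.avg_full_ys (P : Model X Y Z Xh) (V : Y → 𝓤 → ℝ)
    (H : (Fin n → 𝓤) → (Fin n → Y) → ℝ) :
    avg (prodWeight (P.full V)) (fun a => H (fun i => (a i).2) (ys fun i => (a i).1)) =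
      avg (prodWeight P.pY) (fun y => ∑ u, (∏ i, V (y i) (u i)) * H u y) := by
  rw [P.avg_full V (fun ω u => H u (ys ω)), ← P.law_ys, ← avg_law, avg]
  simp only [Finset.mul_sum, mul_assoc]

/-- Given y the codeword is drawn independently of x and z, so averaging the bad mass over codewords
and summing over y gives the total failure probability. -/
theorem Model.avg_badMass (P : Model X Y Z Xh) (V : Y → 𝓤 → ℝ) (φ : 𝓤 → Z → Xh) (t D : ℝ) :
    ∑ y : Fin n → Y, ∑ u, (∏ i, V (y i) (u i)) * P.badMass V φ t D u y =
      avg (prodWeight (P.full V))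
        (fun a : Fin n → (X × Y × Z) × 𝓤 =>
          ind (¬P.Good V φ t D (fun i => (a i).2) (fun i => (a i).1))) := by
  rw [P.avg_full V (fun ω u => ind (¬P.Good V φ t D u ω))]
  simp only [Model.badMass, avg, Finset.mul_sum]
  rw [Finset.sum_comm, Finset.sum_comm (s := (Finset.univ : Finset (Fin n → X × Y × Z)))]
  refine Finset.sum_congr rfl fun u _ => ?_
  rw [Finset.sum_comm]
  refine Finset.sum_congr rfl fun ω _ => ?_
  rw [Finset.sum_eq_single (ys ω)]
  · simp only [true_and]
    ring
  · intro y _ hy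
    rw [ind_of_false fun h => hy h.1.symm]
    ring
  · simp

/-- The probability that the pair of codeword and source is atypical. -/
theorem Model.avg_not_typY_le (P : Model X Y Z Xh) {V : Y → 𝓤 → ℝ} (hV : ∀ y, IsPMF (V y))
    (φ : 𝓤 → Z → Xh) {δ : ℝ} (hδ : 0 < δ) :
    ∃ σ : ℝ, 0 < σ ∧ σ < 1 ∧ ∀ n : ℕ,
      avg (prodWeight (P.full V)) (fun a : Fin n → (X × Y × Z) × 𝓤 =>
        ind (¬P.TypY V φ (n * (avg (P.full V) (P.densZ V) - δ))
          (avg (P.full V) (fun t => P.d t.1.1 (φ t.2 t.1.2.2)) + δ)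
          (n * (avg (P.full V) (P.densY V) - δ)) (n * (avg (P.full V) (P.densY V) + δ)) (σ ^ n)
          (fun i => (a i).2) (ys fun i => (a i).1))) ≤ 4 * σ ^ n := by
  have hp := P.full_isPMF hV
  set A := avg (P.full V) (P.densY V) with hA
  set B := avg (P.full V) (P.densZ V) with hB
  set E := avg (P.full V) (fun t => P.d t.1.1 (φ t.2 t.1.2.2)) with hE
  have hneg : ∀ F : (X × Y × Z) × 𝓤 → ℝ, avg (P.full V) (fun t => -F t) = -avg (P.full V) F :=
    fun F => by simp [avg]
  obtain ⟨ρ₁, h10, h11, h1⟩ := exists_pow_bound hp (fun t => -P.densY V t) (m := -A + δ)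
    (by rw [hneg]; linarith)
  obtain ⟨ρ₂, h20, h21, h2⟩ := exists_pow_bound hp (P.densY V) (m := A + δ) (by linarith)
  obtain ⟨ρ₃, h30, h31, h3⟩ := exists_pow_bound hp (fun t => -P.densZ V t) (m := -B + δ)
    (by rw [hneg]; linarith)
  obtain ⟨ρ₄, h40, h41, h4⟩ := exists_pow_bound hp (fun t => P.d t.1.1 (φ t.2 t.1.2.2))
    (m := E + δ) (by linarith)
  -- The entry 1/2 only keeps ρ positive, so that one may divide by √ρ ^ n.
  obtain ⟨ρ, hρ0, hρ1, g1, g2, g3, g4⟩ : ∃ ρ : ℝ, 0 < ρ ∧ ρ < 1 ∧ ρ₁ ≤ ρ ∧ ρ₂ ≤ ρ ∧ ρ₃ ≤ ρ ∧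
      ρ₄ ≤ ρ :=
    ⟨max (1 / 2) (max (max ρ₁ ρ₂) (max ρ₃ ρ₄)), lt_max_of_lt_left (by norm_num),
      by simp only [max_lt_iff]; exact ⟨by norm_num, ⟨h11, h21⟩, h31, h41⟩, by simp, by simp,
      by simp, by simp⟩
  have hσ0 : 0 < √ρ := Real.sqrt_pos.2 hρ0
  have hσ1 : √ρ < 1 := by
    rw [Real.sqrt_lt' one_pos]
    simpa using hρ1
  refine ⟨√ρ, hσ0, hσ1, fun n => ?_⟩
  have hσn : 0 < √ρ ^ n := pow_pos hσ0 n
  have hρn : ρ ^ n = √ρ ^ n * √ρ ^ n := by rw [← mul_pow, Real.mul_self_sqrt hρ0.le]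
  have hρσ : ρ ^ n ≤ √ρ ^ n := by
    rw [hρn]
    exact mul_le_of_le_one_left hσn.le (pow_le_one₀ hσ0.le hσ1.le)
  set T := (n : ℝ) * (B - δ) with hT
  have hW := hp.prodWeight (ι := Fin n)
  have hgood : avg (prodWeight (P.full V)) (fun a : Fin n → (X × Y × Z) × 𝓤 =>
      ind (¬P.Good V φ T (E + δ) (fun i => (a i).2) (fun i => (a i).1))) ≤ ρ ^ n + ρ ^ n := by
    refine le_trans (avg_mono_of_pos hW.nonneg (G := fun a =>
      ind ((n : ℝ) * (-B + δ) ≤ ∑ i, -P.densZ V (a i)) +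
      ind ((n : ℝ) * (E + δ) ≤ ∑ i, P.d (a i).1.1 (φ (a i).2 (a i).1.2.2))) fun a ha =>
        ind_not_le_add fun hz hd => ?_) ?_
    · have hpos := fun i => P.full_pos_iff hV ((prodWeight_pos hp.nonneg).1 ha i)
      refine ⟨⟨Finset.prod_pos fun i _ => (hpos i).2.2.2.2, ?_⟩, ?_⟩
      · rw [prodWeight_eq_exp (r := fun i => P.pZU V (zs (fun i => (a i).1) i) (a i).2)
          (fun i => (hpos i).2.2.2.2) (fun i => (hpos i).2.2.1) (fun i => (hpos i).2.2.2.1)]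
        refine mul_le_mul_of_nonneg_right (Real.exp_le_exp.2 ?_) (mul_nonneg
          (Finset.prod_nonneg fun i _ => (hpos i).2.2.1.le)
          (Finset.prod_nonneg fun i _ => (hpos i).2.2.2.1.le))
        rw [Finset.sum_neg_distrib] at hz
        have : T < ∑ i, P.densZ V (a i) := by rw [hT]; linarith
        exact this.le
      · rcases Nat.eq_zero_or_pos n with rfl | hn
        · simp at hd
        · have hn' : (0 : ℝ) < n := Nat.cast_pos.2 hn
          rw [Model.blockDist, one_div, inv_mul_le_iff₀ hn']
          exact (not_le.1 hd).le
    · rw [avg_add]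
      exact add_le_add ((h3 n).trans (pow_le_pow_left₀ h30 g3 n))
        ((h4 n).trans (pow_le_pow_left₀ h40 g4 n))
  have hbad : avg (prodWeight (P.full V)) (fun a : Fin n → (X × Y × Z) × 𝓤 =>
      ind (√ρ ^ n * prodWeight P.pY (ys fun i => (a i).1) <
        P.badMass V φ T (E + δ) (fun i => (a i).2) (ys fun i => (a i).1))) ≤ 2 * √ρ ^ n := by
    rw [P.avg_full_ys V (fun u y => ind (√ρ ^ n * prodWeight P.pY y <
      P.badMass V φ T (E + δ) u y))]
    -- Markov's inequality: the total failure probability is at most 2ρ^n, so the conditional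
    -- failure probability exceeds √ρ^n with probability at most 2√ρ^n. Since typicality demands a
    -- small conditional failure, no Markov lemma for typical sequences is needed.
    have hle : √ρ ^ n * avg (prodWeight P.pY) (fun y : Fin n → Y => ∑ u, (∏ i, V (y i) (u i)) *
        ind (√ρ ^ n * prodWeight P.pY y < P.badMass V φ T (E + δ) u y)) ≤ ρ ^ n + ρ ^ n := by
      refine le_trans ?_ hgood
      rw [← P.avg_badMass, avg, Finset.mul_sum]
      refine Finset.sum_le_sum fun y _ => ?_
      rw [Finset.mul_sum, Finset.mul_sum]
      refine Finset.sum_le_sum fun u _ => ?_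
      have hV0 : 0 ≤ ∏ i, V (y i) (u i) := Finset.prod_nonneg fun i _ => (hV _).nonneg _
      by_cases h : √ρ ^ n * prodWeight P.pY y < P.badMass V φ T (E + δ) u y
      · rw [ind_of_true h]
        have := mul_le_mul_of_nonneg_left h.le hV0
        linarith
      · rw [ind_of_false h]
        have : 0 ≤ P.badMass V φ T (E + δ) u y :=
          avg_nonneg P.joint_isPMF.prodWeight.nonneg fun ω => ind_nonneg _
        have := mul_nonneg hV0 this
        linarith
    rw [hρn, show √ρ ^ n * √ρ ^ n + √ρ ^ n * √ρ ^ n = √ρ ^ n * (2 * √ρ ^ n) by ring] at hle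
    exact le_of_mul_le_mul_left hle hσn
  refine le_trans (avg_mono_of_pos hW.nonneg (G := fun a =>
      (ind ((n : ℝ) * (-A + δ) ≤ ∑ i, -P.densY V (a i)) +
      ind ((n : ℝ) * (A + δ) ≤ ∑ i, P.densY V (a i))) +
      ind (√ρ ^ n * prodWeight P.pY (ys fun i => (a i).1) <
        P.badMass V φ T (E + δ) (fun i => (a i).2) (ys fun i => (a i).1))) fun a ha =>
        ?_) ?_
  · refine (ind_not_le_add (q := (n : ℝ) * (-A + δ) ≤ ∑ i, -P.densY V (a i) ∨
      (n : ℝ) * (A + δ) ≤ ∑ i, P.densY V (a i)) fun hq hb => ?_).trans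
      (add_le_add_left ?_ _)
    · have hpos := fun i => P.full_pos_iff hV ((prodWeight_pos hp.nonneg).1 ha i)
      push Not at hq
      refine ⟨⟨Finset.prod_pos fun i _ => (hpos i).1, ?_⟩, not_lt.1 hb⟩
      have h0 : 0 ≤ (∏ i, P.pU V (a i).2) * ∏ i, P.pY (ys (fun i => (a i).1) i) := mul_nonneg
          (Finset.prod_nonneg fun i _ => (hpos i).2.2.1.le)
          (Finset.prod_nonneg fun i _ => (hpos i).2.1.le)
      rw [prodWeight_eq_exp (r := fun i => P.pY (ys (fun i => (a i).1) i) *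
          V (ys (fun i => (a i).1) i) (a i).2)
          (fun i => (hpos i).1) (fun i => (hpos i).2.2.1) (fun i => (hpos i).2.1)]
      rw [Finset.sum_neg_distrib] at hq
      refine ⟨mul_le_mul_of_nonneg_right (Real.exp_le_exp.2 ?_) h0,
        mul_le_mul_of_nonneg_right (Real.exp_le_exp.2 ?_) h0⟩
      · have : (n : ℝ) * (A - δ) < ∑ i, P.densY V (a i) := by linarith [hq.1]
        exact this.le
      · exact hq.2.le
    · by_cases h : (n : ℝ) * (-A + δ) ≤ ∑ i, -P.densY V (a i)
      · rw [ind_of_true h]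
        linarith [ind_le_one ((n : ℝ) * (-A + δ) ≤ ∑ i, -P.densY V (a i) ∨
          (n : ℝ) * (A + δ) ≤ ∑ i, P.densY V (a i)),
          ind_nonneg ((n : ℝ) * (A + δ) ≤ ∑ i, P.densY V (a i))]
      · simp only [h, false_or]
        linarith [ind_nonneg False]
  · rw [avg_add, avg_add]
    have := (h1 n).trans (pow_le_pow_left₀ h10 g1 n)
    have := (h2 n).trans (pow_le_pow_left₀ h20 g2 n)
    linarith

end TypicalSets

/-! ### Random coding with typical sets. -/

section TypicalCode

variable {X Y Z Xh 𝓤 : Type*} [Fintype X] [Fintype Y] [Fintype Z] [Fintype 𝓤] [Nonempty Xh]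

/-- Random coding with typical sets for the test channel `V` and the reproduction function `φ`. -/
theorem Model.exists_typical_code (P : Model X Y Z Xh) {V : Y → 𝓤 → ℝ} (hV : ∀ y, IsPMF (V y))
    (φ : 𝓤 → Z → Xh) {δ : ℝ} (hδ : 0 < δ) :
    ∃ σ : ℝ, 0 < σ ∧ σ < 1 ∧ ∀ (n M L K : ℕ) (g τ : ℝ), 0 < M → 0 < K →
      g = Real.exp (-(n * (avg (P.full V) (P.densY V) - δ))) →
      τ = Real.exp (-(n * (avg (P.full V) (P.densZ V) - δ))) →
      ∃ C : Code Y Z Xh n, C.M = M ∧ C.L = L + 1 ∧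
        P.errorProb C (avg (P.full V) (fun t => P.d t.1.1 (φ t.2 t.1.2.2)) + δ) ≤
          5 * σ ^ n +
            Real.exp (-(((L * K : ℕ) : ℝ) *
              Real.exp (-(n * (avg (P.full V) (P.densY V) + δ))))) +
            L * K * (K - 1) * (g * τ) +
            (M - 1) * (K * g) * ((L * K) ^ 2 * (g * τ) + L * K * g) := by
  obtain ⟨σ, hσ0, hσ1, hσ⟩ := P.avg_not_typY_le hV φ hδ
  refine ⟨σ, hσ0, hσ1, fun n M L K g τ hM hK hg hτ => ?_⟩
  have hp := P.full_isPMF hV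
  have hU : IsPMF (P.pU V) := hp.law _
  have hσn := hσ n
  set A := avg (P.full V) (P.densY V) with hA
  set B := avg (P.full V) (P.densZ V) with hB
  set D := avg (P.full V) (fun t => P.d t.1.1 (φ t.2 t.1.2.2)) + δ with hD
  have hYU : ∀ y u, 0 ≤ P.pY y * V y u := fun y u => mul_nonneg (P.pY_isPMF.nonneg y)
    ((hV y).nonneg u)
  have hZU : ∀ z u, 0 ≤ P.pZU V z u := fun z u => law_nonneg hp.nonneg _ _
  have hYUu : ∀ y, ∑ u, P.pY y * V y u = P.pY y := fun y => by
    rw [← Finset.mul_sum, (hV y).sum_eq, mul_one]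
  obtain ⟨C, hCM, hCL, hC⟩ := P.exists_code_errorProb_le (L := L) (hU.prodWeight (ι := Fin n))
    (P.TypY V φ (n * (B - δ)) D (n * (A - δ)) (n * (A + δ)) (σ ^ n)) (P.TypZ V (n * (B - δ)))
    (fun u z i => φ (u i) (z i)) hM hK D (g := g) (τ := τ) (θ := σ ^ n) (hg ▸ (Real.exp_pos _).le)
    (fun y => hg ▸ avg_ind_le_exp_neg (fun u => Finset.prod_nonneg fun i _ => hYU (y i) (u i))
      (sum_prod_block hYUu y) fun u hu => ⟨hu.1.1, hu.1.2.1⟩)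
    (fun u => hg ▸ avg_ind_le_exp_neg
      (fun y => Finset.prod_nonneg fun i _ => hYU (y i) (u i))
      (sum_prod_block (q := fun u y => P.pY y * V y u) (P.sum_pYU V) u) fun y hy =>
        ⟨hy.1.1, by rw [prodWeight, mul_comm (∏ i, P.pY (y i))]; exact hy.1.2.1⟩)
    (fun z => hτ ▸ avg_ind_le_exp_neg (fun u => Finset.prod_nonneg fun i _ => hZU (z i) (u i))
      (sum_prod_block (P.sum_pZU_right hV) z) fun u hu => hu)
    (pow_pos hσ0 n).le (fun u y h => h.2)
  refine ⟨C, hCM, hCL, hC.trans ?_⟩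
  -- On typical pairs P_U^n is at least e^{-n(A+δ)} times the channel law V^n(·|y). The covering
  -- bound thus leaves the atypical mass, at most 4σ^n on average; the fifth σ^n of the claim is θ.
  have hcover : avg (prodWeight P.pY) (fun y : Fin n → Y => (1 - avg (prodWeight (P.pU V))
      (fun u => ind (P.TypY V φ (n * (B - δ)) D (n * (A - δ)) (n * (A + δ)) (σ ^ n) u y))) ^
        (L * K)) ≤ 4 * σ ^ n + Real.exp (-(((L * K : ℕ) : ℝ) * Real.exp (-(n * (A + δ))))) := by
    refine le_trans (avg_mono P.pY_isPMF.prodWeight.nonneg (G := fun y =>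
      ∑ u, (∏ i, V (y i) (u i)) * ind (¬P.TypY V φ (n * (B - δ)) D (n * (A - δ)) (n * (A + δ))
        (σ ^ n) u y) + Real.exp (-(((L * K : ℕ) : ℝ) * Real.exp (-(n * (A + δ)))))) fun y => ?_) ?_
    · have hV1 : ∑ u : Fin n → 𝓤, ∏ i, V (y i) (u i) = 1 := by
        rw [sum_prod_block (p := fun _ => 1) fun y => (hV y).sum_eq]
        simp
      have hV0 : ∀ u : Fin n → 𝓤, 0 ≤ ∏ i, V (y i) (u i) := fun u =>
        Finset.prod_nonneg fun i _ => (hV _).nonneg _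
      have hsplit : ∑ u : Fin n → 𝓤, (∏ i, V (y i) (u i)) * ind (¬P.TypY V φ (n * (B - δ)) D
          (n * (A - δ)) (n * (A + δ)) (σ ^ n) u y) = 1 - avg (fun u => ∏ i, V (y i) (u i))
          (fun u => ind (P.TypY V φ (n * (B - δ)) D (n * (A - δ)) (n * (A + δ)) (σ ^ n) u y)) := by
        rw [← hV1, avg, ← Finset.sum_sub_distrib]
        refine Finset.sum_congr rfl fun u _ => ?_
        by_cases h : P.TypY V φ (n * (B - δ)) D (n * (A - δ)) (n * (A + δ)) (σ ^ n) u y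
        · rw [ind_of_true h, ind_of_false (not_not.2 h)]
          ring
        · rw [ind_of_true h, ind_of_false h]
          ring
      rw [hsplit]
      refine one_sub_pow_le ?_ (avg_le hU.prodWeight fun u => ind_le_one _)
        (avg_nonneg hV0 fun u => ind_nonneg _) (avg_le ⟨hV0, hV1⟩ fun u => ind_le_one _) _
      rw [← avg_const_mul]
      refine Finset.sum_le_sum fun u _ => ?_
      beta_reduce
      by_cases h : P.TypY V φ (n * (B - δ)) D (n * (A - δ)) (n * (A + δ)) (σ ^ n) u y
      · rw [ind_of_true h, mul_one, mul_one]
        have h1 := h.1.2.2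
        have h2 : 0 < ∏ i, P.pY (y i) :=
          (Finset.prod_nonneg fun i _ => P.pY_isPMF.nonneg _).lt_of_ne fun h0 => by
            have := h.1.1
            rw [Finset.prod_mul_distrib, ← h0, zero_mul] at this
            exact this.false
        rw [Finset.prod_mul_distrib, mul_comm (∏ i, P.pY (y i)), ← mul_assoc] at h1
        rw [Real.exp_neg, mul_inv_le_iff₀ (Real.exp_pos _), mul_comm (prodWeight _ _)]
        exact le_of_mul_le_mul_right h1 h2
      · rw [ind_of_false h]
        simp
    · rw [avg_add, avg_const P.pY_isPMF.prodWeight, ← P.avg_full_ys V (fun u y =>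
        ind (¬P.TypY V φ (n * (B - δ)) D (n * (A - δ)) (n * (A + δ)) (σ ^ n) u y))]
      exact add_le_add_left hσn _
  linarith

end TypicalCode

/-! ### Information quantities of a test channel. -/

section TestChannel

variable {X Y Z Xh 𝓤 : Type*} [Fintype X] [Fintype Y] [Fintype Z] [Fintype 𝓤]

/-- U depends on the letters only through Y, so once `f` determines Y the joint law factors through
V. -/
theorem Model.law_full_pair {β : Type*} (P : Model X Y Z Xh) (V : Y → 𝓤 → ℝ) {f : X × Y × Z → β}
    (hf : ∀ s t, f s = f t → s.2.1 = t.2.1) (t : (X × Y × Z) × 𝓤) :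
    law (P.full V) (fun t => (t.2, f t.1)) (t.2, f t.1) = law P.joint f (f t.1) * V t.1.2.1 t.2 := by
  rw [law, law, Finset.sum_mul, Fintype.sum_prod_type]
  refine Finset.sum_congr rfl fun s _ => ?_
  by_cases h : f s = f t.1
  · simp [h, Model.full, hf s t.1 h]
  · simp [h]

theorem Model.law_full_left {β : Type*} (P : Model X Y Z Xh) {V : Y → 𝓤 → ℝ}
    (hV : ∀ y, IsPMF (V y)) (f : X × Y × Z → β) :
    law (P.full V) (fun t => f t.1) = law P.joint f := by
  rw [← P.law_full_fst hV, law_comp]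

/-- The conditional entropy of `U` given variables that include `Y`. -/
theorem Model.ent_full_sub {β : Type*} [Fintype β] (P : Model X Y Z Xh) {V : Y → 𝓤 → ℝ}
    (hV : ∀ y, IsPMF (V y)) {f : X × Y × Z → β} (hf : ∀ s t, f s = f t → s.2.1 = t.2.1) :
    ent (P.full V) (fun t => (t.2, f t.1)) = ent (P.full V) (fun t => f t.1) -
      ∑ t, P.full V t * Real.log (V t.1.2.1 t.2) := by
  rw [ent, ent, sub_eq_add_neg, ← neg_add, ← Finset.sum_add_distrib]
  congr 1
  refine Finset.sum_congr rfl fun t _ => ?_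
  rw [P.law_full_pair V hf, P.law_full_left hV]
  rcases ((P.full_isPMF hV).nonneg t).eq_or_lt with h | h
  · simp [← h]
  · have h1 := P.full_pos_iff hV h
    have h2 : 0 < law P.joint f (f t.1) := law_pos P.joint_isPMF.nonneg f
      ((P.joint_isPMF.nonneg _).lt_of_ne fun h' => by
        rw [Model.full, ← h', zero_mul] at h
        exact h.false)
    rw [Real.log_mul h2.ne' (pos_of_mul_pos_right h1.1 h1.2.1.le).ne', mul_add]

theorem Model.avg_densZ (P : Model X Y Z Xh) {V : Y → 𝓤 → ℝ} (hV : ∀ y, IsPMF (V y)) :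
    avg (P.full V) (P.densZ V) = mutualInfo (P.full V) (fun t => t.2) (fun t => t.1.2.2) := by
  rw [mutualInfo_eq_sum, avg]
  refine Finset.sum_congr rfl fun t _ => ?_
  rw [Model.densZ, Model.pZU, law_congr (A := fun t : (X × Y × Z) × 𝓤 => (t.1.2.2, t.2))
    (B := fun t => (t.2, t.1.2.2)) (by simp [and_comm]) t, Model.pU, Model.pZ,
    P.law_full_left hV (fun s => s.2.2)]

theorem Model.avg_densY (P : Model X Y Z Xh) {V : Y → 𝓤 → ℝ} (hV : ∀ y, IsPMF (V y)) :
    avg (P.full V) (P.densY V) = mutualInfo (P.full V) (fun t => t.2) (fun t => t.1.2.1) := by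
  rw [mutualInfo_eq_sum, avg]
  refine Finset.sum_congr rfl fun t _ => ?_
  rw [Model.densY, P.law_full_pair V (f := fun s => s.2.1) fun s t h => h, Model.pU, Model.pY,
    P.law_full_left hV (fun s => s.2.1)]

/-- The chain rule `I(U; Y) = I(U; Z) + I(U; Y | Z)` for the Markov chain `Z - Y - U`. -/
theorem Model.avg_densY_eq (P : Model X Y Z Xh) {V : Y → 𝓤 → ℝ} (hV : ∀ y, IsPMF (V y)) :
    avg (P.full V) (P.densY V) = avg (P.full V) (P.densZ V) +
      condMutualInfo (P.full V) (fun t => t.2) (fun t => t.1.2.1) (fun t => t.1.2.2) := by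
  have hp := P.full_isPMF hV
  -- `P.ent_full_sub` at Y and at (Y, Z) gives H(U | Y) = H(U | Y, Z), which is the Markov property
  -- used by the chain rule.
  rw [P.avg_densY hV, P.avg_densZ hV, mutualInfo_eq_ent hp, mutualInfo_eq_ent hp,
    condMutualInfo_eq_ent hp, P.ent_full_sub hV (f := fun s => s.2.1) fun s t h => h,
    P.ent_full_sub hV (f := fun s => (s.2.1, s.2.2)) fun s t h => (Prod.mk.inj h).1]
  ring

theorem condMutualInfo_nonneg {Ω α β γ : Type*} [Fintype Ω] [Fintype α] [Fintype β] [Fintype γ]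
    {Q : Ω → ℝ} (hQ : IsPMF Q) (A : Ω → α) (B : Ω → β) (C : Ω → γ) :
    0 ≤ condMutualInfo Q A B C := by
  rw [condMutualInfo_eq_ent hQ]
  have := ent_submod hQ A (fun ω => (B ω, C ω)) C fun _ _ h => (Prod.mk.inj h).2
  linarith

/-- A test law is the image of the law of ((X, Y, Z), U) under appending φ(U, Z), so its information
quantities can be computed before Xh is adjoined. -/
theorem Model.testLaw_eq_law [Fintype Xh] (P : Model X Y Z Xh) {k : ℕ}
    {Q : X × Y × Z × Fin k × Xh → ℝ} {V : Y → Fin k → ℝ} {φ : Fin k → Z → Xh}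
    (hQ : ∀ x y z u xh, Q (x, y, z, u, xh) =
      P.PX x * P.PYX x y * P.PZX x z * V y u * (if xh = φ u z then 1 else 0)) :
    Q = law (P.full V) (fun t => (t.1.1, t.1.2.1, t.1.2.2, t.2, φ t.2 t.1.2.2)) := by
  ext ⟨x, y, z, u, xh⟩
  rw [hQ, law, Finset.sum_eq_single ((x, y, z), u)]
  · simp only [Prod.mk.injEq, true_and, Model.full, Model.joint, mul_ite, mul_one, mul_zero,
      eq_comm]
  · rintro ⟨⟨x', y', z'⟩, u'⟩ _ h
    refine if_neg fun h' => h ?_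
    simp only [Prod.mk.injEq] at h' ⊢
    tauto
  · simp

end TestChannel

/-! ### Exponents of the code sizes. -/

section Rates

theorem ceil_le_two_mul_exp {x : ℝ} (hx : 0 ≤ x) : (⌈Real.exp x⌉₊ : ℝ) ≤ 2 * Real.exp x := by
  have := Nat.ceil_lt_add_one (Real.exp_pos x).le
  have := Real.one_le_exp hx
  linarith

theorem ceil_sub_one_le (x : ℝ) : (⌈Real.exp x⌉₊ : ℝ) - 1 ≤ Real.exp x := by
  have := Nat.ceil_lt_add_one (Real.exp_pos x).le
  linarith

theorem exp_neg_le_of_exp_le {x y : ℝ} (h : Real.exp x ≤ y) : Real.exp (-y) ≤ Real.exp (-x) :=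
  Real.exp_le_exp.2 (by linarith [Real.add_one_le_exp x])

/-- Rounding up and the failure symbol cost at most a factor 3 when l ≥ 0, since then ⌈e^{nl}⌉ + 1 ≤
3 e^{nl}; log 3 / n tends to 0. -/
theorem hasRates_of_ceil {Y Z Xh : Type*} {C : ∀ n, Code Y Z Xh n} {m l Ri Rc : ℝ} (hl : 0 ≤ l)
    (hRi : Ri ≤ m) (hRc : l ≤ Rc) (hM : ∀ n, (C n).M = ⌈Real.exp (n * m)⌉₊)
    (hL : ∀ n, (C n).L = ⌈Real.exp (n * l)⌉₊ + 1) : HasRates C Ri Rc := by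
  constructor
  · refine le_liminf_of_le (by isBoundedDefault) ?_
    filter_upwards [eventually_gt_atTop 0] with n hn
    have hn' : (0 : ℝ) < n := Nat.cast_pos.2 hn
    refine EReal.coe_le_coe_iff.2 (hRi.trans ?_)
    rw [one_div, le_inv_mul_iff₀ hn', hM]
    rw [Real.le_log_iff_exp_le (Nat.cast_pos.2 (Nat.ceil_pos.2 (Real.exp_pos _)))]
    exact Nat.le_ceil _
  · have h1 : Tendsto (fun n : ℕ => ((l + Real.log 3 / n : ℝ) : EReal)) atTop (𝓝 (l : EReal)) := by
      refine (continuous_coe_real_ereal.tendsto l).comp ?_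
      simpa using (tendsto_const_div_atTop_nhds_zero_nat (Real.log 3)).const_add l
    have h2 : limsup (fun n : ℕ => (((1 / (n : ℝ)) * Real.log (C n).L : ℝ) : EReal)) atTop ≤
        limsup (fun n : ℕ => ((l + Real.log 3 / n : ℝ) : EReal)) atTop := by
      refine limsup_le_limsup ?_ (by isBoundedDefault) (by isBoundedDefault)
      filter_upwards [eventually_gt_atTop 0] with n hn
      have hn' : (0 : ℝ) < n := Nat.cast_pos.2 hn
      refine EReal.coe_le_coe_iff.2 ?_
      rw [one_div, inv_mul_le_iff₀ hn', mul_add, mul_div_cancel₀ _ hn'.ne', hL,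
        Real.log_le_iff_le_exp (by positivity), Real.exp_add, Real.exp_log (by norm_num)]
      have h0 : 0 ≤ n * l := by positivity
      have := ceil_le_two_mul_exp h0
      have := Real.one_le_exp h0
      push_cast
      linarith
    exact (h2.trans h1.limsup_eq.le).trans (EReal.coe_le_coe_iff.2 hRc)

/-- The error bound of random binning at rates below the information limits. -/
theorem binning_bound_le {A B R δ g τ : ℝ} {n : ℕ} (hδ : 0 ≤ δ) (hR : 8 * δ ≤ R)
    (hRB : R ≤ B) (hBA : B ≤ A) (hg : g = Real.exp (-(n * (A - δ))))
    (hτ : τ = Real.exp (-(n * (B - δ)))) {M L K : ℕ} (hM : M = ⌈Real.exp (n * (R - 8 * δ))⌉₊)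
    (hL : L = ⌈Real.exp (n * (R + (A - B) + 2 * δ))⌉₊) (hK : K = ⌈Real.exp (n * (B - R))⌉₊) :
    Real.exp (-(((L * K : ℕ) : ℝ) * Real.exp (-(n * (A + δ))))) + L * K * (K - 1) * (g * τ) +
      (M - 1) * (K * g) * ((L * K) ^ 2 * (g * τ) + L * K * g) ≤ 45 * Real.exp (-(n * δ)) := by
  have hn : (0 : ℝ) ≤ n := n.cast_nonneg
  -- Up to rounding LK = e^{n(A+2δ)}, just above the covering threshold e^{n(A+δ)}. The constant 45
  -- is 1 + 4 + 40 from the three terms.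
  set e1 := Real.exp (n * (R - 8 * δ)) with he1
  set e2 := Real.exp (n * (B - R)) with he2
  set e3 := Real.exp (n * (R + (A - B) + 2 * δ)) with he3
  have hg0 : 0 < g := hg ▸ Real.exp_pos _
  have hτ0 : 0 < τ := hτ ▸ Real.exp_pos _
  have h1 : (M : ℝ) - 1 ≤ e1 := hM ▸ ceil_sub_one_le _
  have h2 : (K : ℝ) - 1 ≤ e2 := hK ▸ ceil_sub_one_le _
  have h2' : (K : ℝ) ≤ 2 * e2 := hK ▸ ceil_le_two_mul_exp (mul_nonneg hn (by linarith))
  have h3' : (L : ℝ) ≤ 2 * e3 := hL ▸ ceil_le_two_mul_exp (mul_nonneg hn (by linarith))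
  have h2'' : e2 ≤ K := hK ▸ Nat.le_ceil _
  have h3'' : e3 ≤ L := hL ▸ Nat.le_ceil _
  have hK1 : (1 : ℝ) ≤ K := by
    have : 0 < K := hK ▸ Nat.ceil_pos.2 (Real.exp_pos _)
    exact_mod_cast this
  have hM1 : (1 : ℝ) ≤ M := by
    have : 0 < M := hM ▸ Nat.ceil_pos.2 (Real.exp_pos _)
    exact_mod_cast this
  have p1 : 0 < e1 := Real.exp_pos _
  have p2 : 0 < e2 := Real.exp_pos _
  have p3 : 0 < e3 := Real.exp_pos _
  have t1 : Real.exp (-(((L * K : ℕ) : ℝ) * Real.exp (-(n * (A + δ))))) ≤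
      Real.exp (-(n * δ)) := by
    refine exp_neg_le_of_exp_le ?_
    push_cast
    calc Real.exp (n * δ) = e3 * e2 * Real.exp (-(n * (A + δ))) := by
          rw [he2, he3, ← Real.exp_add, ← Real.exp_add]
          ring_nf
      _ ≤ _ := by gcongr
  have t2 : L * K * (K - 1) * (g * τ) ≤ 4 * Real.exp (-(n * δ)) := by
    calc L * K * (K - 1) * (g * τ) ≤ (2 * e3) * (2 * e2) * e2 * (g * τ) := by
          have : (0 : ℝ) ≤ K - 1 := by linarith
          gcongr
      _ = 4 * (e3 * e2 * e2 * (g * τ)) := by ring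
      _ ≤ _ := by
          refine mul_le_mul_of_nonneg_left ?_ (by norm_num)
          rw [he2, he3, hg, hτ, ← Real.exp_add, ← Real.exp_add, ← Real.exp_add, ← Real.exp_add]
          refine Real.exp_le_exp.2 ?_
          have : 0 ≤ n * (R - 5 * δ) := mul_nonneg hn (by linarith)
          linarith
  have t3 : (M - 1) * (K * g) * ((L * K) ^ 2 * (g * τ) + L * K * g) ≤
      40 * Real.exp (-(n * δ)) := by
    -- The binding term: its exponent is -8δ + 4δ + 3δ = -δ, from M, from (LK)² and from g, g, τ.
    -- This is where the 8δ in the identification rate comes from.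
    have s1 : e1 * (e2 * g) * ((e3 * e2) * (e3 * e2) * (g * τ)) ≤ Real.exp (-(n * δ)) := by
      rw [he1, he2, he3, hg, hτ]
      simp only [← Real.exp_add]
      exact Real.exp_le_exp.2 (by ring_nf; rfl)
    have s2 : e1 * (e2 * g) * (e3 * e2 * g) ≤ Real.exp (-(n * δ)) := by
      rw [he1, he2, he3, hg]
      simp only [← Real.exp_add]
      refine Real.exp_le_exp.2 ?_
      have : 0 ≤ n * (A - B + 3 * δ) := mul_nonneg hn (by linarith)
      linarith
    calc (M - 1) * (K * g) * ((L * K) ^ 2 * (g * τ) + L * K * g) ≤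
          e1 * (2 * e2 * g) * ((2 * e3 * (2 * e2)) ^ 2 * (g * τ) + 2 * e3 * (2 * e2) * g) := by
          have : (0 : ℝ) ≤ M - 1 := by linarith
          gcongr
      _ = 32 * (e1 * (e2 * g) * ((e3 * e2) * (e3 * e2) * (g * τ))) +
          8 * (e1 * (e2 * g) * (e3 * e2 * g)) := by ring
      _ ≤ _ := by linarith
  linarith

end Rates

/-! ### Achievability for a fixed test channel. -/

section Achievability

variable {X Y Z Xh : Type*} [Fintype X] [Fintype Y] [Fintype Z]

theorem Model.correctProb_mono (P : Model X Y Z Xh) {n : ℕ} (C : Code Y Z Xh n) {D D' : ℝ}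
    (h : D ≤ D') : P.correctProb C D ≤ P.correctProb C D' := by
  rw [P.correctProb_eq, P.correctProb_eq]
  refine Finset.sum_le_sum fun ω _ => mul_le_mul_of_nonneg_left
    (mul_le_mul_of_nonneg_left ?_ (P.hitProb_nonneg C _ _)) (P.joint_isPMF.prodWeight.nonneg _)
  split_ifs with h1 h2
  · rfl
  · exact absurd (h1.trans h) h2
  · exact zero_le_one
  · rfl

theorem Model.errorProb_anti (P : Model X Y Z Xh) {n : ℕ} (C : Code Y Z Xh n) {D D' : ℝ}
    (h : D ≤ D') : P.errorProb C D' ≤ P.errorProb C D := by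
  have := P.correctProb_mono C h
  rw [Model.correctProb, Model.correctProb] at this
  linarith

theorem Model.achievable_of_ceil (P : Model X Y Z Xh) {m l Ri Rc D σ δ : ℝ} (hl : 0 ≤ l)
    (hRi : Ri ≤ m) (hRc : l ≤ Rc) (hσ0 : 0 < σ) (hσ1 : σ < 1) (hδ : 0 < δ)
    (H : ∀ n : ℕ, ∃ C : Code Y Z Xh n, C.M = ⌈Real.exp (n * m)⌉₊ ∧
      C.L = ⌈Real.exp (n * l)⌉₊ + 1 ∧
      P.errorProb C D ≤ 5 * σ ^ n + 45 * Real.exp (-(n * δ))) : P.Achievable 0 Ri Rc D := by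
  choose C hM hL hC using H
  refine ⟨C, hasRates_of_ceil hl hRi hRc hM hL, ?_⟩
  have h1 : Tendsto (fun n : ℕ => ((5 * σ ^ n + 45 * Real.exp (-(n * δ)) : ℝ) : EReal)) atTop
      (𝓝 ((0 : ℝ) : EReal)) := by
    refine (continuous_coe_real_ereal.tendsto 0).comp ?_
    have h2 : Tendsto (fun n : ℕ => Real.exp (-δ) ^ n) atTop (𝓝 0) :=
      tendsto_pow_atTop_nhds_zero_of_lt_one (Real.exp_pos _).le (by simpa using hδ)
    have h3 := ((tendsto_pow_atTop_nhds_zero_of_lt_one hσ0.le hσ1).const_mul 5).add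
      (h2.const_mul 45)
    simp only [← Real.exp_nat_mul, mul_zero, add_zero, mul_neg] at h3
    exact h3
  exact (limsup_le_limsup (Eventually.of_forall fun n => EReal.coe_le_coe_iff.2 (hC n))
    (by isBoundedDefault) (by isBoundedDefault)).trans h1.limsup_eq.le

/-- The direct part for a fixed test channel. -/
theorem Model.achievable_of_test [Nonempty Xh] {𝓤 : Type*} [Fintype 𝓤] (P : Model X Y Z Xh)
    {V : Y → 𝓤 → ℝ} (hV : ∀ y, IsPMF (V y)) (φ : 𝓤 → Z → Xh) {Ri Rc D δ : ℝ} (hRi : 0 ≤ Ri)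
    (hδ : 0 < δ) (hB : Ri ≤ avg (P.full V) (P.densZ V))
    (hA : avg (P.full V) (P.densY V) - avg (P.full V) (P.densZ V) ≤ Rc - Ri)
    (hD : avg (P.full V) (fun t => P.d t.1.1 (φ t.2 t.1.2.2)) ≤ D) :
    P.Achievable 0 (Ri - 8 * δ) (Rc + 16 * δ) (D + 8 * δ) := by
  obtain ⟨σ, hσ0, hσ1, H⟩ := P.exists_typical_code hV φ hδ
  have hBA : avg (P.full V) (P.densZ V) ≤ avg (P.full V) (P.densY V) := by
    rw [P.avg_densY_eq hV]
    linarith [condMutualInfo_nonneg (P.full_isPMF hV) (fun t => t.2) (fun t => t.1.2.1)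
      (fun t => t.1.2.2)]
  set A := avg (P.full V) (P.densY V)
  set B := avg (P.full V) (P.densZ V)
  have hDD : avg (P.full V) (fun t => P.d t.1.1 (φ t.2 t.1.2.2)) + δ ≤ D + 8 * δ := by linarith
  by_cases hB8 : 8 * δ ≤ B
  · have hR8 : 8 * δ ≤ max Ri (8 * δ) := le_max_right _ _
    have hRB : max Ri (8 * δ) ≤ B := max_le hB hB8
    have hRR : max Ri (8 * δ) ≤ Ri + 8 * δ := max_le (by linarith) (by linarith)
    -- With R = max(Ri, 8δ) the storage rate is at most Ri + 8δ + (Rc - Ri) + 2δ, within the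
    -- allowance Rc + 16δ.
    refine P.achievable_of_ceil (m := max Ri (8 * δ) - 8 * δ)
      (l := max Ri (8 * δ) + (A - B) + 2 * δ) (by linarith)
      (by linarith [le_max_left Ri (8 * δ)]) (by linarith) hσ0 hσ1 hδ fun n => ?_
    obtain ⟨C, hM, hL, hC⟩ := H n _ ⌈Real.exp (n * (max Ri (8 * δ) + (A - B) + 2 * δ))⌉₊ _ _ _
      (Nat.ceil_pos.2 (Real.exp_pos (n * (max Ri (8 * δ) - 8 * δ))))
      (Nat.ceil_pos.2 (Real.exp_pos (n * (B - max Ri (8 * δ))))) rfl rfl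
    refine ⟨C, hM, hL, (P.errorProb_anti C hDD).trans (hC.trans ?_)⟩
    have := binning_bound_le (n := n) hδ.le hR8 hRB hBA rfl rfl rfl rfl rfl
    linarith
  -- If I(U;Z) < 8δ then Ri - 8δ < 0, so a single item with bins of size one suffices. Since Ri ≥ 0,
  -- the storage rate is below Rc + 10δ.
  · refine P.achievable_of_ceil (m := 0) (l := A + 2 * δ) (by linarith) (by linarith)
      (by linarith) hσ0 hσ1 hδ fun n => ?_
    obtain ⟨C, hM, hL, hC⟩ := H n 1 ⌈Real.exp (n * (A + 2 * δ))⌉₊ 1 _ _ one_pos one_pos rfl rfl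
    refine ⟨C, by simpa using hM, hL, (P.errorProb_anti C hDD).trans (hC.trans ?_)⟩
    have : Real.exp (-(((⌈Real.exp (n * (A + 2 * δ))⌉₊ * 1 : ℕ) : ℝ) *
        Real.exp (-(n * (A + δ))))) ≤ Real.exp (-(n * δ)) := by
      refine exp_neg_le_of_exp_le ?_
      calc Real.exp (n * δ) = Real.exp (n * (A + 2 * δ)) * Real.exp (-(n * (A + δ))) := by
            rw [← Real.exp_add]
            ring_nf
        _ ≤ _ := by
            rw [mul_one]
            gcongr
            exact Nat.le_ceil _
    have := Real.exp_pos (-(n * δ))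
    simp only [Nat.cast_one, sub_self, mul_zero, zero_mul, add_zero]
    linarith

end Achievability

/-! ### Comparison of the regions. -/

section Regions

variable {X Y Z Xh : Type*} [Fintype X] [Fintype Y] [Fintype Z]

theorem HasRates.eventually {Y Z Xh : Type*} {C : ∀ n, Code Y Z Xh n} {Ri Rc γ : ℝ}
    (h : HasRates C Ri Rc)
    (hγ : 0 < γ) : ∀ᶠ n : ℕ in atTop, 0 < n ∧ n * (Ri - γ) ≤ Real.log (C n).M ∧
      Real.log (C n).L ≤ n * (Rc + γ) := by
  have h1 : ((Ri - γ : ℝ) : EReal) < (Ri : EReal) := EReal.coe_lt_coe_iff.2 (by linarith)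
  have h2 : (Rc : EReal) < ((Rc + γ : ℝ) : EReal) := EReal.coe_lt_coe_iff.2 (by linarith)
  filter_upwards [eventually_lt_of_lt_liminf (h1.trans_le h.1),
    eventually_lt_of_limsup_lt (h.2.trans_lt h2), eventually_gt_atTop 0] with n hM hL hn
  have hn' : (0 : ℝ) < n := Nat.cast_pos.2 hn
  rw [EReal.coe_lt_coe_iff, one_div] at hM hL
  exact ⟨hn, ((lt_inv_mul_iff₀ hn').1 hM).le, ((inv_mul_lt_iff₀ hn').1 hL).le⟩

/-- log M ≥ 0 always, so a negative identification rate may be raised to 0, where the direct part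
applies. -/
theorem HasRates.max_zero {Y Z Xh : Type*} {C : ∀ n, Code Y Z Xh n} {Ri Rc : ℝ}
    (h : HasRates C Ri Rc) :
    HasRates C (max Ri 0) Rc := by
  refine ⟨?_, h.2⟩
  rcases max_cases Ri 0 with h' | h'
  · rw [h'.1]
    exact h.1
  · rw [h'.1]
    refine le_liminf_of_le (by isBoundedDefault) (Eventually.of_forall fun n => ?_)
    refine EReal.coe_le_coe_iff.2 (mul_nonneg (by positivity) (Real.log_nonneg ?_))
    exact_mod_cast (C n).M_pos

theorem Model.epsRegion_mono (P : Model X Y Z Xh) {ε ε' : ℝ} (h : ε ≤ ε') :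
    P.epsRegion ε ⊆ P.epsRegion ε' :=
  closure_mono fun _ ⟨C, hC, he⟩ => ⟨C, hC, he.trans (EReal.coe_le_coe_iff.2 h)⟩

/-- Lowering Ri is a translation that maps achievable triples to achievable triples, and being
continuous it passes to the closure. -/
theorem Model.mem_epsRegion_of_le (P : Model X Y Z Xh) {ε Ri Ri' Rc D : ℝ} (h : Ri ≤ Ri')
    (ht : (Ri', Rc, D) ∈ P.epsRegion ε) : (Ri, Rc, D) ∈ P.epsRegion ε := by
  have := map_mem_closure (f := fun t : ℝ × ℝ × ℝ => (t.1 + (Ri - Ri'), t.2)) (by fun_prop) ht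
    (t := {t | P.Achievable ε t.1 t.2.1 t.2.2}) fun t ht => by
      obtain ⟨C, hC, he⟩ := ht
      exact ⟨C, ⟨(EReal.coe_le_coe_iff.2 (by linarith)).trans hC.1, hC.2⟩, he⟩
  simpa [Model.epsRegion] using this

variable [Fintype Xh]

/-- The direct part. -/
theorem Model.mem_epsRegion_of_mem_starRegion (P : Model X Y Z Xh) {ε Ri Rc D : ℝ} (hε : 0 ≤ ε)
    (hRi : 0 ≤ Ri) (h : (Ri, Rc, D) ∈ P.starRegion) : (Ri, Rc, D) ∈ P.epsRegion ε := by
  refine P.epsRegion_mono hε ?_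
  obtain ⟨k, -, Q, ⟨V, φ, hV, hQ⟩, h1, h2, h3⟩ := h
  have hV' : ∀ y, IsPMF (V y) := fun y => ⟨(hV y).1, (hV y).2⟩
  have hne : Nonempty Xh := by
    obtain ⟨t, -⟩ := Finset.nonempty_of_sum_ne_zero
      ((P.full_isPMF hV').sum_eq.trans_ne one_ne_zero)
    exact ⟨φ t.2 t.1.2.2⟩
  have hQ' := P.testLaw_eq_law hQ
  have e1 : mutualInfo Q (fun ω => ω.2.2.2.1) (fun ω => ω.2.2.1) =
      avg (P.full V) (P.densZ V) := by
    rw [P.avg_densZ hV', hQ']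
    simp only [mutualInfo, law_comp]
  have e2 : condMutualInfo Q (fun ω => ω.2.2.2.1) (fun ω => ω.2.1) (fun ω => ω.2.2.1) =
      avg (P.full V) (P.densY V) - avg (P.full V) (P.densZ V) := by
    rw [P.avg_densY_eq hV', add_sub_cancel_left, hQ']
    simp only [condMutualInfo, law_comp]
  have e3 : ∑ ω, Q ω * P.d ω.1 ω.2.2.2.2 =
      avg (P.full V) (fun t => P.d t.1.1 (φ t.2 t.1.2.2)) := by
    rw [hQ', sum_law _ _ (fun ω : X × Y × Z × Fin k × Xh => P.d ω.1 ω.2.2.2.2), avg]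
  dsimp only at h1 h2 h3
  rw [e1] at h1
  rw [e2] at h2
  rw [e3] at h3
  -- The direct part reaches only perturbed triples; the closure is approached as δ decreases to 0.
  refine mem_closure_of_tendsto (b := 𝓝[>] (0 : ℝ))
    (f := fun δ : ℝ => (Ri - 8 * δ, Rc + 16 * δ, D + 8 * δ)) ?_ ?_
  · have : Continuous fun δ : ℝ => (Ri - 8 * δ, Rc + 16 * δ, D + 8 * δ) := by fun_prop
    simpa using (this.tendsto 0).mono_left nhdsWithin_le_nhds
  · filter_upwards [self_mem_nhdsWithin] with δ hδ
    exact P.achievable_of_test hV' φ hRi hδ h1 h2 h3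

/-- The strong converse: achievable triples lie in the single-letter region. -/
theorem Model.mem_starRegion_of_mem_epsRegion (P : Model X Y Z Xh) {ε Ri Rc D : ℝ} (hε : ε < 1)
    (h : (Ri, Rc, D) ∈ P.epsRegion ε) : (Ri, Rc, D) ∈ P.starRegion := by
  refine P.mem_starRegion_of_codes fun γ hγ => ?_
  -- Half of γ pays for approximating the triple by an achievable one, the other half for the rates
  -- of its codes.
  obtain ⟨⟨a, b, c⟩, ⟨C, hC, he⟩, hd⟩ := Metric.mem_closure_iff.1 h (γ / 2) (half_pos hγ)
  simp only [Prod.dist_eq, max_lt_iff, Real.dist_eq, abs_lt] at hd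
  dsimp only at hC he
  -- Eventually the error is below (1 + ε)/2, so the success probability exceeds (1 - ε)/2, which
  -- beats e^{-γn} for large n.
  have h1 : (ε : EReal) < (((1 + ε) / 2 : ℝ) : EReal) := EReal.coe_lt_coe_iff.2 (by linarith)
  have h2 : Tendsto (fun n : ℕ => Real.exp (-γ) ^ n) atTop (𝓝 0) :=
    tendsto_pow_atTop_nhds_zero_of_lt_one (Real.exp_pos _).le (by simpa using hγ)
  obtain ⟨n, ⟨hn, hM, hL⟩, hP, hexp⟩ := ((hC.eventually (half_pos hγ)).and
    ((eventually_lt_of_limsup_lt (he.trans_lt h1)).and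
      (h2.eventually (gt_mem_nhds (show 0 < (1 - ε) / 2 by linarith))))).exists
  have hn' : (0 : ℝ) < n := Nat.cast_pos.2 hn
  refine ⟨n, hn, C n, le_trans ?_ hM, hL.trans ?_, ?_⟩
  · exact mul_le_mul_of_nonneg_left (by linarith [hd.1.2]) hn'.le
  · exact mul_le_mul_of_nonneg_left (by linarith [hd.2.1.1]) hn'.le
  · refine le_trans ?_ (P.correctProb_mono (C n) (show c ≤ D + γ by linarith [hd.2.2.1]))
    rw [EReal.coe_lt_coe_iff] at hP
    rw [← Real.exp_nat_mul, mul_comm] at hexp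
    rw [Model.correctProb]
    linarith

/-- Codes whose probability of success does not decay exponentially have rates in the region. -/
theorem Model.mem_region_of_frequently (P : Model X Y Z Xh) {Ri Rc D : ℝ}
    {C : ∀ n, Code Y Z Xh n} (hC : HasRates C Ri Rc)
    (h : ∀ γ : ℝ, 0 < γ → ∃ᶠ n : ℕ in atTop, Real.exp (-γ * n) < P.correctProb (C n) D) :
    (Ri, Rc, D) ∈ P.region := by
  have hstar : (max Ri 0, Rc, D) ∈ P.starRegion := by
    refine P.mem_starRegion_of_codes fun γ hγ => ?_
    obtain ⟨n, hP, hn, hM, hL⟩ := ((h γ hγ).and_eventually (hC.max_zero.eventually hγ)).exists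
    exact ⟨n, hn, C n, hM, hL, hP.le.trans (P.correctProb_mono (C n) (by linarith))⟩
  refine Set.mem_iInter₂.2 fun ε hε => P.mem_epsRegion_of_le (le_max_left Ri 0) ?_
  exact P.mem_epsRegion_of_mem_starRegion hε.1.le (le_max_right Ri 0) hstar

end Regions

end ContentId

end

theorem mainTheorem3 {X Y Z Xh : Type*} [Fintype X] [Fintype Y] [Fintype Z] [Fintype Xh]
    (P : ContentId.Model X Y Z Xh) :
    (∀ (Ri Rc D : ℝ) (C : ∀ n, ContentId.Code Y Z Xh n),
      ContentId.HasRates C Ri Rc → (Ri, Rc, D) ∉ P.region →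
        ∃ γ : ℝ, 0 < γ ∧
          ∀ᶠ n : ℕ in Filter.atTop, P.correctProb (C n) D ≤ Real.exp (-γ * (n : ℝ))) ∧
    (∀ ε ∈ Set.Ico (0 : ℝ) 1, ∀ Ri Rc D : ℝ, 0 ≤ Ri →
      ((Ri, Rc, D) ∈ P.epsRegion ε ↔ (Ri, Rc, D) ∈ P.starRegion)) := by
  refine ⟨fun Ri Rc D C hC h => ?_, fun ε hε Ri Rc D hRi =>
    ⟨P.mem_starRegion_of_mem_epsRegion hε.2, P.mem_epsRegion_of_mem_starRegion hε.1 hRi⟩⟩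
  -- Failure of every exponential bound means success above e^{-γn} infinitely often, for each γ >
  -- 0.
  by_contra! hc
  exact h (P.mem_region_of_frequently hC fun γ hγ => hc γ hγ)
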